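/- \textbf{Lemma (well-posedness of the weakly symmetric elliptic projection).} Let $\Omega\subset\mathbb R^2$ be a polygonal domain (bounded, open, connected, lying locally on one side of its boundary, which is a finite union of segments). Let $\Gamma^{u},\Gamma^{\sigma}\subset\partial\Omega$ be disjoint, relatively open and of positive length, with $\partial\Omega=\overline{\Gamma^{u}}\cup\overline{\Gamma^{\sigma}}$. Let $\mathcal T_h$ be a finite conforming mesh of $\Omega$ by simple polygons (every edge of an element lies on $\partial\Omega$ or is also an edge of another element; flat angles are allowed at vertices), such that every edge on $\partial\Omega$ lies in $\overline{\Gamma^{u}}$ or in $\overline{\Gamma^{\sigma}}$, and such that, for some $\eta_1,\eta_2>0$, each element $K$ of diameter $h_K$ is star-shaped with respect to a ball of radius greater than $\eta_1h_K$ and each edge of $K$ has length at least $\eta_2h_K$. Let $k\ge 1$ be an integer. Let $(\cdot,\cdot)$ denote the $L^2(\Omega)$ inner products of vector and tensor fields. The divergence and the (scalar) curl of a $2\times2$ tensor field are taken row by row, in the weak sense, so that both are vector fields. Put $$\mathbb S=\{\tau\in L^2(\Omega)^{2\times 2}:\operatorname{div}\tau\in L^2(\Omega)^2,\ \tau n=0\text{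 on }\Gamma^{\sigma}\},\quad V=L^2(\Omega)^2,\quad \mathbb K=\{\eta\in L^2(\Omega)^{2\times2}:\eta=-\eta^{T}\},$$ where $n$ is the outward unit normal. For $K\in\mathcal T_h$ let $\mathbb S(K)$ be the space of all $\tau\in L^2(K)^{2\times2}$ with $\operatorname{div}\tau\in P_k(K)^2$, $\operatorname{curl}\tau\in P_{k-1}(K)^2$ and $\tau n|_F\in P_k(F)^2$ for every edge $F$ of $K$, where $P_m$ denotes polynomials of total degree at most $m$. Let $$\mathbb S_h=\{\tau\in\mathbb S:\tau|_K\in\mathbb S(K)\ \forall K\in\mathcal T_h\},\quad V_h=\{v\in V:v|_K\in P_k(K)^2\ \forall K\in\mathcal T_h\},\quad \mathbb K_h=\{\eta\in\mathbb K:\eta|_K\in P_k(K)^{2\times2}\ \forall K\in\mathcal T_h\}.$$ Then for every $(\sigma_0,\sigma_1,u,r)\in\mathbb S\times\mathbb S\times V\times\mathbb K$ there is exactly one $(\sigma_{0,\pi},\sigma_{1,\pi},u_\pi,r_\pi)\in\mathbb S_h\times\mathbb S_h\times V_h\times\mathbb K_h$ such that $$\begin{aligned} (\sigma_{0,\pi}-\sigma_0,\tau_0)+(\operatorname{div}\tau_0,u_\pi-u)+(\tau_0,r_\pi-r)&=0&&\forall\,\tau_0\in\mathbb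 S_h,\\ (\sigma_{1,\pi}-\sigma_1,\tau_1)+(\operatorname{div}\tau_1,u_\pi-u)+(\tau_1,r_\pi-r)&=0&&\forall\,\tau_1\in\mathbb S_h,\\ (\operatorname{div}(\sigma_{0,\pi}+\sigma_{1,\pi}-\sigma_0-\sigma_1),w)&=0&&\forall\,w\in V_h,\\ (\sigma_{0,\pi}+\sigma_{1,\pi}-\sigma_0-\sigma_1,\eta)&=0&&\forall\,\eta\in\mathbb K_h. \end{aligned}$$ -/

import Mathlib

open MeasureTheory Set
open scoped ContDiff ENNReal

noncomputable section

namespace WeakSymVEM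

/-! ### Function spaces on subsets of the plane -/

/-- Points of the plane, and also vectors of the plane. -/
abbrev Pt : Type := EuclideanSpace ℝ (Fin 2)

/-- Real `2 × 2` tensors with the Frobenius inner product `σ : τ`. The entry in row `i` and
column `j` of `τ` is `τ (i, j)`. -/
abbrev Ten : Type := EuclideanSpace ℝ (Fin 2 × Fin 2)

/-- Vector fields in `L²(Ω)`; `inner ℝ u v` is `∫_Ω u · v`. -/
abbrev L2Vec (Ω : Set Pt) : Type := Lp Pt 2 (volume.restrict Ω)

/-- Tensor fields in `L²(Ω)`; `inner ℝ σ τ` is `∫_Ω σ : τ`. -/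
abbrev L2Ten (Ω : Set Pt) : Type := Lp Ten 2 (volume.restrict Ω)

/-- Smooth compactly supported real functions on the whole plane. -/
def IsTest (φ : Pt → ℝ) : Prop := ContDiff ℝ ∞ φ ∧ HasCompactSupport φ

/-- The partial derivative `∂φ/∂x_j`. -/
def pderiv (j : Fin 2) (φ : Pt → ℝ) (x : Pt) : ℝ := fderiv ℝ φ x (EuclideanSpace.single j 1)

/-- `f` is the row-wise weak divergence of `τ` in the open set `U`. -/
def IsWeakDiv (U : Set Pt) (τ : Pt → Ten) (f : Pt → Pt) : Prop :=
  ∀ φ : Pt → ℝ, IsTest φ → tsupport φ ⊆ U → ∀ i : Fin 2,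
    ∫ x in U, ∑ j : Fin 2, τ x (i, j) * pderiv j φ x = -∫ x in U, f x i * φ x

/-- `c` is the row-wise weak (scalar) curl of `τ` in the open set `U`: in the sense of
distributions, `c i = ∂ τ (i, 1) / ∂x_0 - ∂ τ (i, 0) / ∂x_1`. -/
def IsWeakCurl (U : Set Pt) (τ : Pt → Ten) (c : Pt → Pt) : Prop :=
  ∀ φ : Pt → ℝ, IsTest φ → tsupport φ ⊆ U → ∀ i : Fin 2,
    ∫ x in U, (τ x (i, 1) * pderiv 0 φ x - τ x (i, 0) * pderiv 1 φ x) = -∫ x in U, c x i * φ x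

/-- The boundary pairing `⟨(τ n)_i, φ⟩` over `∂U` of a tensor field `τ` whose weak divergence
is `f`, by Green's formula. -/
def normalPairing (U : Set Pt) (τ : Pt → Ten) (f : Pt → Pt) (φ : Pt → ℝ) (i : Fin 2) : ℝ :=
  ∫ x in U, (f x i * φ x + ∑ j : Fin 2, τ x (i, j) * pderiv j φ x)

/-- The space `H(div, Ω)` of tensor fields in `L²` with row-wise weak divergence in `L²`. -/
def HDiv (Ω : Set Pt) : Set (L2Ten Ω) := {τ | ∃ f : L2Vec Ω, IsWeakDiv Ω τ f}

open Classical in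
/-- The divergence of an element of `H(div, Ω)` (zero outside of this space). -/
def divergence {Ω : Set Pt} (τ : L2Ten Ω) : L2Vec Ω :=
  if h : ∃ f : L2Vec Ω, IsWeakDiv Ω τ f then h.choose else 0

theorem isWeakDiv_divergence {Ω : Set Pt} {τ : L2Ten Ω} (h : τ ∈ HDiv Ω) :
    IsWeakDiv Ω τ (divergence τ) := by
  have h' : ∃ f : L2Vec Ω, IsWeakDiv Ω τ f := h
  rw [divergence, dif_pos h']
  exact h'.choose_spec

/-- The weak divergence in `L²` of an open set is unique, so `divergence` does not depend on the
choice made in its definition. -/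
theorem divergence_eq {Ω : Set Pt} (hΩ : IsOpen Ω) {τ : L2Ten Ω} {f : L2Vec Ω}
    (h : IsWeakDiv Ω τ f) : divergence τ = f := by
  have h' := isWeakDiv_divergence (show τ ∈ HDiv Ω from ⟨f, h⟩)
  have key : ∀ i : Fin 2, ∀ᵐ x ∂(volume : Measure Pt), x ∈ Ω → divergence τ x i - f x i = 0 := by
    intro i
    have hd : ∀ g : L2Vec Ω, LocallyIntegrableOn (fun x => g x i) Ω := by
      intro g
      have h1 : LocallyIntegrable (fun x => g x) (volume.restrict Ω) :=
        (Lp.memLp g).locallyIntegrable (by norm_num)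
      have h2 : LocallyIntegrable (fun x => g x i) (volume.restrict Ω) := by
        intro x
        obtain ⟨s, hs, hi⟩ := h1 x
        exact ⟨s, hs, (EuclideanSpace.proj (𝕜 := ℝ) i).integrable_comp hi⟩
      exact locallyIntegrableOn_of_locallyIntegrable_restrict h2
    refine hΩ.ae_eq_zero_of_integral_contDiff_smul_eq_zero
      ((hd (divergence τ)).sub (hd f)) ?_
    intro φ h1 h2 h3
    have e1 := h φ ⟨h1, h2⟩ h3 i
    have e2 := h' φ ⟨h1, h2⟩ h3 i
    have hφ : ∀ g : L2Vec Ω, IntegrableOn (fun x => φ x * g x i) Ω := by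
      intro g
      have hs : IntegrableOn (fun x => φ x * g x i) (tsupport φ) := by
        have := (hd g).integrableOn_compact_subset h3 h2
        exact this.continuousOn_mul h1.continuous.continuousOn h2
      have := hs.integrable_of_forall_notMem_eq_zero (f := fun x => φ x * g x i) (by
        intro x hx
        rw [image_eq_zero_of_notMem_tsupport hx, zero_mul])
      exact this.integrableOn
    have e3 : ∫ x in Ω, φ x * divergence τ x i = ∫ x in Ω, φ x * f x i := by
      simp only [mul_comm (φ _)]
      linarith
    have e4 : ∫ x in Ω, φ x • (divergence τ x i - f x i) = 0 := by
      simp only [smul_eq_mul, mul_sub]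
      rw [integral_sub (hφ _) (hφ _), e3, sub_self]
    rw [← e4]
    symm
    apply setIntegral_eq_integral_of_forall_compl_eq_zero
    intro x hx
    rw [image_eq_zero_of_notMem_tsupport (fun hx' => hx (h3 hx')), zero_smul]
  apply Lp.ext
  filter_upwards [ae_restrict_of_ae (key 0), ae_restrict_of_ae (key 1),
    ae_restrict_mem hΩ.measurableSet] with x h0 h1 hx
  ext i
  fin_cases i
  · exact sub_eq_zero.1 (h0 hx)
  · exact sub_eq_zero.1 (h1 hx)

/-- The space of those `τ` in `H(div, Ω)` with `τ n = 0` on `Γσ`, a relatively open part of the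
boundary: the normal trace vanishes against all test functions whose support meets the
boundary only within `Γσ`. -/
def HDivStar (Ω Γσ : Set Pt) : Set (L2Ten Ω) :=
  {τ | τ ∈ HDiv Ω ∧ ∀ φ : Pt → ℝ, IsTest φ → tsupport φ ∩ frontier Ω ⊆ Γσ →
    ∀ i : Fin 2, normalPairing Ω τ (divergence τ) φ i = 0}

/-- The space of skew-symmetric tensor fields in `L²(Ω)`. -/
def L2Skew (Ω : Set Pt) : Set (L2Ten Ω) :=
  {η | ∀ᵐ x ∂(volume.restrict Ω), ∀ i j : Fin 2, η x (i, j) = -η x (j, i)}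

/-! ### Domains, polygons and meshes -/

/-- A polygonal domain (possibly with holes): a bounded, connected, nonempty open set bounded by
finitely many segments. The equality `interior (closure Ω) = Ω` says that the domain lies on one
side only of its boundary (no slits, no punctures). -/
structure IsPolygonalDomain (Ω : Set Pt) : Prop where
  isOpen : IsOpen Ω
  isConnected : IsConnected Ω
  isBounded : Bornology.IsBounded Ω
  interior_closure : interior (closure Ω) = Ω
  frontier_eq : ∃ s : Finset (Pt × Pt), frontier Ω = ⋃ p ∈ s, segment ℝ p.1 p.2

/-- `Γu` and `Γσ` are disjoint relatively open parts of `∂Ω` of positive length whose closures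
cover `∂Ω`. -/
structure IsBoundaryPartition (Ω Γu Γσ : Set Pt) : Prop where
  open_u : ∃ U : Set Pt, IsOpen U ∧ Γu = U ∩ frontier Ω
  open_σ : ∃ U : Set Pt, IsOpen U ∧ Γσ = U ∩ frontier Ω
  disjoint : Disjoint Γu Γσ
  cover : frontier Ω = closure Γu ∪ closure Γσ
  length_u : 0 < μH[1] Γu
  length_σ : 0 < μH[1] Γσ

/-- An (open) simple polygon with cyclically ordered vertices. Flat angles at vertices are allowed,
so that hanging nodes count as vertices. The interior `carrier` is determined by the vertices:
it is the bounded component of the complement of the closed polygonal curve. -/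
structure SimplePolygon where
  n : ℕ
  three_le : 3 ≤ n
  vertex : Fin n → Pt
  vertex_injective : Function.Injective vertex
  /-- Two different edges meet at most in common end points. -/
  simple : ∀ i j : Fin n, i ≠ j →
    segment ℝ (vertex i) (vertex (finRotate n i)) ∩ segment ℝ (vertex j) (vertex (finRotate n j)) ⊆
      {vertex i, vertex (finRotate n i)} ∩ {vertex j, vertex (finRotate n j)}
  carrier : Set Pt
  isOpen : IsOpen carrier
  isConnected : IsConnected carrier
  isBounded : Bornology.IsBounded carrier
  frontier_eq : frontier carrier = ⋃ i : Fin n, segment ℝ (vertex i) (vertex (finRotate n i))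

namespace SimplePolygon

/-- The `i`-th edge, a closed segment. -/
def edge (K : SimplePolygon) (i : Fin K.n) : Set Pt :=
  segment ℝ (K.vertex i) (K.vertex (finRotate K.n i))

/-- The length of the `i`-th edge. -/
def edgeLength (K : SimplePolygon) (i : Fin K.n) : ℝ :=
  dist (K.vertex i) (K.vertex (finRotate K.n i))

/-- The integral of `g` over the `i`-th edge with respect to arc length. -/
def edgeIntegral (K : SimplePolygon) (i : Fin K.n) (g : Pt → ℝ) : ℝ :=
  K.edgeLength i *
    ∫ t in (0 : ℝ)..1, g (AffineMap.lineMap (K.vertex i) (K.vertex (finRotate K.n i)) t)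

end SimplePolygon

/-- A polygonal mesh of `Ω`: finitely many disjoint polygons whose closures cover the closure
of `Ω`, such that every edge of an element lies on the boundary or is also an edge of
another element. -/
structure PolygonalMesh (Ω : Set Pt) where
  N : ℕ
  cell : Fin N → SimplePolygon
  subset : ∀ K, (cell K).carrier ⊆ Ω
  disjoint : ∀ K L, K ≠ L → Disjoint (cell K).carrier (cell L).carrier
  cover : closure Ω = ⋃ K, closure (cell K).carrier
  conforming : ∀ K i, (cell K).edge i ⊆ frontier Ω ∨
    ∃ L, L ≠ K ∧ ∃ j, (cell L).edge j = (cell K).edge i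

namespace PolygonalMesh

variable {Ω : Set Pt}

/-- Shape regularity: every element `K` is star-shaped with respect to (each point of) a ball of
radius greater than `η₁ h_K`, and its edges have length at least `η₂ h_K`, where `h_K` is the
diameter of `K`. -/
def ShapeRegular (T : PolygonalMesh Ω) (η₁ η₂ : ℝ) : Prop :=
  ∀ K, (∃ (c : Pt) (r : ℝ), η₁ * Metric.diam (T.cell K).carrier < r ∧
      ∀ y ∈ Metric.ball c r, StarConvex ℝ y (T.cell K).carrier) ∧
    ∀ i, η₂ * Metric.diam (T.cell K).carrier ≤ (T.cell K).edgeLength i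

/-- The mesh respects the boundary partition: every edge on `∂Ω` lies in the closure of one of
the two parts. -/
def Fits (T : PolygonalMesh Ω) (Γu Γσ : Set Pt) : Prop :=
  ∀ K i, (T.cell K).edge i ⊆ frontier Ω →
    (T.cell K).edge i ⊆ closure Γu ∨ (T.cell K).edge i ⊆ closure Γσ

end PolygonalMesh

/-! ### The discrete spaces -/

/-- The value at `x` of a polynomial in two variables. -/
def polyEval (p : MvPolynomial (Fin 2) ℝ) (x : Pt) : ℝ := MvPolynomial.eval (fun j => x j) p

/-- The vector field with polynomial components `p 0`, `p 1`. -/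
def polyField (p : Fin 2 → MvPolynomial (Fin 2) ℝ) (x : Pt) : Pt :=
  WithLp.toLp 2 fun i => polyEval (p i) x

/-- The local virtual space `S(K)` of order `k`: square integrable tensor fields on `K` with
divergence in `P_k(K)`, curl in `P_{k-1}(K)`, and normal trace `τ n` on `∂K` equal to
a polynomial (vector) of degree at most `k` on each edge. -/
def IsLocalStress (k : ℕ) (K : SimplePolygon) (τ : Pt → Ten) : Prop :=
  MemLp τ 2 (volume.restrict K.carrier) ∧
  (∃ c : Fin 2 → MvPolynomial (Fin 2) ℝ, (∀ i, (c i).totalDegree ≤ k - 1) ∧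
    IsWeakCurl K.carrier τ (polyField c)) ∧
  ∃ f : Fin 2 → MvPolynomial (Fin 2) ℝ, (∀ i, (f i).totalDegree ≤ k) ∧
    IsWeakDiv K.carrier τ (polyField f) ∧
    ∃ q : Fin K.n → Fin 2 → MvPolynomial (Fin 2) ℝ, (∀ e i, (q e i).totalDegree ≤ k) ∧
      ∀ φ : Pt → ℝ, IsTest φ → ∀ i : Fin 2,
        normalPairing K.carrier τ (polyField f) φ i =
          ∑ e : Fin K.n, K.edgeIntegral e (fun x => polyEval (q e i) x * φ x)

variable {Ω : Set Pt}

/-- The global virtual space `S_h`. -/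
def stressSpace (k : ℕ) (T : PolygonalMesh Ω) (Γσ : Set Pt) : Set (L2Ten Ω) :=
  {τ | τ ∈ HDivStar Ω Γσ ∧ ∀ K, IsLocalStress k (T.cell K) τ}

/-- The space `V_h` of piecewise polynomial vector fields of degree at most `k`. -/
def velocitySpace (k : ℕ) (T : PolygonalMesh Ω) : Set (L2Vec Ω) :=
  {v | ∀ K, ∃ p : Fin 2 → MvPolynomial (Fin 2) ℝ, (∀ i, (p i).totalDegree ≤ k) ∧
    ∀ᵐ x ∂(volume.restrict (T.cell K).carrier), ∀ i, v x i = polyEval (p i) x}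

/-- The space `K_h` of piecewise polynomial skew tensor fields of degree at most `k`. -/
def rotationSpace (k : ℕ) (T : PolygonalMesh Ω) : Set (L2Ten Ω) :=
  {η | η ∈ L2Skew Ω ∧
    ∀ K, ∃ p : Fin 2 × Fin 2 → MvPolynomial (Fin 2) ℝ, (∀ i, (p i).totalDegree ≤ k) ∧
      ∀ᵐ x ∂(volume.restrict (T.cell K).carrier), ∀ i, η x i = polyEval (p i) x}

/-- `(σ₀π, σ₁π, uπ, rπ)` solves the weakly symmetric elliptic projection system with data
`(σ₀, σ₁, u, r)`. -/
structure IsProjection (k : ℕ) (T : PolygonalMesh Ω) (Γσ : Set Pt)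
    (σ₀ σ₁ : L2Ten Ω) (u : L2Vec Ω) (r : L2Ten Ω)
    (σ₀π σ₁π : L2Ten Ω) (uπ : L2Vec Ω) (rπ : L2Ten Ω) : Prop where
  mem_stress₀ : σ₀π ∈ stressSpace k T Γσ
  mem_stress₁ : σ₁π ∈ stressSpace k T Γσ
  mem_velocity : uπ ∈ velocitySpace k T
  mem_rotation : rπ ∈ rotationSpace k T
  eq₀ : ∀ τ ∈ stressSpace k T Γσ,
    inner ℝ (σ₀π - σ₀) τ + inner ℝ (divergence τ) (uπ - u) + inner ℝ τ (rπ - r) = 0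
  eq₁ : ∀ τ ∈ stressSpace k T Γσ,
    inner ℝ (σ₁π - σ₁) τ + inner ℝ (divergence τ) (uπ - u) + inner ℝ τ (rπ - r) = 0
  eq_div : ∀ w ∈ velocitySpace k T, inner ℝ (divergence (σ₀π + σ₁π - σ₀ - σ₁)) w = 0
  eq_skew : ∀ η ∈ rotationSpace k T, inner ℝ (σ₀π + σ₁π - σ₀ - σ₁) η = 0

end WeakSymVEM

end

noncomputable section

namespace WeakSymVEM

/-! ### Gradients and rotated gradients of test functions -/

/-! The system is a saddle point problem with the identity on each of the two stress blocks. Let `S`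
be the discrete stress space, and for a multiplier `q = (v, η)` let `R q` in `S` represent `τ ↦ (div
τ, v) + (τ, η)`. The first two equations say that each stress is a known element of `S` minus `R q`.
Inserted in the two constraints, they leave the Schur complement equation `2 (R q, R q') = given`, a
Gram system on the finite-dimensional multiplier space. It is uniquely solvable as soon as `R` is
injective (`existsUnique_saddle`, `existsUnique_two_stress_saddle`). For `R` to exist, `S` has to be
complete and the divergence bounded on it. The space `S` is closed because it is the preimage of a
finite-dimensional space of polynomial data under a continuous map (`exists_closed_submodule`); the
divergence is then bounded by the closed graph theorem (`exists_divergence_clm`).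

Injectivity of `R` (`eq_zero_of_forall_pairing_eq_zero`) is the core. Suppose `(div τ, u) + (τ, r) =
0` for all `τ` in `S`, and let `ρ` be the upper right entry of `r`. Three families of stresses are
tested. (1) On each cell, project the rows of `r` to the closure of the rotated gradients. The
result has zero divergence, zero normal trace and curl `∇ρ`, of degree at most `k - 1`, so it is an
admissible stress. Its pairing with `r` is its squared norm, hence it vanishes and `ρ` is constant
on each cell (`exists_rotation_const`). (2) Now `r` is on each cell the gradient of a rigid motion,
with the translation still free. Choose the translation so that `F`, which is `u` minus the rigid
motion, has mean zero, and test with a curl free field of divergence `F` and zero normal trace. By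
Green's formula the pairing is `‖F‖²`, so `u` is that rigid motion (`exists_rigid`). (3) Stresses
with prescribed normal traces on edges now see only the edge integrals of the rigid motions
(`sum_edgeIntegral_eq_zero`). Taking the jump across a common edge, with opposite signs on the two
sides, shows that neighbours carry the same motion; taking the motion itself on an edge in the
closure of `Γu` shows that it is zero there. Cells are connected through common edges
(`eq_univ_of_neighbours`), so `u = 0` and `r = 0`.

The curl free fields are weak solutions of Neumann problems on the cells. By the Riesz theorem a
functional bounded by the norm of the gradient is represented by a limit of gradients, and the bound
follows from Poincaré and trace inequalities on sets star-shaped about a ball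
(`exists_field_div_normal`). -/

/-- The gradient of `φ`. -/
def grad (φ : Pt → ℝ) (x : Pt) : Pt := WithLp.toLp 2 fun j => pderiv j φ x

/-- The rotated gradient `(-∂φ/∂x_1, ∂φ/∂x_0)` of `φ`. -/
def rot (φ : Pt → ℝ) (x : Pt) : Pt := !₂[-pderiv 1 φ x, pderiv 0 φ x]

theorem inner_grad (v : Pt) (φ : Pt → ℝ) (x : Pt) :
    inner ℝ v (grad φ x) = ∑ j : Fin 2, v j * pderiv j φ x := by
  simp [grad, PiLp.inner_apply, mul_comm]

theorem inner_rot (v : Pt) (φ : Pt → ℝ) (x : Pt) :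
    inner ℝ v (rot φ x) = v 1 * pderiv 0 φ x - v 0 * pderiv 1 φ x := by
  simp [rot, PiLp.inner_apply, Fin.sum_univ_two]; ring

theorem inner_grad_left (v : Pt) (φ : Pt → ℝ) (x : Pt) :
    inner ℝ (grad φ x) v = fderiv ℝ φ x v := by
  rw [real_inner_comm, inner_grad]
  have : v = ∑ j : Fin 2, v j • EuclideanSpace.single j (1 : ℝ) := by
    ext i; fin_cases i <;> simp [Fin.sum_univ_two]
  conv_rhs => rw [this]
  simp [pderiv]

theorem norm_grad (φ : Pt → ℝ) (x : Pt) : ‖grad φ x‖ = ‖fderiv ℝ φ x‖ := by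
  have : fderiv ℝ φ x = innerSL ℝ (grad φ x) := by
    ext v; simp [inner_grad_left]
  rw [this, innerSL_apply_norm]

theorem IsTest.add {φ ψ : Pt → ℝ} (h : IsTest φ) (h' : IsTest ψ) : IsTest (φ + ψ) :=
  ⟨h.1.add h'.1, h.2.add h'.2⟩

theorem IsTest.const_smul {φ : Pt → ℝ} (h : IsTest φ) (c : ℝ) : IsTest (c • φ) :=
  ⟨h.1.const_smul c, h.2.mono (Function.support_const_smul_subset c φ)⟩

/-- The space of test functions on the plane. -/
def testSpace : Submodule ℝ (Pt → ℝ) where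
  carrier := {φ | IsTest φ}
  add_mem' := fun h h' => h.add h'
  zero_mem' := ⟨contDiff_const, HasCompactSupport.zero⟩
  smul_mem' := fun c _ h => h.const_smul c

/-- The space of test functions supported in `U`. -/
def testSpaceIn (U : Set Pt) : Submodule ℝ (Pt → ℝ) where
  carrier := {φ | IsTest φ ∧ tsupport φ ⊆ U}
  add_mem' := fun h h' => ⟨h.1.add h'.1, (tsupport_add _ _).trans (union_subset h.2 h'.2)⟩
  zero_mem' := ⟨testSpace.zero_mem, by simp⟩
  smul_mem' := fun c φ h => ⟨h.1.const_smul c,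
    (closure_mono (Function.support_const_smul_subset c φ)).trans h.2⟩

section Smooth

variable {φ ψ : Pt → ℝ}

theorem contDiff_pderiv (h : ContDiff ℝ ∞ φ) (j : Fin 2) : ContDiff ℝ ∞ (pderiv j φ) :=
  (h.fderiv_right (m := ∞) (by simp)).clm_apply contDiff_const

theorem IsTest.pderiv (h : IsTest φ) (j : Fin 2) : IsTest (pderiv j φ) :=
  ⟨contDiff_pderiv h.1 j, (h.2.fderiv_apply (𝕜 := ℝ) (EuclideanSpace.single j 1))⟩

theorem pderiv_add (h : ContDiff ℝ ∞ φ) (h' : ContDiff ℝ ∞ ψ) (j : Fin 2) (x : Pt) :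
    pderiv j (φ + ψ) x = pderiv j φ x + pderiv j ψ x := by
  simp [WeakSymVEM.pderiv, fderiv_add (h.differentiable (by simp) x)
    (h'.differentiable (by simp) x)]

theorem pderiv_const_smul (h : ContDiff ℝ ∞ φ) (c : ℝ) (j : Fin 2) (x : Pt) :
    pderiv j (c • φ) x = c * pderiv j φ x := by
  simp [WeakSymVEM.pderiv, fderiv_const_smul (h.differentiable (by simp) x)]

theorem grad_add (h : ContDiff ℝ ∞ φ) (h' : ContDiff ℝ ∞ ψ) : grad (φ + ψ) = grad φ + grad ψ := by
  ext x i; simp [grad, pderiv_add h h']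

theorem grad_const_smul (h : ContDiff ℝ ∞ φ) (c : ℝ) : grad (c • φ) = c • grad φ := by
  ext x i; simp [grad, pderiv_const_smul h]

theorem rot_add (h : ContDiff ℝ ∞ φ) (h' : ContDiff ℝ ∞ ψ) : rot (φ + ψ) = rot φ + rot ψ := by
  ext x i; fin_cases i <;> simp [rot, pderiv_add h h']; ring

theorem rot_const_smul (h : ContDiff ℝ ∞ φ) (c : ℝ) : rot (c • φ) = c • rot φ := by
  ext x i; fin_cases i <;> simp [rot, pderiv_const_smul h]

theorem continuous_grad (h : ContDiff ℝ ∞ φ) : Continuous (grad φ) := by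
  unfold grad
  have := fun j => (contDiff_pderiv h j).continuous
  fun_prop

theorem continuous_rot (h : ContDiff ℝ ∞ φ) : Continuous (rot φ) := by
  have h0 := (contDiff_pderiv h 0).continuous
  have h1 := (contDiff_pderiv h 1).continuous
  unfold rot
  refine (PiLp.continuous_toLp 2 _).comp (continuous_pi fun i => ?_)
  fin_cases i
  · exact h1.neg
  · exact h0

theorem memLp_of_continuous {F : Type*} [NormedAddCommGroup F] {K : Set Pt}
    (hK : Bornology.IsBounded K) {f : Pt → F} (h : Continuous f)
    (p : ℝ≥0∞) : MemLp f p (volume.restrict K) := by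
  have hc : IsCompact (closure K) := hK.isCompact_closure
  obtain ⟨C, hC⟩ := hc.exists_bound_of_continuousOn h.continuousOn
  have : IsFiniteMeasure (volume.restrict K) :=
    ⟨by simpa using hK.measure_lt_top⟩
  have : IsFiniteMeasure (volume.restrict (closure K)) :=
    ⟨by simpa using hc.measure_lt_top⟩
  have : MemLp f p (volume.restrict (closure K)) :=
    MemLp.of_bound h.aestronglyMeasurable C
      ((ae_restrict_iff' isClosed_closure.measurableSet).2 (Filter.Eventually.of_forall hC))
  exact this.mono_measure (Measure.restrict_mono subset_closure le_rfl)

theorem integrableOn_of_continuous {F : Type*} [NormedAddCommGroup F] {K : Set Pt}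
    (hK : Bornology.IsBounded K) {f : Pt → F} (h : Continuous f) : IntegrableOn f K :=
  memLp_one_iff_integrable.1 (memLp_of_continuous hK h 1)

/-- The rotated gradient of a function with compact support is divergence free. -/
theorem integral_rot_grad (hφ : IsTest φ) (hψ : ContDiff ℝ ∞ ψ) :
    ∫ x, inner ℝ (rot φ x) (grad ψ x) = 0 := by
  have hc := (contDiff_pderiv hψ)
  have key : ∀ i j : Fin 2,
      (∫ x, φ x * pderiv i (pderiv j ψ) x = - ∫ x, pderiv i φ x * pderiv j ψ x) ∧
      Integrable (fun x => pderiv i φ x * pderiv j ψ x) := by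
    intro i j
    have a1 : Integrable (fun x => pderiv i φ x * pderiv j ψ x) :=
      (((contDiff_pderiv hφ.1 i).continuous.mul (hc j).continuous).integrable_of_hasCompactSupport
        ((hφ.pderiv i).2.mul_right))
    refine ⟨integral_mul_fderiv_eq_neg_fderiv_mul_of_integrable a1 ?_ ?_ ?_ ?_, a1⟩
    · exact ((hφ.1.continuous.mul (contDiff_pderiv (hc j) i).continuous
        ).integrable_of_hasCompactSupport hφ.2.mul_right)
    · exact ((hφ.1.continuous.mul (hc j).continuous).integrable_of_hasCompactSupport
        hφ.2.mul_right)
    · exact fun x _ => hφ.1.differentiable (by simp) x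
    · exact fun x _ => (hc j).differentiable (by simp) x
  -- Moving the derivatives off `φ` leaves the two mixed second derivatives of `ψ`, which cancel.
  -- Only `φ` needs compact support.
  have sym : ∀ x, pderiv 0 (pderiv 1 ψ) x = pderiv 1 (pderiv 0 ψ) x := by
    intro x
    have h1 : ∀ i j : Fin 2, pderiv i (pderiv j ψ) x
        = fderiv ℝ (fderiv ℝ ψ) x (EuclideanSpace.single i 1) (EuclideanSpace.single j 1) := by
      intro i j
      have : DifferentiableAt ℝ (fderiv ℝ ψ) x :=
        ((hψ.fderiv_right (m := ∞) (by simp)).differentiable (by simp)) x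
      unfold WeakSymVEM.pderiv
      rw [fderiv_clm_apply this (differentiableAt_const _)]
      simp
    rw [h1, h1]
    exact (hψ.contDiffAt.isSymmSndFDerivAt (by
      simpa using WithTop.coe_le_coe.2 (le_top : (2 : ℕ∞) ≤ ⊤))) _ _
  have e : ∀ x, inner ℝ (rot φ x) (grad ψ x)
      = pderiv 0 φ x * pderiv 1 ψ x - pderiv 1 φ x * pderiv 0 ψ x := by
    intro x; rw [inner_grad]; simp [rot, Fin.sum_univ_two]; ring
  simp_rw [e]
  rw [integral_sub (key 0 1).2 (key 1 0).2]
  have h1 := (key 0 1).1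
  have h2 := (key 1 0).1
  simp_rw [sym] at h1
  linarith

theorem support_pderiv_subset (j : Fin 2) (φ : Pt → ℝ) :
    Function.support (pderiv j φ) ⊆ tsupport φ := by
  intro x hx
  by_contra h
  apply hx
  have : fderiv ℝ φ x = 0 := by
    by_contra h'
    exact h (support_fderiv_subset ℝ h')
  simp [WeakSymVEM.pderiv, this]

theorem pderiv_eq_zero_of_notMem {x : Pt} (h : x ∉ tsupport φ) (j : Fin 2) : pderiv j φ x = 0 := by
  by_contra h'
  exact h (support_pderiv_subset j φ h')

theorem rot_eq_zero_of_notMem {x : Pt} (h : x ∉ tsupport φ) : rot φ x = 0 := by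
  ext i; fin_cases i <;> simp [rot, pderiv_eq_zero_of_notMem h]

theorem setIntegral_rot_grad {U : Set Pt} (hφ : IsTest φ) (hU : tsupport φ ⊆ U)
    (hψ : ContDiff ℝ ∞ ψ) : ∫ x in U, inner ℝ (rot φ x) (grad ψ x) = 0 := by
  rw [← integral_rot_grad hφ hψ]
  apply setIntegral_eq_integral_of_forall_compl_eq_zero
  intro x hx
  rw [rot_eq_zero_of_notMem (fun h => hx (hU h)), inner_zero_left]

end Smooth

/-! ### Gradients and rotated gradients as orthogonal families in L² -/

theorem IsTest.memLp_grad {φ : Pt → ℝ} (h : IsTest φ) (U : Set Pt) :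
    MemLp (grad φ) 2 (volume.restrict U) := by
  refine MemLp.restrict U ((continuous_grad h.1).memLp_of_hasCompactSupport ?_)
  refine h.2.mono' fun x hx => ?_
  by_contra h'
  apply hx
  ext i
  simp [grad, pderiv_eq_zero_of_notMem h']

theorem IsTest.memLp_rot {φ : Pt → ℝ} (h : IsTest φ) (U : Set Pt) :
    MemLp (rot φ) 2 (volume.restrict U) := by
  refine MemLp.restrict U ((continuous_rot h.1).memLp_of_hasCompactSupport ?_)
  refine h.2.mono' fun x hx => ?_
  by_contra h'
  exact hx (rot_eq_zero_of_notMem h')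

/-- The gradients of test functions, as elements of `L²(U)`. -/
def gradL2 (U : Set Pt) : testSpace →ₗ[ℝ] L2Vec U where
  toFun φ := (IsTest.memLp_grad φ.2 U).toLp
  map_add' φ ψ := by
    rw [← MemLp.toLp_add]; congr 1; exact grad_add φ.2.1 ψ.2.1
  map_smul' c φ := by
    rw [RingHom.id_apply, ← MemLp.toLp_const_smul]; congr 1; exact grad_const_smul φ.2.1 c

/-- The rotated gradients of test functions supported in `U`, as elements of `L²(U)`. -/
def rotL2 (U : Set Pt) : testSpaceIn U →ₗ[ℝ] L2Vec U where
  toFun φ := (IsTest.memLp_rot φ.2.1 U).toLp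
  map_add' φ ψ := by
    rw [← MemLp.toLp_add]; congr 1; exact rot_add φ.2.1.1 ψ.2.1.1
  map_smul' c φ := by
    rw [RingHom.id_apply, ← MemLp.toLp_const_smul]; congr 1; exact rot_const_smul φ.2.1.1 c

theorem inner_L2_eq_of_ae {U : Set Pt} {E : Type*} [NormedAddCommGroup E] [InnerProductSpace ℝ E]
    (f g : Lp E 2 (volume.restrict U)) {f' g' : Pt → E}
    (hf : f =ᵐ[volume.restrict U] f') (hg : g =ᵐ[volume.restrict U] g') :
    inner ℝ f g = ∫ x in U, inner ℝ (f' x) (g' x) := by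
  rw [L2.inner_def]
  refine integral_congr_ae ?_
  filter_upwards [hf, hg] with x h1 h2
  rw [h1, h2]

theorem inner_gradL2 {U : Set Pt} (t : L2Vec U) (φ : testSpace) :
    inner ℝ t (gradL2 U φ) = ∫ x in U, inner ℝ (t x) (grad φ x) :=
  inner_L2_eq_of_ae _ _ (Filter.EventuallyEq.refl _ _) (MemLp.coeFn_toLp (φ.2.memLp_grad U))

theorem inner_rotL2 {U : Set Pt} (t : L2Vec U) (φ : testSpaceIn U) :
    inner ℝ t (rotL2 U φ) = ∫ x in U, inner ℝ (t x) (rot φ x) :=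
  inner_L2_eq_of_ae _ _ (Filter.EventuallyEq.refl _ _) (MemLp.coeFn_toLp (φ.2.1.memLp_rot U))

theorem inner_rotL2_gradL2 {U : Set Pt} (φ : testSpaceIn U) (ψ : testSpace) :
    inner ℝ (rotL2 U φ) (gradL2 U ψ) = 0 := by
  rw [← setIntegral_rot_grad φ.2.1 φ.2.2 ψ.2.1]
  exact inner_L2_eq_of_ae _ _ (MemLp.coeFn_toLp (φ.2.1.memLp_rot U))
    (MemLp.coeFn_toLp (ψ.2.memLp_grad U))

/-! ### Fields with prescribed divergence or curl -/

/-- A functional which is bounded by the norm of `G v` is represented by an element of the closure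
of the range of `G`. -/
theorem exists_mem_closure_range_inner_eq {V H : Type*} [AddCommGroup V] [Module ℝ V]
    [NormedAddCommGroup H] [InnerProductSpace ℝ H] [CompleteSpace H]
    (G : V →ₗ[ℝ] H) (L : V →ₗ[ℝ] ℝ) (C : ℝ) (hL : ∀ v, |L v| ≤ C * ‖G v‖) :
    ∃ t ∈ (LinearMap.range G).topologicalClosure, ∀ v, inner ℝ t (G v) = L v := by
  set M := (LinearMap.range G).topologicalClosure
  have : CompleteSpace M := (LinearMap.range G).isClosed_topologicalClosure.completeSpace_coe
  -- The bound forces `L` to vanish on the kernel of `G`, so `L` descends to a bounded functional on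
  -- the range. It is extended by Hahn–Banach, represented by Riesz, and the representative is
  -- projected to the closure of the range.
  have hker : LinearMap.ker G ≤ LinearMap.ker L := by
    intro v hv
    have := hL v
    rw [LinearMap.mem_ker.1 hv, norm_zero, mul_zero] at this
    exact abs_nonpos_iff.1 this
  let l : LinearMap.range G →ₗ[ℝ] ℝ :=
    ((LinearMap.ker G).liftQ L hker).comp G.quotKerEquivRange.symm.toLinearMap
  have hl : ∀ v, l ⟨G v, v, rfl⟩ = L v := by
    intro v
    have : G.quotKerEquivRange.symm ⟨G v, v, rfl⟩ = (LinearMap.ker G).mkQ v := by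
      rw [LinearEquiv.symm_apply_eq]; rfl
    simp [l, this]
  let lc : StrongDual ℝ (LinearMap.range G) := l.mkContinuous C (by
    rintro ⟨_, v, rfl⟩
    rw [hl]
    exact hL v)
  obtain ⟨g, hg, -⟩ := exists_extension_norm_eq _ lc
  let t := (InnerProductSpace.toDual ℝ H).symm g
  refine ⟨M.starProjection t, M.starProjection_apply_mem t, fun v => ?_⟩
  have hGv : G v ∈ M := (LinearMap.range G).le_topologicalClosure ⟨v, rfl⟩
  have h1 : inner ℝ (t - M.starProjection t) (G v) = 0 := by
    exact Submodule.starProjection_inner_eq_zero t _ hGv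
  rw [inner_sub_left, sub_eq_zero] at h1
  rw [← h1, InnerProductSpace.toDual_symm_apply]
  have := hg ⟨G v, v, rfl⟩
  rw [this]
  exact hl v

/-- A bounded functional of the gradient is represented by a curl free field. -/
theorem exists_curlFree_field {U : Set Pt} (L : testSpace →ₗ[ℝ] ℝ) (C : ℝ)
    (hL : ∀ φ, |L φ| ≤ C * ‖gradL2 U φ‖) :
    ∃ t : L2Vec U, (∀ φ : testSpace, ∫ x in U, inner ℝ (t x) (grad φ x) = L φ) ∧
      ∀ φ : testSpaceIn U, ∫ x in U, inner ℝ (t x) (rot φ x) = 0 := by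
  obtain ⟨t, ht, h⟩ := exists_mem_closure_range_inner_eq (gradL2 U) L C hL
  refine ⟨t, fun φ => by rw [← inner_gradL2, h], fun φ => ?_⟩
  rw [← inner_rotL2]
  -- Orthogonality to a rotated gradient holds for each gradient and is a closed condition, so it
  -- passes to the limit `t`.
  have : (LinearMap.range (gradL2 U)).topologicalClosure ≤ (ℝ ∙ rotL2 U φ)ᗮ := by
    refine Submodule.topologicalClosure_minimal _ ?_ (Submodule.isClosed_orthogonal _)
    rintro _ ⟨ψ, rfl⟩
    rw [Submodule.mem_orthogonal_singleton_iff_inner_right]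
    exact inner_rotL2_gradL2 φ ψ
  exact Submodule.mem_orthogonal_singleton_iff_inner_left.1 (this ht)

/-- The projection of a field to the rotated gradients has the same curl, no divergence and no
normal trace. -/
theorem exists_divFree_field {U : Set Pt} (w : L2Vec U) :
    ∃ t : L2Vec U, (∀ φ : testSpace, ∫ x in U, inner ℝ (t x) (grad φ x) = 0) ∧
      (∀ φ : testSpaceIn U,
        ∫ x in U, inner ℝ (t x) (rot φ x) = ∫ x in U, inner ℝ (w x) (rot φ x)) ∧
      inner ℝ t w = ‖t‖ ^ 2 := by
  set M := (LinearMap.range (rotL2 U)).topologicalClosure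
  have : CompleteSpace M := (LinearMap.range (rotL2 U)).isClosed_topologicalClosure.completeSpace_coe
  have ht := M.starProjection_apply_mem w
  set t := M.starProjection w
  refine ⟨t, fun φ => ?_, fun φ => ?_, ?_⟩
  · rw [← inner_gradL2]
    have : M ≤ (ℝ ∙ gradL2 U φ)ᗮ := by
      refine Submodule.topologicalClosure_minimal _ ?_ (Submodule.isClosed_orthogonal _)
      rintro _ ⟨ψ, rfl⟩
      rw [Submodule.mem_orthogonal_singleton_iff_inner_left]
      exact inner_rotL2_gradL2 ψ φ
    exact Submodule.mem_orthogonal_singleton_iff_inner_left.1 (this ht)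
  · rw [← inner_rotL2, ← inner_rotL2]
    have hm : rotL2 U φ ∈ M := (LinearMap.range (rotL2 U)).le_topologicalClosure ⟨φ, rfl⟩
    have := Submodule.starProjection_inner_eq_zero w _ hm
    rw [inner_sub_left, sub_eq_zero] at this
    exact this.symm
  · have := Submodule.starProjection_inner_eq_zero w t ht
    rw [inner_sub_left, sub_eq_zero] at this
    rw [real_inner_comm, this, real_inner_self_eq_norm_sq]

end WeakSymVEM

end

noncomputable section

namespace WeakSymVEM

/-! ### Poincaré and trace inequalities on star-shaped sets -/

/-- Shrinking towards the centre carries even boundary points into `K`: replace `x` by a nearby `x'`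
in `K` and absorb the error by moving the star centre within the ball. -/
theorem add_smul_sub_mem_of_starConvex {K : Set Pt} {c : Pt} {r : ℝ} (hr : 0 < r)
    (hK : ∀ y ∈ Metric.ball c r, StarConvex ℝ y K) {x : Pt} (hx : x ∈ closure K) {s : ℝ}
    (h0 : 0 ≤ s) (h1 : s < 1) : c + s • (x - c) ∈ K := by
  have hs : 0 < 1 - s := by linarith
  obtain ⟨x', hx', hd⟩ := Metric.mem_closure_iff.1 hx (r * (1 - s)) (by positivity)
  rw [dist_eq_norm] at hd
  -- This centre `y` is the solution of `(1 - s) y + s x' = c + s (x - c)`; the tolerance `r (1 -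
  -- s)` above is what keeps it in the ball.
  have hy : c + (s / (1 - s)) • (x - x') ∈ Metric.ball c r := by
    rw [mem_ball_iff_norm, add_sub_cancel_left, norm_smul, Real.norm_eq_abs,
      abs_of_nonneg (by positivity), div_mul_eq_mul_div, div_lt_iff₀ hs]
    nlinarith [norm_nonneg (x - x')]
  have := hK _ hy hx' hs.le h0 (by ring)
  convert this using 1
  rw [smul_add, smul_smul, mul_div_cancel₀ _ hs.ne']
  module

/-- Change of variables in the plane: the Jacobian factor is `s⁻²`, at most `4` for `s ≥ 1/2`. -/
theorem setLIntegral_comp_add_smul_le {K A : Set Pt} (hK : MeasurableSet K) (hA : MeasurableSet A)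
    {g : Pt → ℝ≥0∞} (hg : Measurable g) {v : Pt} {s : ℝ} (hs : 1 / 2 ≤ s)
    (h : ∀ x ∈ A, v + s • x ∈ K) :
    ∫⁻ x in A, g (v + s • x) ≤ 4 * ∫⁻ x in K, g x := by
  have hs0 : 0 < s := by linarith
  calc ∫⁻ x in A, g (v + s • x) ≤ ∫⁻ x in A, K.indicator g (v + s • x) := by
        refine setLIntegral_mono' hA fun x hx => ?_
        rw [indicator_of_mem (h x hx)]
    _ ≤ ∫⁻ x, K.indicator g (v + s • x) := setLIntegral_le_lintegral _ _
    _ = ∫⁻ x, K.indicator g (v + x) ∂(Measure.map (fun x : Pt => s • x) volume) := by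
        rw [lintegral_map (f := fun x => K.indicator g (v + x))
          ((hg.indicator hK).comp (measurable_const_add v)) (measurable_const_smul s)]
    _ = ENNReal.ofReal |(s ^ 2)⁻¹| * ∫⁻ x, K.indicator g x := by
        rw [Measure.map_addHaar_smul _ hs0.ne', lintegral_smul_measure]
        simp [lintegral_add_left_eq_self (fun x => K.indicator g x) v]
    _ ≤ 4 * ∫⁻ x in K, g x := by
        rw [lintegral_indicator hK]
        gcongr
        rw [show (4 : ℝ≥0∞) = ENNReal.ofReal 4 by norm_num]
        apply ENNReal.ofReal_le_ofReal
        rw [abs_of_pos (by positivity), inv_le_comm₀ (by positivity) (by norm_num)]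
        nlinarith

/-- Fundamental theorem of calculus along the segment from `y` to `x`, followed by Cauchy–Schwarz
pointwise. -/
theorem enorm_sub_le_lintegral_grad {φ : Pt → ℝ} (h : ContDiff ℝ ∞ φ) (x y : Pt) :
    ‖φ x - φ y‖ₑ ≤ ‖x - y‖ₑ * ∫⁻ t in Ioc (0 : ℝ) 1, ‖grad φ (y + t • (x - y))‖ₑ := by
  have hd : ∀ t : ℝ, HasDerivAt (fun t : ℝ => φ (y + t • (x - y)))
      (fderiv ℝ φ (y + t • (x - y)) (x - y)) t := by
    intro t
    have h1 : HasDerivAt (fun t : ℝ => y + t • (x - y)) (x - y) t := by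
      simpa using ((hasDerivAt_id t).smul_const (x - y)).const_add y
    exact ((h.differentiable (by simp)) _).hasFDerivAt.comp_hasDerivAt t h1
  have hc : Continuous fun t : ℝ => fderiv ℝ φ (y + t • (x - y)) (x - y) := by
    have := h.continuous_fderiv (by simp)
    fun_prop
  have e := intervalIntegral.integral_eq_sub_of_hasDerivAt (a := 0) (b := 1)
    (fun t _ => hd t) (hc.intervalIntegrable _ _)
  simp only [one_smul, add_sub_cancel, zero_smul, add_zero] at e
  rw [← e, intervalIntegral.integral_of_le zero_le_one]
  refine (enorm_integral_le_lintegral_enorm _).trans ?_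
  rw [← lintegral_const_mul' _ _ (by simp)]
  refine lintegral_mono fun t => ?_
  rw [mul_comm, ← inner_grad_left]
  have := norm_inner_le_norm (𝕜 := ℝ) (grad φ (y + t • (x - y))) (x - y)
  simp only [← ofReal_norm, ← ENNReal.ofReal_mul (norm_nonneg _)]
  exact ENNReal.ofReal_le_ofReal this

/-- Poincaré inequality on a set which is star-shaped with respect to a ball. -/
theorem exists_poincare_const {K : Set Pt} (hKo : IsOpen K) (hKb : Bornology.IsBounded K)
    (hne : K.Nonempty) {c : Pt} {r : ℝ} (hr : 0 < r)
    (hK : ∀ y ∈ Metric.ball c r, StarConvex ℝ y K) :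
    ∃ C : ℝ≥0∞, C ≠ ⊤ ∧ ∀ φ : Pt → ℝ, ContDiff ℝ ∞ φ →
      ∃ m : ℝ, ∫⁻ x in K, ‖φ x - m‖ₑ ≤ C * ∫⁻ x in K, ‖grad φ x‖ₑ := by
  obtain ⟨x₀, hx₀⟩ := hne
  set B := Metric.ball c r
  have hBK : B ⊆ K := fun y hy => (hK y hy).mem ⟨x₀, hx₀⟩
  have hBm : MeasurableSet B := measurableSet_ball
  have hB0 : volume B ≠ 0 := (Metric.measure_ball_pos _ _ hr).ne'
  have hBt : volume B ≠ ⊤ := measure_ball_lt_top.ne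
  have hKt : volume K ≠ ⊤ := hKb.measure_lt_top.ne
  obtain ⟨D, hD⟩ := Metric.isBounded_iff.1 hKb
  refine ⟨(ENNReal.ofReal D * (4 * (volume B + volume K))) / volume B,
    (ENNReal.div_lt_top (by finiteness) hB0).ne, fun φ hφ => ?_⟩
  have hgc : Continuous fun x => ‖grad φ x‖ₑ := (continuous_grad hφ).enorm
  set g : Pt → ℝ≥0∞ := fun x => ‖grad φ x‖ₑ
  set I := ∫⁻ x in K, g x
  have hφc := hφ.continuous
  -- The constant of the inequality is this double integral's bound divided by the volume of `B`,
  -- since `m` will be the value of `φ` at a point `y` of `B` where the inner integral is at most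
  -- its average.
  have main : ∫⁻ y in B, ∫⁻ x in K, ‖φ x - φ y‖ₑ
      ≤ ENNReal.ofReal D * (4 * (volume B + volume K)) * I := by
    calc ∫⁻ y in B, ∫⁻ x in K, ‖φ x - φ y‖ₑ
        ≤ ∫⁻ y in B, ∫⁻ x in K, ENNReal.ofReal D *
            ∫⁻ t in Ioc (0 : ℝ) 1, g (y + t • (x - y)) := by
          refine setLIntegral_mono' hBm fun y hy => setLIntegral_mono' hKo.measurableSet
            fun x hx => ?_
          refine (enorm_sub_le_lintegral_grad hφ x y).trans ?_
          gcongr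
          rw [← ofReal_norm, ← dist_eq_norm]
          exact ENNReal.ofReal_le_ofReal (hD hx (hBK hy))
      _ = ENNReal.ofReal D * ∫⁻ y in B, ∫⁻ x in K,
            ∫⁻ t in Ioc (0 : ℝ) 1, g (y + t • (x - y)) := by
          simp_rw [lintegral_const_mul' _ _ ENNReal.ofReal_ne_top]
      _ = ENNReal.ofReal D * ∫⁻ t in Ioc (0 : ℝ) 1, ∫⁻ y in B, ∫⁻ x in K,
            g (y + t • (x - y)) := by
          congr 1
          have e1 : ∀ y, ∫⁻ x in K, ∫⁻ t in Ioc (0 : ℝ) 1, g (y + t • (x - y))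
              = ∫⁻ t in Ioc (0 : ℝ) 1, ∫⁻ x in K, g (y + t • (x - y)) := by
            intro y
            refine lintegral_lintegral_swap (Measurable.aemeasurable ?_)
            exact Continuous.measurable (by unfold Function.uncurry; fun_prop)
          simp_rw [e1]
          refine lintegral_lintegral_swap (Measurable.aemeasurable ?_)
          refine Measurable.lintegral_prod_right'
            (f := fun p : (Pt × ℝ) × Pt => g (p.1.1 + p.1.2 • (p.2 - p.1.1))) ?_
          exact Continuous.measurable (by fun_prop)
      _ ≤ ENNReal.ofReal D * ∫⁻ t in Ioc (0 : ℝ) 1, 4 * (volume B + volume K) * I := by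
          refine mul_le_mul_right (setLIntegral_mono' measurableSet_Ioc fun t ht => ?_) _
          have hmem : ∀ y ∈ B, ∀ x ∈ K, y + t • (x - y) ∈ K := by
            intro y hy x hx
            have := hK y hy hx (sub_nonneg.2 ht.2) ht.1.le (by ring)
            convert this using 1
            module
          -- The point `(1 - t) y + t x` is a dilation in `x` with factor `t` and in `y` with factor
          -- `1 - t`. The substitution is made in the variable whose factor is at least `1/2`, so
          -- that the Jacobian stays bounded.
          rcases le_total (1 / 2) t with h2 | h2
          · calc ∫⁻ y in B, ∫⁻ x in K, g (y + t • (x - y))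
                ≤ ∫⁻ y in B, 4 * I := by
                  refine setLIntegral_mono' hBm fun y hy => ?_
                  have e : ∀ x, y + t • (x - y) = (1 - t) • y + t • x := fun x => by module
                  simp_rw [e]
                  refine setLIntegral_comp_add_smul_le hKo.measurableSet hKo.measurableSet
                    hgc.measurable h2 fun x hx => ?_
                  rw [← e]
                  exact hmem y hy x hx
              _ = 4 * volume B * I := by rw [setLIntegral_const]; ring
              _ ≤ _ := by gcongr; exact le_self_add
          · rw [lintegral_lintegral_swap (by
              refine Measurable.aemeasurable (Continuous.measurable ?_)
              unfold Function.uncurry; fun_prop)]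
            calc ∫⁻ x in K, ∫⁻ y in B, g (y + t • (x - y))
                ≤ ∫⁻ x in K, 4 * I := by
                  refine setLIntegral_mono' hKo.measurableSet fun x hx => ?_
                  have e : ∀ y, y + t • (x - y) = t • x + (1 - t) • y := fun x => by module
                  simp_rw [e]
                  refine setLIntegral_comp_add_smul_le hKo.measurableSet hBm
                    hgc.measurable (by linarith) fun y hy => ?_
                  rw [← e]
                  exact hmem y hy x hx
              _ = 4 * volume K * I := by rw [setLIntegral_const]; ring
              _ ≤ _ := by gcongr; exact le_add_self
      _ = _ := by simp [mul_assoc]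
  have hmeas : Measurable fun y => ∫⁻ x in K, ‖φ x - φ y‖ₑ :=
    Measurable.lintegral_prod_right' (f := fun p : Pt × Pt => ‖φ p.2 - φ p.1‖ₑ)
      (Continuous.measurable (by fun_prop))
  obtain ⟨y, hy, hle⟩ := exists_le_setLAverage hB0 hBt hmeas.aemeasurable
  refine ⟨φ y, hle.trans ?_⟩
  rw [setLAverage_eq, ENNReal.mul_comm_div, ← mul_div_assoc]
  gcongr

/-- The weight `s` makes the primitive vanish at the start of the segment, so that a point value of
`φ` is controlled by integrals along the segment with no contribution from its other end. -/
theorem enorm_mul_le_lintegral {φ : Pt → ℝ} (h : ContDiff ℝ ∞ φ) (z v : Pt) {s : ℝ} (h0 : 0 ≤ s)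
    (h1 : s ≤ 1) :
    ‖s * φ (z + s • v)‖ₑ ≤ ∫⁻ a in Ioo 0 s, (‖φ (z + a • v)‖ₑ + ‖v‖ₑ * ‖grad φ (z + a • v)‖ₑ) := by
  have hd : ∀ t : ℝ, HasDerivAt (fun t : ℝ => t * φ (z + t • v))
      (φ (z + t • v) + t * fderiv ℝ φ (z + t • v) v) t := by
    intro t
    have h1 : HasDerivAt (fun t : ℝ => z + t • v) v t := by
      simpa using ((hasDerivAt_id t).smul_const v).const_add z
    have := (hasDerivAt_id t).mul
      (((h.differentiable (by simp)) (z + t • v)).hasFDerivAt.comp_hasDerivAt t h1)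
    simpa [Pi.mul_def, Function.comp_def] using this
  have hc : Continuous fun t : ℝ => φ (z + t • v) + t * fderiv ℝ φ (z + t • v) v := by
    have := h.continuous_fderiv (by simp)
    have := h.continuous
    fun_prop
  have e := intervalIntegral.integral_eq_sub_of_hasDerivAt (a := 0) (b := s)
    (fun t _ => hd t) (hc.intervalIntegrable _ _)
  simp only [zero_mul, sub_zero] at e
  rw [← e, intervalIntegral.integral_of_le h0, integral_Ioc_eq_integral_Ioo]
  refine (enorm_integral_le_lintegral_enorm _).trans ?_
  refine setLIntegral_mono' measurableSet_Ioo fun t ht => ?_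
  refine (enorm_add_le _ _).trans ?_
  gcongr
  rw [mul_comm ‖v‖ₑ, ← inner_grad_left]
  have := norm_inner_le_norm (𝕜 := ℝ) (grad φ (z + t • v)) v
  simp only [← ofReal_norm, ← ENNReal.ofReal_mul (norm_nonneg _)]
  refine ENNReal.ofReal_le_ofReal ?_
  rw [norm_mul, Real.norm_of_nonneg ht.1.le]
  exact (mul_le_of_le_one_left (norm_nonneg _) (ht.2.le.trans h1)).trans this

/-- Trace inequality for a segment in the closure of a set which is star-shaped with respect to
a ball. -/
theorem exists_trace_const {K : Set Pt} (hKo : IsOpen K) {c : Pt} {r : ℝ} (hr : 0 < r)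
    (hK : ∀ y ∈ Metric.ball c r, StarConvex ℝ y K) {P Q : Pt} (hPQ : segment ℝ P Q ⊆ closure K)
    (hind : ∀ a b : ℝ, a • (P - c) + b • (Q - c) = 0 → a = 0 ∧ b = 0) :
    ∃ C : ℝ≥0∞, C ≠ ⊤ ∧ ∀ φ : Pt → ℝ, ContDiff ℝ ∞ φ →
      ∫⁻ t in Ioc (0 : ℝ) 1, ‖φ (AffineMap.lineMap P Q t)‖ₑ ≤
        C * ((∫⁻ x in K, ‖φ x‖ₑ) + ∫⁻ x in K, ‖grad φ x‖ₑ) := by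
  set v := P - c
  set w := Q - c
  -- In the coordinates `(a, b)` about `c`, the triangle with vertices `c`, `P`, `Q` becomes the
  -- standard one; all of it except the side `PQ` lies in `K`.
  have hmem : ∀ a b : ℝ, 0 ≤ a → 0 ≤ b → a + b < 1 → c + (a • v + b • w) ∈ K := by
    intro a b ha hb hab
    rcases eq_or_lt_of_le (add_nonneg ha hb) with h | h
    · have ha' : a = 0 := by linarith
      have hb' : b = 0 := by linarith
      have := add_smul_sub_mem_of_starConvex hr hK (hPQ (left_mem_segment ℝ P Q)) le_rfl
        zero_lt_one
      simpa [ha', hb'] using this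
    · have hz : (a / (a + b)) • P + (b / (a + b)) • Q ∈ segment ℝ P Q :=
        ⟨_, _, by positivity, by positivity, by field_simp, rfl⟩
      have := add_smul_sub_mem_of_starConvex hr hK (hPQ hz) h.le hab
      convert this using 2
      rw [smul_sub (a + b), smul_add (a + b), smul_smul, smul_smul, mul_div_cancel₀ _ h.ne',
        mul_div_cancel₀ _ h.ne']
      module
  let A₀ : ℝ × ℝ →ₗ[ℝ] Pt :=
    (LinearMap.toSpanSingleton ℝ Pt v).coprod (LinearMap.toSpanSingleton ℝ Pt w)
  have hA₀ : ∀ p : ℝ × ℝ, A₀ p = p.1 • v + p.2 • w := fun p => by simp [A₀]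
  have hinj : Function.Injective A₀ := by
    rw [← LinearMap.ker_eq_bot, LinearMap.ker_eq_bot']
    intro p hp
    rw [hA₀] at hp
    exact Prod.ext (hind _ _ hp).1 (hind _ _ hp).2
  let A : (ℝ × ℝ) ≃L[ℝ] Pt :=
    (LinearEquiv.ofInjectiveOfFinrankEq A₀ hinj (by simp)).toContinuousLinearEquiv
  have hA : ∀ p : ℝ × ℝ, A p = p.1 • v + p.2 • w := hA₀
  have := A.isAddHaarMeasure_map (volume : Measure (ℝ × ℝ))
  -- By uniqueness of Haar measure the linear coordinates change volume by some constant factor,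
  -- whose value plays no role.
  obtain ⟨κ, hκ⟩ : ∃ κ : NNReal, Measure.map A (volume : Measure (ℝ × ℝ)) = κ • volume :=
    ⟨_, Measure.isAddLeftInvariant_eq_smul _ _⟩
  have cv : ∀ F : Pt → ℝ≥0∞, Measurable F →
      ∫⁻ p : ℝ × ℝ, F (c + (p.1 • v + p.2 • w)) = κ * ∫⁻ x, F x := by
    intro F hF
    simp_rw [← hA]
    rw [← lintegral_map (f := fun x => F (c + x)) (hF.comp (measurable_const_add c))
      A.continuous.measurable, hκ, lintegral_smul_measure, lintegral_add_left_eq_self F c]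
    rfl
  set D : ℝ≥0∞ := 1 + ‖v‖ₑ + ‖w‖ₑ
  refine ⟨2 * κ * D, by finiteness, fun φ hφ => ?_⟩
  have hφc := hφ.continuous
  have hgc := continuous_grad hφ
  set h : Pt → ℝ≥0∞ := fun x => ‖φ x‖ₑ + D * ‖grad φ x‖ₑ
  have hh : Measurable h := by
    have h1 := hφc.enorm.measurable
    have h2 := hgc.enorm.measurable
    fun_prop
  have hF : Measurable (K.indicator h) := hh.indicator hKo.measurableSet
  have line : ∀ t ∈ Ioc (0 : ℝ) 1, ‖φ (AffineMap.lineMap P Q t)‖ₑ ≤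
      (∫⁻ a : ℝ, K.indicator h (c + (a • v + t • w))) +
        ∫⁻ b : ℝ, K.indicator h (c + ((1 - t) • v + b • w)) := by
    intro t ht
    have e : AffineMap.lineMap P Q t = c + ((1 - t) • v + t • w) := by
      simp only [AffineMap.lineMap_apply_module, v, w]; module
    rw [e]
    -- The value on the edge is split with weights `1 - t` and `t`. The first part is integrated
    -- along a segment parallel to `v`, the second along one parallel to `w`, and each weight is the
    -- length parameter that the preceding weighted estimate needs. Integrating in `t` then turns
    -- both into integrals over the triangle, with no singularity at `P` or `Q`.
    have e2 : φ (c + ((1 - t) • v + t • w)) = (1 - t) * φ ((c + t • w) + (1 - t) • v)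
        + t * φ ((c + (1 - t) • v) + t • w) := by
      rw [show (c + t • w) + (1 - t) • v = c + ((1 - t) • v + t • w) by module,
        show (c + (1 - t) • v) + t • w = c + ((1 - t) • v + t • w) by module]
      ring
    rw [e2]
    refine (enorm_add_le _ _).trans (add_le_add ?_ ?_)
    · refine (enorm_mul_le_lintegral hφ _ _ (by linarith [ht.2]) (by linarith [ht.1])).trans ?_
      refine le_trans ?_ (setLIntegral_le_lintegral (Ioo 0 (1 - t)) _)
      refine setLIntegral_mono' measurableSet_Ioo fun a ha => ?_
      rw [show c + (a • v + t • w) = c + t • w + a • v by module, indicator_of_mem]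
      · simp only [h]
        gcongr
        simp only [D]
        rw [add_assoc, add_left_comm]
        exact le_self_add
      · rw [show c + t • w + a • v = c + (a • v + t • w) by module]
        exact hmem a t ha.1.le ht.1.le (by linarith [ha.2])
    · refine (enorm_mul_le_lintegral hφ _ _ ht.1.le ht.2).trans ?_
      refine le_trans ?_ (setLIntegral_le_lintegral (Ioo 0 t) _)
      refine setLIntegral_mono' measurableSet_Ioo fun b hb => ?_
      rw [← add_assoc, indicator_of_mem]
      · simp only [h]
        gcongr
        exact le_add_self
      · rw [add_assoc]
        exact hmem (1 - t) b (by linarith [ht.2]) hb.1.le (by linarith [hb.2])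
  have hcomp : Measurable fun p : ℝ × ℝ => K.indicator h (c + (p.1 • v + p.2 • w)) :=
    hF.comp (Continuous.measurable (by fun_prop))
  have hcomp' : Measurable fun p : ℝ × ℝ => K.indicator h (c + (p.2 • v + p.1 • w)) :=
    hF.comp (Continuous.measurable (by fun_prop))
  have i1 : ∫⁻ t : ℝ, ∫⁻ a : ℝ, K.indicator h (c + (a • v + t • w)) = κ * ∫⁻ x in K, h x := by
    rw [← lintegral_indicator hKo.measurableSet, ← cv _ hF]
    exact (lintegral_prod_symm' _ hcomp).symm
  have i2 : ∫⁻ t in Ioc (0 : ℝ) 1, ∫⁻ b : ℝ, K.indicator h (c + ((1 - t) • v + b • w))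
      ≤ κ * ∫⁻ x in K, h x := by
    refine (setLIntegral_le_lintegral _ _).trans ?_
    rw [lintegral_sub_left_eq_self
      (fun t => ∫⁻ b : ℝ, K.indicator h (c + (t • v + b • w))) 1,
      ← lintegral_indicator hKo.measurableSet, ← cv _ hF]
    exact (lintegral_prod _ hcomp.aemeasurable).symm.le
  calc ∫⁻ t in Ioc (0 : ℝ) 1, ‖φ (AffineMap.lineMap P Q t)‖ₑ
      ≤ ∫⁻ t in Ioc (0 : ℝ) 1, ((∫⁻ a : ℝ, K.indicator h (c + (a • v + t • w))) +
        ∫⁻ b : ℝ, K.indicator h (c + ((1 - t) • v + b • w))) :=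
        setLIntegral_mono' measurableSet_Ioc line
    _ = (∫⁻ t in Ioc (0 : ℝ) 1, ∫⁻ a : ℝ, K.indicator h (c + (a • v + t • w))) +
        ∫⁻ t in Ioc (0 : ℝ) 1, ∫⁻ b : ℝ, K.indicator h (c + ((1 - t) • v + b • w)) :=
        lintegral_add_left (Measurable.lintegral_prod_right' hcomp') _
    _ ≤ κ * (∫⁻ x in K, h x) + κ * ∫⁻ x in K, h x :=
        add_le_add ((setLIntegral_le_lintegral _ _).trans i1.le) i2
    _ = 2 * κ * ∫⁻ x in K, h x := by ring
    _ = 2 * κ * ((∫⁻ x in K, ‖φ x‖ₑ) + D * ∫⁻ x in K, ‖grad φ x‖ₑ) := by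
        rw [lintegral_add_left hφc.enorm.measurable, lintegral_const_mul _ hgc.enorm.measurable]
    _ ≤ 2 * κ * (D * (∫⁻ x in K, ‖φ x‖ₑ) + D * ∫⁻ x in K, ‖grad φ x‖ₑ) := by
        gcongr
        refine le_mul_of_one_le_left zero_le ?_
        simp only [D]
        rw [add_assoc]
        exact le_self_add
    _ = _ := by ring

/-! ### Neumann problems on a star-shaped cell -/

theorem integrableOn_inner_grad {U : Set Pt} (t : L2Vec U) {φ : Pt → ℝ} (hφ : IsTest φ) :
    IntegrableOn (fun x => inner ℝ (t x) (grad φ x)) U := by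
  refine (L2.integrable_inner (𝕜 := ℝ) t (gradL2 U ⟨φ, hφ⟩)).congr ?_
  filter_upwards [MemLp.coeFn_toLp (hφ.memLp_grad U)] with x hx
  rw [← hx]; rfl

/-- Cauchy–Schwarz on a cell; it links the L¹ Poincaré and trace inequalities with the L² norm in
which the Riesz argument runs. -/
theorem lintegral_grad_le {K : Set Pt} (φ : testSpace) :
    ∫⁻ x in K, ‖grad φ x‖ₑ ≤ ‖gradL2 K φ‖ₑ * volume K ^ (1 / 2 : ℝ) := by
  rw [← eLpNorm_one_eq_lintegral_enorm]
  refine (eLpNorm_le_eLpNorm_mul_rpow_measure_univ (p := 1) (q := 2) (by norm_num)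
    (φ.2.memLp_grad K).1).trans (le_of_eq ?_)
  rw [Measure.restrict_apply_univ, gradL2]
  simp only [LinearMap.coe_mk, AddHom.coe_mk]
  rw [Lp.enorm_toLp]
  norm_num

/-- In a set which is star-shaped with respect to a ball there is a curl free field with given
divergence `f` and normal trace `q` on a segment of the boundary, zero elsewhere on the boundary. -/
theorem exists_field_div_normal {K : Set Pt} (hKo : IsOpen K) (hKb : Bornology.IsBounded K)
    (hne : K.Nonempty) {c : Pt} {r : ℝ} (hr : 0 < r)
    (hK : ∀ y ∈ Metric.ball c r, StarConvex ℝ y K) {P Q : Pt} (hPQ : segment ℝ P Q ⊆ closure K)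
    (hind : ∀ a b : ℝ, a • (P - c) + b • (Q - c) = 0 → a = 0 ∧ b = 0)
    {f q : Pt → ℝ} (hf : Continuous f) (hq : Continuous q)
    (hfq : ∫ x in K, f x = ∫ s in (0 : ℝ)..1, q (AffineMap.lineMap P Q s)) :
    ∃ t : L2Vec K,
      (∀ φ, IsTest φ → ∫ x in K, (f x * φ x + inner ℝ (t x) (grad φ x)) =
        ∫ s in (0 : ℝ)..1, q (AffineMap.lineMap P Q s) * φ (AffineMap.lineMap P Q s)) ∧
      ∀ φ, IsTest φ → tsupport φ ⊆ K → ∫ x in K, inner ℝ (t x) (rot φ x) = 0 := by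
  have hlc : Continuous fun s : ℝ => (AffineMap.lineMap P Q s : Pt) :=
    AffineMap.lineMap_continuous
  have int1 : ∀ φ : Pt → ℝ, Continuous φ → IntegrableOn (fun x => f x * φ x) K := fun φ h =>
    integrableOn_of_continuous hKb (hf.mul h)
  have int2 : ∀ φ : Pt → ℝ, Continuous φ → IntervalIntegrable
      (fun s => q (AffineMap.lineMap P Q s) * φ (AffineMap.lineMap P Q s)) volume 0 1 :=
    fun φ h => ((hq.comp hlc).mul (h.comp hlc)).intervalIntegrable _ _
  let L : testSpace →ₗ[ℝ] ℝ :=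
    { toFun := fun φ => (∫ s in (0 : ℝ)..1,
        q (AffineMap.lineMap P Q s) * φ.1 (AffineMap.lineMap P Q s)) - ∫ x in K, f x * φ.1 x
      map_add' := fun φ ψ => by
        simp only [Submodule.coe_add, Pi.add_apply, mul_add]
        rw [intervalIntegral.integral_add (int2 _ φ.2.1.continuous) (int2 _ ψ.2.1.continuous),
          integral_add (int1 _ φ.2.1.continuous) (int1 _ ψ.2.1.continuous)]
        ring
      map_smul' := fun a φ => by
        simp only [Submodule.coe_smul, Pi.smul_apply, smul_eq_mul, mul_left_comm _ a,
          intervalIntegral.integral_const_mul, integral_const_mul, RingHom.id_apply]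
        ring }
  obtain ⟨C₁, hC₁, h₁⟩ := exists_poincare_const hKo hKb hne hr hK
  obtain ⟨C₂, hC₂, h₂⟩ := exists_trace_const hKo hr hK hPQ hind
  obtain ⟨M₁, hM₁⟩ := hKb.isCompact_closure.exists_bound_of_continuousOn hf.continuousOn
  obtain ⟨M₂, hM₂⟩ := (isCompact_Icc (a := (0 : ℝ)) (b := 1)).exists_bound_of_continuousOn
    (hq.comp hlc).continuousOn
  set C : ℝ≥0∞ := (ENNReal.ofReal M₂ * (C₂ * (C₁ + 1)) + ENNReal.ofReal M₁ * C₁) *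
    volume K ^ (1 / 2 : ℝ)
  have hKt : volume K ≠ ⊤ := hKb.measure_lt_top.ne
  have hC : C ≠ ⊤ := by
    have := ENNReal.rpow_ne_top_of_nonneg (by norm_num : (0 : ℝ) ≤ 1 / 2) hKt
    finiteness
  have bound : ∀ φ : testSpace, ‖L φ‖ₑ ≤ C * ‖gradL2 K φ‖ₑ := by
    intro φ
    obtain ⟨m, hm⟩ := h₁ φ φ.2.1
    have hφc := φ.2.1.continuous
    -- Subtracting the constant destroys compact support; hence the Poincaré and trace inequalities
    -- are stated for all smooth functions.
    set ψ : Pt → ℝ := fun x => φ.1 x - m with hψ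
    have hψs : ContDiff ℝ ∞ ψ := φ.2.1.sub contDiff_const
    have hgrad : grad ψ = grad φ := by
      ext x j
      simp only [grad, pderiv, hψ, fderiv_sub_const]
    -- The compatibility condition `hfq` says exactly that the functional kills constants.
    have e : L φ = (∫ s in (0 : ℝ)..1,
        q (AffineMap.lineMap P Q s) * ψ (AffineMap.lineMap P Q s)) - ∫ x in K, f x * ψ x := by
      simp only [hψ, mul_sub]
      rw [intervalIntegral.integral_sub (int2 _ hφc) (int2 (fun _ => m) continuous_const),
        integral_sub (int1 _ hφc) (int1 (fun _ => m) continuous_const),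
        intervalIntegral.integral_mul_const, integral_mul_const, hfq]
      simp [L]
    have b1 : ‖∫ s in (0 : ℝ)..1, q (AffineMap.lineMap P Q s) * ψ (AffineMap.lineMap P Q s)‖ₑ
        ≤ ENNReal.ofReal M₂ * ∫⁻ s in Ioc (0 : ℝ) 1, ‖ψ (AffineMap.lineMap P Q s)‖ₑ := by
      rw [intervalIntegral.integral_of_le zero_le_one,
        ← lintegral_const_mul' _ _ ENNReal.ofReal_ne_top]
      refine (enorm_integral_le_lintegral_enorm _).trans
        (setLIntegral_mono' measurableSet_Ioc fun s hs => ?_)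
      rw [enorm_mul]
      gcongr
      rw [← ofReal_norm]
      exact ENNReal.ofReal_le_ofReal (hM₂ s (Ioc_subset_Icc_self hs))
    have b2 : ‖∫ x in K, f x * ψ x‖ₑ ≤ ENNReal.ofReal M₁ * ∫⁻ x in K, ‖ψ x‖ₑ := by
      rw [← lintegral_const_mul' _ _ ENNReal.ofReal_ne_top]
      refine (enorm_integral_le_lintegral_enorm _).trans
        (setLIntegral_mono' hKo.measurableSet fun x hx => ?_)
      rw [enorm_mul]
      gcongr
      rw [← ofReal_norm]
      exact ENNReal.ofReal_le_ofReal (hM₁ x (subset_closure hx))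
    have b3 := h₂ ψ hψs
    rw [hgrad] at b3
    set G := ∫⁻ x in K, ‖grad φ x‖ₑ
    calc ‖L φ‖ₑ ≤ ENNReal.ofReal M₂ * (C₂ * (C₁ * G + G)) + ENNReal.ofReal M₁ * (C₁ * G) := by
          rw [e]
          refine (enorm_sub_le).trans (add_le_add (b1.trans ?_) (b2.trans ?_))
          · gcongr
            exact b3.trans (by gcongr)
          · gcongr
      _ = (ENNReal.ofReal M₂ * (C₂ * (C₁ + 1)) + ENNReal.ofReal M₁ * C₁) * G := by ring
      _ ≤ (ENNReal.ofReal M₂ * (C₂ * (C₁ + 1)) + ENNReal.ofReal M₁ * C₁) *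
          (‖gradL2 K φ‖ₑ * volume K ^ (1 / 2 : ℝ)) := by
          gcongr
          exact lintegral_grad_le φ
      _ = C * ‖gradL2 K φ‖ₑ := by ring
  obtain ⟨t, ht, ht'⟩ := exists_curlFree_field (U := K) L C.toReal (fun φ => by
    have := (ENNReal.toReal_le_toReal (by simp) (by finiteness)).2 (bound φ)
    simpa using this)
  refine ⟨t, fun φ hφ => ?_, fun φ hφ hs => ht' ⟨φ, hφ, hs⟩⟩
  rw [integral_add (int1 _ hφ.1.continuous) (integrableOn_inner_grad t hφ), ht ⟨φ, hφ⟩]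
  simp [L]

end WeakSymVEM

end

noncomputable section

namespace WeakSymVEM

/-! ### Geometry of edges of star-shaped cells -/

open Filter Topology

/-- Twice the signed area of the triangle with vertices `P`, `Q`, `y`. -/
def side (P Q y : Pt) : ℝ := (Q 0 - P 0) * (y 1 - P 1) - (Q 1 - P 1) * (y 0 - P 0)

theorem continuous_side (P Q : Pt) : Continuous (side P Q) := by
  unfold side; fun_prop

theorem normSq_pos {P Q : Pt} (h : P ≠ Q) : 0 < (Q 0 - P 0) ^ 2 + (Q 1 - P 1) ^ 2 := by
  by_contra! h'
  apply h
  ext i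
  fin_cases i
  · simp only [Fin.zero_eta]; nlinarith [sq_nonneg (Q 0 - P 0), sq_nonneg (Q 1 - P 1)]
  · simp only [Fin.mk_one]; nlinarith [sq_nonneg (Q 0 - P 0), sq_nonneg (Q 1 - P 1)]

/-- The coordinate along the line through `P` and `Q` of the orthogonal projection of `y`. -/
def lineCoord (P Q y : Pt) : ℝ :=
  ((y 0 - P 0) * (Q 0 - P 0) + (y 1 - P 1) * (Q 1 - P 1)) /
    ((Q 0 - P 0) ^ 2 + (Q 1 - P 1) ^ 2)

theorem eq_lineMap_of_side_eq_zero {P Q y : Pt} (h : P ≠ Q) (hy : side P Q y = 0) :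
    y = AffineMap.lineMap P Q (lineCoord P Q y) := by
  have hp := (normSq_pos h).ne'
  unfold side at hy
  ext i
  simp only [AffineMap.lineMap_apply_module', lineCoord, PiLp.add_apply, PiLp.smul_apply,
    PiLp.sub_apply, smul_eq_mul]
  fin_cases i
  · simp only [Fin.zero_eta]
    field_simp
    linear_combination (-(Q 1 - P 1)) * hy
  · simp only [Fin.mk_one]
    field_simp
    linear_combination (Q 0 - P 0) * hy

theorem side_lineMap (P Q : Pt) (t : ℝ) : side P Q (AffineMap.lineMap P Q t) = 0 := by
  simp only [side, AffineMap.lineMap_apply_module', PiLp.add_apply, PiLp.smul_apply,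
    PiLp.sub_apply, smul_eq_mul]
  ring

theorem lineCoord_lineMap {P Q : Pt} (h : P ≠ Q) (t : ℝ) :
    lineCoord P Q (AffineMap.lineMap P Q t) = t := by
  have hp := (normSq_pos h).ne'
  simp only [lineCoord, AffineMap.lineMap_apply_module', PiLp.add_apply, PiLp.smul_apply,
    PiLp.sub_apply, smul_eq_mul]
  field_simp
  ring

theorem continuous_lineCoord (P Q : Pt) : Continuous (lineCoord P Q) := by
  unfold lineCoord
  exact Continuous.div_const (by fun_prop) _

theorem eventually_lineCoord_mem {P Q x : Pt} (h : P ≠ Q) (hx : x ∈ openSegment ℝ P Q) :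
    ∀ᶠ y in 𝓝 x, lineCoord P Q y ∈ Ioo (0 : ℝ) 1 := by
  rw [openSegment_eq_image_lineMap] at hx
  obtain ⟨t, ht, rfl⟩ := hx
  apply (continuous_lineCoord P Q).continuousAt.eventually_mem
  rw [lineCoord_lineMap h]
  exact isOpen_Ioo.mem_nhds ht

/-- Near an interior point of the segment the projection to its line stays strictly between the end
points, so the line and the segment cannot be told apart there. -/
theorem eventually_mem_segment {P Q x : Pt} (h : P ≠ Q) (hx : x ∈ openSegment ℝ P Q) :
    ∀ᶠ y in 𝓝 x, side P Q y = 0 → y ∈ segment ℝ P Q := by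
  filter_upwards [eventually_lineCoord_mem h hx] with y hy h0
  rw [eq_lineMap_of_side_eq_zero h h0, segment_eq_image_lineMap]
  exact ⟨_, Ioo_subset_Icc_self hy, rfl⟩

/-- `K` is open and star-shaped with respect to a ball with centre `c`. -/
structure IsStarAbout (K : Set Pt) (c : Pt) : Prop where
  isOpen : IsOpen K
  star : ∃ r > 0, ∀ y ∈ Metric.ball c r, StarConvex ℝ y K

namespace IsStarAbout

variable {K L : Set Pt} {c c' P Q x : Pt}

theorem mem (h : IsStarAbout K c) (hx : x ∈ closure K) {s : ℝ} (h0 : 0 ≤ s) (h1 : s < 1) :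
    c + s • (x - c) ∈ K := by
  obtain ⟨r, hr, hK⟩ := h.star
  exact add_smul_sub_mem_of_starConvex hr hK hx h0 h1

theorem notMem_frontier (h : IsStarAbout K c) (hx : x ∈ K) : x ∉ frontier K := by
  rw [h.isOpen.frontier_eq]
  exact fun h' => h'.2 hx

/-- The centre does not lie on the line of an edge. -/
theorem independent (h : IsStarAbout K c) (hPQ : P ≠ Q) (he : segment ℝ P Q ⊆ frontier K)
    (a b : ℝ) (hab : a • (P - c) + b • (Q - c) = 0) : a = 0 ∧ b = 0 := by
  have hP := he (left_mem_segment ℝ P Q)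
  have hQ := he (right_mem_segment ℝ P Q)
  have hPc := frontier_subset_closure hP
  have hQc := frontier_subset_closure hQ
  have hc : c ∈ K := by simpa using h.mem hPc le_rfl zero_lt_one
  have hQ0 : Q - c ≠ 0 := by
    intro h0
    rw [sub_eq_zero] at h0
    exact h.notMem_frontier hc (h0 ▸ hQ)
  by_cases ha : a = 0
  · subst ha
    simpa [hQ0] using hab
  exfalso
  have hμ : P - c = (-b / a) • (Q - c) := by
    have : a • (P - c) = (-b) • (Q - c) := by
      rw [neg_smul]; exact eq_neg_of_add_eq_zero_left hab
    rw [div_eq_inv_mul, mul_smul, ← this, smul_smul, inv_mul_cancel₀ ha, one_smul]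
  set μ := -b / a
  have hPe : P = c + μ • (Q - c) := by rw [← hμ]; abel
  -- Collinear with `c`, there are four positions: for `μ < 0` the centre lies on the edge; for `0 ≤
  -- μ < 1` the point `P` is strictly between `c` and `Q` (or equal to `c`), hence inside `K`; for
  -- `μ = 1` the end points coincide; for `μ > 1` the point `Q` is inside `K`.
  rcases lt_or_ge μ 0 with h1 | h1
  · refine h.notMem_frontier hc (he ?_)
    have hμ1 : 0 < 1 - μ := by linarith
    refine ⟨1 / (1 - μ), -μ / (1 - μ), by positivity, div_nonneg (by linarith) hμ1.le,
      by field_simp; ring, ?_⟩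
    rw [hPe]
    have : c + μ • (Q - c) = (1 - μ) • c + μ • Q := by module
    rw [this, smul_add, smul_smul, smul_smul, one_div_mul_cancel hμ1.ne', one_smul, add_assoc,
      ← add_smul]
    rw [show 1 / (1 - μ) * μ + -μ / (1 - μ) = 0 by ring, zero_smul, add_zero]
  rcases lt_trichotomy μ 1 with h2 | h2 | h2
  · exact h.notMem_frontier (hPe ▸ h.mem hQc h1 h2) hP
  · apply hPQ
    rw [hPe, h2]
    simp
  · have := h.mem hPc (inv_nonneg.2 h1) (inv_lt_one_of_one_lt₀ h2)
    rw [hμ, smul_smul, inv_mul_cancel₀ (by linarith), one_smul, add_sub_cancel] at this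
    exact h.notMem_frontier this hQ

theorem side_ne_zero (h : IsStarAbout K c) (hPQ : P ≠ Q) (he : segment ℝ P Q ⊆ frontier K) :
    side P Q c ≠ 0 := by
  intro h0
  have e := eq_lineMap_of_side_eq_zero hPQ h0
  set t := lineCoord P Q c
  have := h.independent hPQ he (1 - t) t (by
    rw [AffineMap.lineMap_apply_module] at e
    rw [smul_sub, smul_sub, show (1 - t) • P - (1 - t) • c + (t • Q - t • c)
      = ((1 - t) • P + t • Q) - c by module, ← e, sub_self])
  linarith [this.1, this.2]

/-- Near an interior point of an edge, the half plane containing the centre lies in `K`. -/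
theorem eventually_mem (h : IsStarAbout K c) (hPQ : P ≠ Q) (he : segment ℝ P Q ⊆ frontier K)
    (hx : x ∈ openSegment ℝ P Q) : ∀ᶠ y in 𝓝 x, 0 < side P Q y * side P Q c → y ∈ K := by
  have hδ := h.side_ne_zero hPQ he
  set δ := side P Q c
  have hx0 : side P Q x = 0 := by
    rw [openSegment_eq_image_lineMap] at hx
    obtain ⟨t, -, rfl⟩ := hx
    exact side_lineMap P Q t
  let s : Pt → ℝ := fun y => 1 - side P Q y / δ
  have hs : ContinuousAt s x :=
    (continuous_const.sub ((continuous_side P Q).div_const δ)).continuousAt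
  have hsx : s x = 1 := by simp [s, hx0]
  -- Central projection from `c` to the line through `P` and `Q`: `s y` is chosen so that `y = c + s
  -- y • (z y - c)` with `z y` on the line. For `y` near `x` the point `z y` is on the edge, and `s
  -- y < 1` on the side of the centre.
  let z : Pt → Pt := fun y => c + (s y)⁻¹ • (y - c)
  have hz : ContinuousAt z x := by
    refine continuousAt_const.add ((hs.inv₀ (by rw [hsx]; exact one_ne_zero)).smul ?_)
    exact continuousAt_id.sub continuousAt_const
  have hzx : z x = x := by simp [z, hsx]
  have e1 : ∀ᶠ y in 𝓝 x, 0 < s y := hs.eventually_mem (by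
    rw [hsx]; exact isOpen_Ioi.mem_nhds (by simp))
  have e2 := hz.tendsto.eventually (by rw [hzx]; exact eventually_mem_segment hPQ hx)
  filter_upwards [e1, e2] with y hy hzy hpos
  have hs1 : s y < 1 := by
    have : 0 < side P Q y / δ := by
      rw [div_eq_mul_inv, ← div_self_mul_self', ← mul_div_assoc]
      exact div_pos hpos (mul_self_pos.2 hδ)
    simp only [s]; linarith
  have hz0 : side P Q (z y) = 0 := by
    have e : side P Q (z y) = δ + (s y)⁻¹ * (side P Q y - δ) := by
      simp only [side, z, δ, PiLp.add_apply, PiLp.smul_apply, PiLp.sub_apply, smul_eq_mul]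
      ring
    have e' : side P Q y - δ = - (s y) * δ := by
      simp only [s]; field_simp; ring
    rw [e, e']
    field_simp
    ring
  have := h.mem (frontier_subset_closure (he (hzy hz0))) hy.le hs1
  convert this using 1
  simp only [z, add_sub_cancel_left, smul_smul, mul_inv_cancel₀ hy.ne', one_smul]
  abel

/-- Two disjoint cells cover a neighbourhood of each interior point of a common edge. -/
theorem eventually_mem_closure_union (hK : IsStarAbout K c) (hL : IsStarAbout L c')
    (hd : Disjoint K L) (hPQ : P ≠ Q) (heK : segment ℝ P Q ⊆ frontier K)
    (heL : segment ℝ P Q ⊆ frontier L) (hx : x ∈ openSegment ℝ P Q) :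
    ∀ᶠ y in 𝓝 x, y ∈ closure K ∪ closure L := by
  have hc := hK.side_ne_zero hPQ heK
  have hc' := hL.side_ne_zero hPQ heL
  have hx0 : side P Q x = 0 := by
    rw [openSegment_eq_image_lineMap] at hx
    obtain ⟨t, -, rfl⟩ := hx
    exact side_lineMap P Q t
  have eK := hK.eventually_mem hPQ heK hx
  have eL := hL.eventually_mem hPQ heL hx
  -- If both centres were on the same side, a small move from `x` in the direction `c - P` would
  -- land in both cells.
  have hopp : side P Q c * side P Q c' < 0 := by
    by_contra! hsame
    have hsame : 0 < side P Q c * side P Q c' := lt_of_le_of_ne hsame (mul_ne_zero hc hc').symm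
    have ht : Tendsto (fun ε : ℝ => x + ε • (c - P)) (𝓝[>] 0) (𝓝 x) := by
      have : Continuous fun ε : ℝ => x + ε • (c - P) := by fun_prop
      have := this.tendsto 0
      rw [zero_smul, add_zero] at this
      exact this.mono_left nhdsWithin_le_nhds
    obtain ⟨ε, h1, h2, hε⟩ := ((ht.eventually eK).and ((ht.eventually eL).and
      self_mem_nhdsWithin)).exists
    have hε : 0 < ε := hε
    have e : side P Q (x + ε • (c - P)) = ε * side P Q c := by
      have : side P Q (x + ε • (c - P)) = side P Q x + ε * side P Q c := by
        simp only [side, PiLp.add_apply, PiLp.smul_apply, PiLp.sub_apply, smul_eq_mul]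
        ring
      rw [this, hx0, zero_add]
    rw [e, mul_assoc] at h1 h2
    exact disjoint_left.1 hd (h1 (mul_pos hε (mul_self_pos.2 hc))) (h2 (mul_pos hε hsame))
  filter_upwards [eK, eL, eventually_mem_segment hPQ hx] with y h1 h2 h3
  rcases lt_trichotomy (side P Q y) 0 with h | h | h
  · rcases lt_or_gt_of_ne hc with h' | h'
    · exact Or.inl (subset_closure (h1 (mul_pos_of_neg_of_neg h h')))
    · exact Or.inr (subset_closure (h2 (mul_pos_of_neg_of_neg h (by nlinarith))))
  · exact Or.inl (frontier_subset_closure (heK (h3 h)))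
  · rcases lt_or_gt_of_ne hc with h' | h'
    · exact Or.inr (subset_closure (h2 (mul_pos h (by nlinarith))))
    · exact Or.inl (subset_closure (h1 (mul_pos h h')))

end IsStarAbout

/-! ### Elementary facts on polygons and on open sets of the plane -/

theorem SimplePolygon.vertex_ne (K : SimplePolygon) (i : Fin K.n) :
    K.vertex i ≠ K.vertex (finRotate K.n i) := by
  intro h
  have h1 := K.vertex_injective h
  have h2 : i ∈ (finRotate K.n).support := by
    rw [support_finRotate_of_le (by linarith [K.three_le])]
    exact Finset.mem_univ i
  exact Equiv.Perm.mem_support.1 h2 h1.symm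

theorem SimplePolygon.edge_subset_frontier (K : SimplePolygon) (i : Fin K.n) :
    K.edge i ⊆ frontier K.carrier := by
  rw [K.frontier_eq]
  exact subset_iUnion (fun i => segment ℝ (K.vertex i) (K.vertex (finRotate K.n i))) i

theorem volume_segment (P Q : Pt) : volume (segment ℝ P Q) = 0 := by
  have h : segment ℝ P Q ⊆ (line[ℝ, P, Q] : AffineSubspace ℝ Pt) := by
    rw [segment_eq_image_lineMap]
    rintro _ ⟨t, -, rfl⟩
    exact AffineMap.lineMap_mem_affineSpan_pair t P Q
  refine measure_mono_null h (Measure.addHaar_affineSubspace _ _ ?_)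
  intro htop
  have h1 := (collinear_pair ℝ P Q).finrank_le_one
  rw [← direction_affineSpan, htop, AffineSubspace.direction_top, finrank_top] at h1
  simp at h1

theorem SimplePolygon.volume_frontier (K : SimplePolygon) : volume (frontier K.carrier) = 0 := by
  rw [K.frontier_eq, measure_iUnion_null_iff]
  exact fun i => volume_segment _ _

/-- The punctured ball is homeomorphic to the punctured plane. It allows mesh vertices to be ignored
in the connectedness argument for cells. -/
theorem isPreconnected_ball_diff_center (c : Pt) {r : ℝ} (hr : 0 < r) :
    IsPreconnected (Metric.ball c r \ {c}) := by
  have h : Metric.ball c r \ {c} = OpenPartialHomeomorph.univBall c r '' {0}ᶜ := by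
    have hc : OpenPartialHomeomorph.univBall c r 0 = c :=
      OpenPartialHomeomorph.univBall_apply_zero c r
    ext y
    constructor
    · rintro ⟨hy, hyc⟩
      have hy' : y ∈ (OpenPartialHomeomorph.univBall c r).target := by
        rwa [OpenPartialHomeomorph.univBall_target c hr]
      refine ⟨(OpenPartialHomeomorph.univBall c r).symm y, fun h0 => hyc ?_,
        (OpenPartialHomeomorph.univBall c r).right_inv hy'⟩
      rw [mem_singleton_iff] at h0
      rw [mem_singleton_iff, ← (OpenPartialHomeomorph.univBall c r).right_inv hy', h0, hc]
    · rintro ⟨x, hx, rfl⟩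
      have hsrc : ∀ x, x ∈ (OpenPartialHomeomorph.univBall c r).source := by simp
      refine ⟨?_, fun h => hx ?_⟩
      · rw [← OpenPartialHomeomorph.univBall_target c hr]
        exact (OpenPartialHomeomorph.univBall c r).map_source (hsrc x)
      · refine (OpenPartialHomeomorph.univBall c r).injOn (hsrc x) (hsrc 0) ?_
        rw [hc]; exact h
  rw [h]
  have hrank : 1 < Module.rank ℝ Pt := by
    rw [← Module.finrank_eq_rank]; simp
  exact ((isConnected_compl_singleton_of_one_lt_rank hrank 0).isPreconnected).image _
    (OpenPartialHomeomorph.continuous_univBall c r).continuousOn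

theorem infinite_of_isOpen {U : Set Pt} (hU : IsOpen U) (hne : U.Nonempty) : U.Infinite := by
  intro hf
  exact (hU.measure_pos volume hne).ne' (hf.measure_zero volume)

/-! ### Connectedness of a mesh through its edges -/

namespace PolygonalMesh

variable {Ω : Set Pt} (T : PolygonalMesh Ω)

/-- Every cell is star-shaped with respect to a ball. -/
def IsStarMesh : Prop := ∀ K, ∃ c, IsStarAbout (T.cell K).carrier c

variable {T}

theorem ShapeRegular.isStarMesh {η₁ η₂ : ℝ} (hη₁ : 0 < η₁) (h : T.ShapeRegular η₁ η₂) :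
    T.IsStarMesh := by
  intro K
  obtain ⟨⟨c, r, hr, hs⟩, -⟩ := h K
  exact ⟨c, (T.cell K).isOpen, r, lt_of_le_of_lt (mul_nonneg hη₁.le Metric.diam_nonneg) hr, hs⟩

variable (T)

/-- The set of all vertices of the mesh. -/
def vertices : Set Pt := ⋃ K, range (T.cell K).vertex

theorem finite_vertices : T.vertices.Finite := finite_iUnion fun _ => finite_range _

theorem mem_openSegment_of_notMem_vertices {K : Fin T.N} {i : Fin (T.cell K).n} {x : Pt}
    (hx : x ∈ (T.cell K).edge i) (hv : x ∉ T.vertices) :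
    x ∈ openSegment ℝ ((T.cell K).vertex i) ((T.cell K).vertex (finRotate _ i)) := by
  rw [SimplePolygon.edge, ← insert_endpoints_openSegment] at hx
  rcases hx with rfl | rfl | h
  · exact absurd (mem_iUnion_of_mem K (mem_range_self i)) hv
  · exact absurd (mem_iUnion_of_mem K (mem_range_self _)) hv
  · exact h

variable {T}

theorem IsStarMesh.eventually_mem_closure_union (hT : T.IsStarMesh) {K L : Fin T.N} (hKL : L ≠ K)
    {i : Fin (T.cell K).n} {j : Fin (T.cell L).n} (he : (T.cell L).edge j = (T.cell K).edge i)
    {x : Pt} (hx : x ∈ openSegment ℝ ((T.cell K).vertex i) ((T.cell K).vertex (finRotate _ i))) :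
    ∀ᶠ y in 𝓝 x, y ∈ closure (T.cell K).carrier ∪ closure (T.cell L).carrier := by
  obtain ⟨c, hc⟩ := hT K
  obtain ⟨c', hc'⟩ := hT L
  exact hc.eventually_mem_closure_union hc' (T.disjoint K L hKL.symm)
    ((T.cell K).vertex_ne i) ((T.cell K).edge_subset_frontier i)
    (he.symm.trans_subset ((T.cell L).edge_subset_frontier j)) hx

theorem notMem_of_mem_closure {K L : Fin T.N} (h : K ≠ L) {x : Pt}
    (hx : x ∈ closure (T.cell L).carrier) : x ∉ (T.cell K).carrier := by
  intro hK
  exact disjoint_left.1 ((T.disjoint K L h).closure_right (T.cell K).isOpen) hK hx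

theorem exists_mem_edge {K : Fin T.N} {x : Pt} (hx : x ∈ closure (T.cell K).carrier)
    (h : x ∉ (T.cell K).carrier) : ∃ i, x ∈ (T.cell K).edge i := by
  have : x ∈ frontier (T.cell K).carrier := by
    rw [(T.cell K).isOpen.frontier_eq]; exact ⟨hx, h⟩
  rw [(T.cell K).frontier_eq] at this
  exact mem_iUnion.1 this

/-- The cells of a mesh of a connected set are connected through common edges. -/
theorem IsStarMesh.eq_univ_of_neighbours (hT : T.IsStarMesh) (hΩ : IsOpen Ω)
    (hc : IsPreconnected Ω) (A : Set (Fin T.N)) (hne : A.Nonempty)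
    (hA : ∀ K ∈ A, ∀ L, L ≠ K → ∀ i j, (T.cell L).edge j = (T.cell K).edge i → L ∈ A) :
    A = univ := by
  set F : Set (Fin T.N) → Set Pt := fun B => ⋃ K ∈ B, closure (T.cell K).carrier
  have hFc : ∀ B, IsClosed (F B) := fun B =>
    B.toFinite.isClosed_biUnion fun K _ => isClosed_closure
  have hcov : Ω ⊆ F A ∪ F Aᶜ := by
    intro x hx
    have := subset_closure hx
    rw [T.cover] at this
    obtain ⟨K, hK⟩ := mem_iUnion.1 this
    by_cases h : K ∈ A
    · exact Or.inl (mem_biUnion h hK)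
    · exact Or.inr (mem_biUnion (s := Aᶜ) h hK)
  -- The cells in `A` and those outside can only touch at vertices: at an interior point of an edge,
  -- the cell in `A` and its neighbour, also in `A`, already fill a neighbourhood, which leaves no
  -- room for a third cell.
  have hint : ∀ x ∈ Ω, x ∈ F A → x ∈ F Aᶜ → x ∈ T.vertices := by
    intro x hx h1 h2
    by_contra hv
    obtain ⟨K, hK, hxK⟩ := mem_iUnion₂.1 h1
    obtain ⟨L, hL, hxL⟩ := mem_iUnion₂.1 h2
    have hKL : K ≠ L := fun h => hL (h ▸ hK)
    obtain ⟨i, hi⟩ := exists_mem_edge hxK (notMem_of_mem_closure hKL hxL)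
    have hi' := T.mem_openSegment_of_notMem_vertices hi hv
    rcases T.conforming K i with h | ⟨M, hM, j, hj⟩
    · have := h hi
      rw [hΩ.frontier_eq] at this
      exact this.2 hx
    · have hMA := hA K hK M hM i j hj
      have hML : M ≠ L := fun h => hL (h ▸ hMA)
      have hev := hT.eventually_mem_closure_union hM hj hi'
      obtain ⟨y, hy, hy'⟩ := mem_closure_iff_nhds.1 hxL _ hev
      rcases hy with hy | hy
      · exact notMem_of_mem_closure hKL.symm hy hy'
      · exact notMem_of_mem_closure hML.symm hy hy'
  -- A small punctured ball about `x` avoids all vertices, so the two closed sets split it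
  -- disjointly; being connected, it lies in one of them, and closedness adds the centre.
  have hloc : ∀ x ∈ Ω, x ∈ interior (F A) ∪ interior (F Aᶜ) := by
    intro x hx
    have hV : (T.vertices \ {x})ᶜ ∈ 𝓝 x :=
      (T.finite_vertices.subset sdiff_subset).isClosed.isOpen_compl.mem_nhds (by simp)
    obtain ⟨ε, hε, hb⟩ := Metric.mem_nhds_iff.1 (Filter.inter_mem (hΩ.mem_nhds hx) hV)
    have key : ∀ B, Metric.ball x ε \ {x} ⊆ F B → x ∈ interior (F B) := by
      intro B hB
      have h1 : ∀ᶠ y in 𝓝[≠] x, y ∈ F B := by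
        have : Metric.ball x ε \ {x} ∈ 𝓝[≠] x :=
          Filter.inter_mem (mem_nhdsWithin_of_mem_nhds (Metric.ball_mem_nhds x hε))
            self_mem_nhdsWithin
        exact Filter.mem_of_superset this hB
      have h2 : x ∈ F B := (hFc B).mem_of_tendsto (tendsto_id.mono_left nhdsWithin_le_nhds) h1
      rw [mem_interior_iff_mem_nhds]
      refine Filter.mem_of_superset (Metric.ball_mem_nhds x hε) fun y hy => ?_
      by_cases hyx : y = x
      · exact hyx ▸ h2
      · exact hB ⟨hy, hyx⟩
    have := isPreconnected_iff_subset_of_disjoint_closed.1 (isPreconnected_ball_diff_center x hε)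
      (F A) (F Aᶜ) (hFc _) (hFc _) (fun y hy => hcov (hb hy.1).1) (by
        ext y
        simp only [mem_inter_iff, mem_empty_iff_false, iff_false]
        rintro ⟨⟨hy, hyx⟩, hyA, hyA'⟩
        exact (hb hy).2 ⟨hint y (hb hy).1 hyA hyA', hyx⟩)
    exact this.imp (key A) (key Aᶜ)
  by_contra hAu
  obtain ⟨L, hL⟩ := (ne_univ_iff_exists_notMem A).1 hAu
  obtain ⟨K, hK⟩ := hne
  have hin : ∀ B : Set (Fin T.N), ∀ K ∈ B, (Ω ∩ interior (F B)).Nonempty := by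
    intro B K hK
    obtain ⟨x, hx⟩ := (T.cell K).isConnected.nonempty
    refine ⟨x, T.subset K hx, ?_⟩
    rw [mem_interior]
    exact ⟨_, subset_closure.trans (subset_biUnion_of_mem
      (u := fun K => closure (T.cell K).carrier) hK), (T.cell K).isOpen, hx⟩
  -- Connectedness of `Ω` makes the two interiors meet inside `Ω`, in a nonempty open and therefore
  -- infinite set, yet every common point is one of the finitely many vertices.
  have h := hc _ _ isOpen_interior isOpen_interior hloc (hin A K hK) (hin Aᶜ L hL)
  refine infinite_of_isOpen (hΩ.inter (isOpen_interior.inter isOpen_interior)) h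
    (T.finite_vertices.subset ?_)
  rintro x ⟨hx, h1, h2⟩
  exact hint x hx (interior_subset h1) (interior_subset h2)

end PolygonalMesh

/-- An open set of the plane that cuts out one part misses the other part, hence also its closure.
-/
theorem IsBoundaryPartition.disjoint_closure {Ω Γu Γσ : Set Pt}
    (h : IsBoundaryPartition Ω Γu Γσ) : Disjoint Γu (closure Γσ) ∧ Disjoint Γσ (closure Γu) := by
  have key : ∀ A B : Set Pt, (∃ U, IsOpen U ∧ A = U ∩ frontier Ω) → B ⊆ frontier Ω →
      Disjoint A B → Disjoint A (closure B) := by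
    rintro A B ⟨U, hU, rfl⟩ hB hd
    have : Disjoint U B := by
      rw [disjoint_left] at hd ⊢
      exact fun x hx hxB => hd ⟨hx, hB hxB⟩ hxB
    exact (this.closure_right hU).mono_left inter_subset_left
  have hu : Γu ⊆ frontier Ω := by obtain ⟨U, -, rfl⟩ := h.open_u; exact inter_subset_right
  have hσ : Γσ ⊆ frontier Ω := by obtain ⟨U, -, rfl⟩ := h.open_σ; exact inter_subset_right
  exact ⟨key _ _ h.open_u hσ h.disjoint, key _ _ h.open_σ hu h.disjoint.symm⟩

/-- Some edge of the mesh lies in the closure of `Γu`. -/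
theorem PolygonalMesh.IsStarMesh.exists_edge_subset {Ω Γu Γσ : Set Pt} {T : PolygonalMesh Ω}
    (hT : T.IsStarMesh) (hΩ : IsPolygonalDomain Ω) (hΓ : IsBoundaryPartition Ω Γu Γσ)
    (hF : T.Fits Γu Γσ) : ∃ K i, (T.cell K).edge i ⊆ closure Γu := by
  -- Positive length rules out that `Γu` consists of vertices, since points have length zero.
  obtain ⟨x, hx, hxv⟩ : ∃ x ∈ Γu, x ∉ T.vertices := by
    by_contra! h
    have := Measure.nullSingletonClass_hausdorff Pt (zero_lt_one (α := ℝ))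
    exact hΓ.length_u.ne' ((T.finite_vertices.subset h).measure_zero _)
  have hxf : x ∈ frontier Ω := by
    obtain ⟨U, -, rfl⟩ := hΓ.open_u
    exact hx.2
  rw [hΩ.isOpen.frontier_eq] at hxf
  have hcov := hxf.1
  rw [T.cover] at hcov
  obtain ⟨K, hK⟩ := mem_iUnion.1 hcov
  obtain ⟨i, hi⟩ := exists_mem_edge hK fun h => hxf.2 (T.subset K h)
  refine ⟨K, i, ?_⟩
  rcases T.conforming K i with h | ⟨M, hM, j, hj⟩
  · refine (hF K i h).resolve_right fun h' => ?_
    exact disjoint_left.1 hΓ.disjoint_closure.1 hx (h' hi)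
  · exfalso
    apply hxf.2
    -- If the edge were shared, the two cells would fill a neighbourhood of `x` up to closure,
    -- placing `x` in the interior of the closure of `Ω`. This is where the domain must lie on one
    -- side of its boundary.
    rw [← hΩ.interior_closure, mem_interior_iff_mem_nhds]
    refine Filter.mem_of_superset (hT.eventually_mem_closure_union hM hj
      (T.mem_openSegment_of_notMem_vertices hi hxv)) (union_subset ?_ ?_)
    · exact closure_mono (T.subset K)
    · exact closure_mono (T.subset M)

end WeakSymVEM

end

noncomputable section

namespace WeakSymVEM

/-! ### Polynomials in two variables -/

theorem polyEval_add (p q : MvPolynomial (Fin 2) ℝ) (x : Pt) :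
    polyEval (p + q) x = polyEval p x + polyEval q x := by simp [polyEval]

theorem polyEval_sub (p q : MvPolynomial (Fin 2) ℝ) (x : Pt) :
    polyEval (p - q) x = polyEval p x - polyEval q x := by simp [polyEval]

theorem polyEval_smul (a : ℝ) (p : MvPolynomial (Fin 2) ℝ) (x : Pt) :
    polyEval (a • p) x = a * polyEval p x := by simp [polyEval, MvPolynomial.smul_eval]

@[simp] theorem polyEval_zero (x : Pt) : polyEval 0 x = 0 := by simp [polyEval]

@[simp] theorem polyEval_C (a : ℝ) (x : Pt) : polyEval (MvPolynomial.C a) x = a := by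
  simp [polyEval]

@[simp] theorem polyField_apply (p : Fin 2 → MvPolynomial (Fin 2) ℝ) (x : Pt) (i : Fin 2) :
    polyField p x i = polyEval (p i) x := rfl

theorem contDiff_polyEval (p : MvPolynomial (Fin 2) ℝ) : ContDiff ℝ ∞ (polyEval p) := by
  induction p using MvPolynomial.induction_on with
  | C a =>
    have e : polyEval (MvPolynomial.C a) = fun _ => a := by ext; simp
    exact e ▸ contDiff_const
  | add p q hp hq =>
    have e : polyEval (p + q) = fun x => polyEval p x + polyEval q x := by ext; simp [polyEval]
    exact e ▸ hp.add hq
  | mul_X p j hp =>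
    have : ContDiff ℝ ∞ fun x : Pt => x j := by fun_prop
    have e : polyEval (p * MvPolynomial.X j) = fun x => polyEval p x * x j := by
      ext; simp [polyEval]
    exact e ▸ hp.mul this

theorem continuous_polyEval (p : MvPolynomial (Fin 2) ℝ) : Continuous (polyEval p) :=
  (contDiff_polyEval p).continuous

theorem pderiv_polyEval (j : Fin 2) (p : MvPolynomial (Fin 2) ℝ) (x : Pt) :
    pderiv j (polyEval p) x = polyEval (MvPolynomial.pderiv j p) x := by
  have hd : ∀ p, DifferentiableAt ℝ (polyEval p) x := fun p =>
    (contDiff_polyEval p).differentiable (by simp) x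
  induction p using MvPolynomial.induction_on with
  | C a =>
    have : polyEval (MvPolynomial.C a) = fun _ => a := by ext; simp
    simp [this, pderiv]
  | add p q hp hq =>
    have : polyEval (p + q) = polyEval p + polyEval q := by ext; simp [polyEval_add]
    rw [this, pderiv_add (contDiff_polyEval p) (contDiff_polyEval q), hp, hq, map_add,
      polyEval_add]
  | mul_X p l hp =>
    have hX : HasFDerivAt (fun x : Pt => x l) (EuclideanSpace.proj (𝕜 := ℝ) l : Pt →L[ℝ] ℝ) x :=
      (EuclideanSpace.proj (𝕜 := ℝ) l : Pt →L[ℝ] ℝ).hasFDerivAt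
    have e : polyEval (p * MvPolynomial.X l) = polyEval p * fun x => x l := by
      ext; simp [polyEval]
    unfold pderiv at hp ⊢
    rw [e, (((hd p).hasFDerivAt).mul hX).fderiv]
    simp only [add_apply, smul_apply, smul_eq_mul, hp]
    simp only [polyEval, Derivation.leibniz, MvPolynomial.pderiv_X, smul_eq_mul, map_add, map_mul,
      MvPolynomial.eval_X]
    by_cases h : j = l
    · subst h; simp
    · simp [Ne.symm h]

/-- Differentiation lowers the degree of each monomial that it does not kill. This puts the curl of
a skew polynomial field of degree `k` into the degree `k - 1` allowed by the local stress space. -/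
theorem totalDegree_pderiv_le {p : MvPolynomial (Fin 2) ℝ} {k : ℕ} (h : p.totalDegree ≤ k)
    (j : Fin 2) : (MvPolynomial.pderiv j p).totalDegree ≤ k - 1 := by
  conv_lhs => rw [p.as_sum, map_sum]
  refine (MvPolynomial.totalDegree_finsetSum _ _).trans (Finset.sup_le fun s hs => ?_)
  rw [MvPolynomial.pderiv_monomial]
  by_cases h0 : s j = 0
  · simp [h0]
  refine (MvPolynomial.totalDegree_monomial_le _ _).trans ?_
  have h1 : s.sum (fun _ e => e) ≤ k := (MvPolynomial.le_totalDegree hs).trans h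
  have h2 : s - Finsupp.single j 1 + Finsupp.single j 1 = s :=
    tsub_add_cancel_of_le (Finsupp.single_le_iff.2 (Nat.one_le_iff_ne_zero.2 h0))
  have h3 : s.sum (fun _ e => e) = (s - Finsupp.single j 1).sum (fun _ e => e) + 1 := by
    conv_lhs => rw [← h2]
    rw [Finsupp.sum_add_index' (by simp) (by simp)]
    simp
  have h4 : (s - Finsupp.single j 1).sum (fun _ e => e) ≤ k - 1 := by omega
  exact h4

/-- The polynomials of total degree at most `k`. -/
abbrev Poly (k : ℕ) : Submodule ℝ (MvPolynomial (Fin 2) ℝ) :=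
  MvPolynomial.restrictTotalDegree (Fin 2) ℝ k

/-! ### Gluing fields given on the cells -/

theorem SimplePolygon.measurableSet (K : SimplePolygon) : MeasurableSet K.carrier :=
  K.isOpen.measurableSet

namespace PolygonalMesh

variable {Ω : Set Pt} (T : PolygonalMesh Ω)

/-- Whatever the open cells miss lies on their frontiers, which are finite unions of segments and so
null. -/
theorem iUnion_ae_eq : (⋃ K, (T.cell K).carrier) =ᵐ[volume] Ω := by
  have h1 : (⋃ K, (T.cell K).carrier) ⊆ Ω := iUnion_subset T.subset
  refine Filter.EventuallyLE.antisymm (LE.le.eventuallyLE h1) ?_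
  rw [ae_le_set]
  have : Ω \ ⋃ K, (T.cell K).carrier ⊆ ⋃ K, frontier (T.cell K).carrier := by
    rintro x ⟨hx, hx'⟩
    have := subset_closure hx
    rw [T.cover] at this
    obtain ⟨K, hK⟩ := mem_iUnion.1 this
    refine mem_iUnion.2 ⟨K, ?_⟩
    rw [(T.cell K).isOpen.frontier_eq]
    exact ⟨hK, fun h => hx' (mem_iUnion.2 ⟨K, h⟩)⟩
  exact measure_mono_null this (measure_iUnion_null fun K => (T.cell K).volume_frontier)

theorem ae_restrict_iff (p : Pt → Prop) : (∀ᵐ x ∂(volume.restrict Ω), p x) ↔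
    ∀ K, ∀ᵐ x ∂(volume.restrict (T.cell K).carrier), p x := by
  rw [← Measure.restrict_congr_set T.iUnion_ae_eq, ae_restrict_iUnion_iff]

theorem setIntegral_eq_sum {f : Pt → ℝ}
    (hf : ∀ K, IntegrableOn f (T.cell K).carrier) :
    ∫ x in Ω, f x = ∑ K, ∫ x in (T.cell K).carrier, f x := by
  rw [← setIntegral_congr_set T.iUnion_ae_eq]
  exact integral_iUnion_fintype (fun K => (T.cell K).measurableSet)
    (fun K L h => T.disjoint K L h) hf

theorem exists_glue {E : Type*} [NormedAddCommGroup E] (g : Fin T.N → Pt → E)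
    (hg : ∀ K, MemLp (g K) 2 (volume.restrict (T.cell K).carrier)) :
    ∃ G : Lp E 2 (volume.restrict Ω), ∀ K, G =ᵐ[volume.restrict (T.cell K).carrier] g K := by
  have h1 : MemLp (fun x => ∑ K, (T.cell K).carrier.indicator (g K) x) 2 (volume.restrict Ω) :=
    (memLp_finsetSum _ fun K _ => (memLp_indicator_iff_restrict (T.cell K).measurableSet).2
      (hg K)).restrict Ω
  refine ⟨h1.toLp, fun K => ?_⟩
  have h2 := (T.ae_restrict_iff _).1 h1.coeFn_toLp K
  filter_upwards [h2, ae_restrict_mem (T.cell K).measurableSet] with x hx hxK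
  rw [hx, Finset.sum_eq_single K, indicator_of_mem hxK]
  · intro L _ hL
    exact indicator_of_notMem (disjoint_right.1 (T.disjoint L K hL) hxK) _
  · simp

variable {T}

theorem ext_of_cells {E : Type*} [NormedAddCommGroup E] {f g : Lp E 2 (volume.restrict Ω)}
    (h : ∀ K, f =ᵐ[volume.restrict (T.cell K).carrier] g) : f = g :=
  Lp.ext ((T.ae_restrict_iff _).2 h)

variable (T)

theorem restrict_cell_le (K : Fin T.N) :
    volume.restrict (T.cell K).carrier ≤ volume.restrict Ω :=
  Measure.restrict_mono (T.subset K) le_rfl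

/-- The fields with polynomial components of degree at most `k` on each cell. -/
def piecewisePoly (k : ℕ) (ι : Type) [Fintype ι] :
    Submodule ℝ (Lp (EuclideanSpace ℝ ι) 2 (volume.restrict Ω)) where
  carrier := {v | ∀ K, ∃ p : ι → MvPolynomial (Fin 2) ℝ, (∀ i, (p i).totalDegree ≤ k) ∧
    ∀ᵐ x ∂(volume.restrict (T.cell K).carrier), ∀ i, v x i = polyEval (p i) x}
  add_mem' := by
    intro v w hv hw K
    obtain ⟨p, hp, h1⟩ := hv K
    obtain ⟨q, hq, h2⟩ := hw K
    refine ⟨fun i => p i + q i, fun i =>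
      (MvPolynomial.totalDegree_add _ _).trans (max_le (hp i) (hq i)), ?_⟩
    filter_upwards [h1, h2, ae_mono (T.restrict_cell_le K) (Lp.coeFn_add v w)] with x h1 h2 h3 i
    rw [h3, Pi.add_apply, PiLp.add_apply, h1, h2, polyEval_add]
  zero_mem' := by
    intro K
    refine ⟨fun _ => 0, by simp, ?_⟩
    filter_upwards [ae_mono (T.restrict_cell_le K)
      (Lp.coeFn_zero (EuclideanSpace ℝ ι) 2 (volume.restrict Ω))] with x h i
    rw [h]; simp
  smul_mem' := by
    intro a v hv K
    obtain ⟨p, hp, h1⟩ := hv K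
    refine ⟨fun i => a • p i, fun i => (MvPolynomial.totalDegree_smul_le a _).trans (hp i), ?_⟩
    filter_upwards [h1, ae_mono (T.restrict_cell_le K) (Lp.coeFn_smul a v)] with x h1 h3 i
    rw [h3, Pi.smul_apply, PiLp.smul_apply, h1, polyEval_smul, smul_eq_mul]

theorem memLp_polyEval {F : Type*} [Fintype F] (K : SimplePolygon)
    (p : F → MvPolynomial (Fin 2) ℝ) :
    MemLp (fun x => (WithLp.toLp 2 fun i => polyEval (p i) x : EuclideanSpace ℝ F)) 2
      (volume.restrict K.carrier) := by
  apply memLp_of_continuous K.isBounded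
  have := fun i => continuous_polyEval (p i)
  fun_prop

/-- The space is contained in the image of the finite-dimensional space of coefficient families, one
polynomial per cell and component. -/
instance finiteDimensional_piecewisePoly (k : ℕ) (ι : Type) [Fintype ι] :
    FiniteDimensional ℝ (T.piecewisePoly k ι) := by
  have hex : ∀ p : Fin T.N → ι → Poly k,
      ∃ G : Lp (EuclideanSpace ℝ ι) 2 (volume.restrict Ω), ∀ K,
        ∀ᵐ x ∂(volume.restrict (T.cell K).carrier), ∀ i, G x i = polyEval (p K i).1 x := by
    intro p
    obtain ⟨G, hG⟩ := T.exists_glue _ fun K => memLp_polyEval (T.cell K) fun i => (p K i).1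
    refine ⟨G, fun K => ?_⟩
    filter_upwards [hG K] with x hx i
    rw [hx]
  choose G hG using hex
  have huniq : ∀ p g, (∀ K, ∀ᵐ x ∂(volume.restrict (T.cell K).carrier), ∀ i,
      g x i = polyEval (p K i).1 x) → G p = g := by
    intro p g h
    refine ext_of_cells (T := T) fun K => ?_
    filter_upwards [hG p K, h K] with x h1 h2
    ext i
    rw [h1, h2]
  let Gl : (Fin T.N → ι → Poly k) →ₗ[ℝ] Lp (EuclideanSpace ℝ ι) 2 (volume.restrict Ω) :=
    { toFun := G
      map_add' := fun p q => huniq _ _ fun K => by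
        filter_upwards [hG p K, hG q K, ae_mono (T.restrict_cell_le K)
          (Lp.coeFn_add (G p) (G q))] with x h1 h2 h3 i
        rw [h3, Pi.add_apply, PiLp.add_apply, h1, h2, ← polyEval_add]
        rfl
      map_smul' := fun a p => huniq _ _ fun K => by
        filter_upwards [hG p K, ae_mono (T.restrict_cell_le K)
          (Lp.coeFn_smul a (G p))] with x h1 h3 i
        rw [RingHom.id_apply, h3, Pi.smul_apply, PiLp.smul_apply, h1, smul_eq_mul, ← polyEval_smul]
        rfl }
  have hle : T.piecewisePoly k ι ≤ LinearMap.range Gl := by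
    intro v hv
    have hv' : ∀ K, ∃ p : ι → Poly k,
        ∀ᵐ x ∂(volume.restrict (T.cell K).carrier), ∀ i, v x i = polyEval (p i).1 x := by
      intro K
      obtain ⟨p, hp, h⟩ := hv K
      exact ⟨fun i => ⟨p i, (MvPolynomial.mem_restrictTotalDegree _ _ _).2 (hp i)⟩, h⟩
    choose p hp using hv'
    exact ⟨p, huniq p v hp⟩
  exact Submodule.finiteDimensional_of_le hle

end PolygonalMesh

/-! ### Weak divergence and curl -/

theorem SimplePolygon.integrableOn_polyEval_mul (K : SimplePolygon) (p : MvPolynomial (Fin 2) ℝ)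
    {φ : Pt → ℝ} (h : Continuous φ) : IntegrableOn (fun x => polyEval p x * φ x) K.carrier :=
  integrableOn_of_continuous K.isBounded ((continuous_polyEval p).mul h)

theorem IsWeakDiv.congr {U : Set Pt} {τ τ' : Pt → Ten} {f f' : Pt → Pt} (h : IsWeakDiv U τ f)
    (hτ : τ =ᵐ[volume.restrict U] τ') (hf : f =ᵐ[volume.restrict U] f') : IsWeakDiv U τ' f' := by
  intro φ h1 h2 i
  have e1 : ∫ x in U, ∑ j : Fin 2, τ x (i, j) * pderiv j φ x
      = ∫ x in U, ∑ j : Fin 2, τ' x (i, j) * pderiv j φ x := integral_congr_ae (by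
    filter_upwards [hτ] with x hx; rw [hx])
  have e2 : ∫ x in U, f x i * φ x = ∫ x in U, f' x i * φ x := integral_congr_ae (by
    filter_upwards [hf] with x hx; rw [hx])
  rw [← e1, ← e2]
  exact h φ h1 h2 i

theorem IsWeakDiv.ae_eq {U : Set Pt} (hU : IsOpen U) {τ : Pt → Ten} {f g : Pt → Pt}
    (hf : IsWeakDiv U τ f) (hg : IsWeakDiv U τ g) (mτ : MemLp τ 2 (volume.restrict U))
    (mf : MemLp f 2 (volume.restrict U)) (mg : MemLp g 2 (volume.restrict U)) :
    f =ᵐ[volume.restrict U] g := by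
  have h1 : IsWeakDiv U mτ.toLp mf.toLp := hf.congr mτ.coeFn_toLp.symm mf.coeFn_toLp.symm
  have h2 : IsWeakDiv U mτ.toLp mg.toLp := hg.congr mτ.coeFn_toLp.symm mg.coeFn_toLp.symm
  have := (divergence_eq hU h1).symm.trans (divergence_eq hU h2)
  exact (MemLp.toLp_eq_toLp_iff mf mg).1 this

theorem IsWeakDiv.mono {U W : Set Pt} (hUW : U ⊆ W) {τ : Pt → Ten} {f : Pt → Pt}
    (h : IsWeakDiv W τ f) : IsWeakDiv U τ f := by
  intro φ h1 h2 i
  have h3 : ∀ x, x ∉ U → φ x = 0 := fun x hx => image_eq_zero_of_notMem_tsupport fun h' => hx (h2 h')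
  have h4 : ∀ x, x ∉ U → ∀ j, pderiv j φ x = 0 := fun x hx j =>
    pderiv_eq_zero_of_notMem (fun h' => hx (h2 h')) j
  have e : ∀ g : Pt → ℝ, (∀ x, x ∉ U → g x = 0) → ∫ x in U, g x = ∫ x in W, g x := fun g hg => by
    rw [setIntegral_eq_integral_of_forall_compl_eq_zero hg,
      setIntegral_eq_integral_of_forall_compl_eq_zero fun x hx => hg x fun h => hx (hUW h)]
  rw [e _ fun x hx => by simp [h4 x hx], e _ fun x hx => by simp [h3 x hx]]
  exact h φ h1 (h2.trans hUW) i

/-- The tensor field with row `i` equal to `w` and other row zero. -/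
def rowTen (i : Fin 2) (w : Pt) : Ten := WithLp.toLp 2 fun p => if p.1 = i then w p.2 else 0

theorem inner_rowTen (i : Fin 2) (w : Pt) (a : Ten) :
    inner ℝ (rowTen i w) a = ∑ j : Fin 2, a (i, j) * w j := by
  simp only [rowTen, PiLp.inner_apply, Fintype.sum_prod_type]
  rw [Finset.sum_eq_single i]
  · simp
  · intro b _ hb; simp [hb]
  · simp

/-- Pairing one row of `τ` with a fixed L² field is a continuous functional of `τ`. Conditions
expressed by such integrals are therefore closed in L². -/
theorem exists_inner_eq_setIntegral {Ω U : Set Pt} (hU : U ⊆ Ω) (hm : MeasurableSet U)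
    {w : Pt → Pt} (hw : MemLp w 2 volume) (i : Fin 2) :
    ∃ F : L2Ten Ω, ∀ τ : L2Ten Ω,
      (inner ℝ F τ = ∫ x in U, ∑ j : Fin 2, τ x (i, j) * w x j) ∧
      IntegrableOn (fun x => ∑ j : Fin 2, τ x (i, j) * w x j) U := by
  have h1 : MemLp (fun x => rowTen i (w x)) 2 volume := by
    rw [memLp_piLp_iff]
    intro p
    by_cases h : p.1 = i
    · simpa [rowTen, h] using hw.eval_piLp p.2
    · simp [rowTen, h]
  have h2 : MemLp (U.indicator fun x => rowTen i (w x)) 2 (volume.restrict Ω) :=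
    (h1.indicator hm).restrict Ω
  refine ⟨h2.toLp, fun τ => ?_⟩
  have e : (fun x => inner ℝ ((MemLp.toLp _ h2) x) (τ x)) =ᵐ[volume.restrict Ω]
      U.indicator fun x => ∑ j : Fin 2, τ x (i, j) * w x j := by
    filter_upwards [h2.coeFn_toLp] with x hx
    rw [hx]
    by_cases hxU : x ∈ U
    · rw [indicator_of_mem hxU, indicator_of_mem hxU, inner_rowTen]
    · rw [indicator_of_notMem hxU, indicator_of_notMem hxU, inner_zero_left]
  constructor
  · rw [L2.inner_def, integral_congr_ae e, setIntegral_indicator hm,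
      inter_eq_self_of_subset_right hU]
  · have := (L2.integrable_inner (𝕜 := ℝ) h2.toLp τ).congr e
    rw [integrable_indicator_iff hm, IntegrableOn, Measure.restrict_restrict hm,
      inter_eq_self_of_subset_left hU] at this
    exact this

theorem IsTest.memLp_grad_volume {φ : Pt → ℝ} (h : IsTest φ) : MemLp (grad φ) 2 volume := by
  simpa using h.memLp_grad univ

theorem IsTest.memLp_rot_volume {φ : Pt → ℝ} (h : IsTest φ) : MemLp (rot φ) 2 volume := by
  simpa using h.memLp_rot univ

theorem integrableOn_row_pderiv {Ω U : Set Pt} (hU : U ⊆ Ω) (hm : MeasurableSet U) {φ : Pt → ℝ}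
    (h : IsTest φ) (τ : L2Ten Ω) (i : Fin 2) :
    IntegrableOn (fun x => ∑ j : Fin 2, τ x (i, j) * pderiv j φ x) U := by
  obtain ⟨F, hF⟩ := exists_inner_eq_setIntegral hU hm h.memLp_grad_volume i
  exact (hF τ).2

theorem integrableOn_comp_mul {Ω : Set Pt} {φ : Pt → ℝ} (h : IsTest φ) (f : L2Vec Ω) (i : Fin 2) :
    IntegrableOn (fun x => f x i * φ x) Ω := by
  have h1 : MemLp (fun x => f x i) 2 (volume.restrict Ω) := (Lp.memLp f).eval_piLp i
  have h2 : MemLp φ 2 (volume.restrict Ω) :=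
    (h.1.continuous.memLp_of_hasCompactSupport h.2).restrict Ω
  exact h1.integrable_mul h2

end WeakSymVEM

end

noncomputable section

namespace WeakSymVEM

/-! ### The discrete stress space -/

variable {Ω : Set Pt}

/-- Piecewise polynomial data: curl, divergence and normal trace on every cell. -/
abbrev StressData (k : ℕ) (T : PolygonalMesh Ω) : Type :=
  (Fin T.N → Fin 2 → Poly (k - 1)) × (Fin T.N → Fin 2 → Poly k) ×
    ((K : Fin T.N) → Fin (T.cell K).n → Fin 2 → Poly k)

/-- Test functions whose support meets the boundary of `Ω` only within `Γσ`. -/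
def IsStarTest (Ω Γσ : Set Pt) (φ : Pt → ℝ) : Prop := IsTest φ ∧ tsupport φ ∩ frontier Ω ⊆ Γσ

/-- The piecewise polynomial data `d` are the curl, the divergence and the normal trace of `τ`. -/
structure HasData (k : ℕ) (T : PolygonalMesh Ω) (Γσ : Set Pt) (d : StressData k T)
    (τ : L2Ten Ω) : Prop where
  curl : ∀ K, ∀ φ ∈ testSpaceIn (T.cell K).carrier, ∀ i : Fin 2,
    ∫ x in (T.cell K).carrier, ∑ j : Fin 2, τ x (i, j) * rot φ x j =
      -∫ x in (T.cell K).carrier, polyEval (d.1 K i) x * φ x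
  normal : ∀ K, ∀ φ, IsTest φ → ∀ i : Fin 2,
    ∫ x in (T.cell K).carrier, ∑ j : Fin 2, τ x (i, j) * grad φ x j =
      (∑ e, (T.cell K).edgeIntegral e (fun x => polyEval (d.2.2 K e i) x * φ x)) -
        ∫ x in (T.cell K).carrier, polyEval (d.2.1 K i) x * φ x
  global : ∀ φ, IsStarTest Ω Γσ φ → ∀ i : Fin 2,
    ∫ x in Ω, ∑ j : Fin 2, τ x (i, j) * grad φ x j =
      -∑ K, ∫ x in (T.cell K).carrier, polyEval (d.2.1 K i) x * φ x

theorem sum_mul_rot (a : Ten) (i : Fin 2) (φ : Pt → ℝ) (x : Pt) :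
    ∑ j : Fin 2, a (i, j) * rot φ x j = a (i, 1) * pderiv 0 φ x - a (i, 0) * pderiv 1 φ x := by
  simp [rot, Fin.sum_univ_two]; ring

theorem IsTest.isStarTest {φ : Pt → ℝ} (h : IsTest φ) (hΩ : IsOpen Ω) (hs : tsupport φ ⊆ Ω)
    (Γσ : Set Pt) : IsStarTest Ω Γσ φ := by
  refine ⟨h, ?_⟩
  rintro x ⟨hx, hx'⟩
  rw [hΩ.frontier_eq] at hx'
  exact absurd (hs hx) hx'.2

theorem edgeIntegral_eq_zero (K : SimplePolygon) (i : Fin K.n) {g : Pt → ℝ}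
    (h : ∀ x ∈ K.edge i, g x = 0) : K.edgeIntegral i g = 0 := by
  rw [SimplePolygon.edgeIntegral, intervalIntegral.integral_congr (g := fun _ => (0 : ℝ))]
  · simp
  · intro t ht
    rw [uIcc_of_le zero_le_one] at ht
    refine h _ ?_
    rw [SimplePolygon.edge, segment_eq_image_lineMap]
    exact ⟨t, ht, rfl⟩

namespace HasData

variable {k : ℕ} {T : PolygonalMesh Ω} {Γσ : Set Pt} {d : StressData k T} {τ : L2Ten Ω}

theorem isWeakDiv (h : HasData k T Γσ d τ) (K : Fin T.N) :
    IsWeakDiv (T.cell K).carrier τ (polyField fun i => d.2.1 K i) := by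
  intro φ h1 h2 i
  have := h.normal K φ h1 i
  rw [Finset.sum_eq_zero, zero_sub] at this
  · exact this
  · intro e _
    refine edgeIntegral_eq_zero _ _ fun x hx => ?_
    have hf := (T.cell K).edge_subset_frontier e hx
    rw [(T.cell K).isOpen.frontier_eq] at hf
    rw [image_eq_zero_of_notMem_tsupport fun h => hf.2 (h2 h), mul_zero]

theorem exists_isWeakDiv (h : HasData k T Γσ d τ) (hΩ : IsOpen Ω) :
    ∃ g : L2Vec Ω, IsWeakDiv Ω τ g ∧ ∀ K,
      g =ᵐ[volume.restrict (T.cell K).carrier] polyField fun i => d.2.1 K i := by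
  obtain ⟨g, hg⟩ := T.exists_glue _ fun K =>
    PolygonalMesh.memLp_polyEval (T.cell K) fun i => (d.2.1 K i).1
  refine ⟨g, fun φ h1 h2 i => ?_, hg⟩
  rw [T.setIntegral_eq_sum fun K => (integrableOn_comp_mul h1 g i).mono_set (T.subset K)]
  refine (h.global φ (h1.isStarTest hΩ h2 Γσ) i).trans ?_
  congr 1
  refine Finset.sum_congr rfl fun K _ => integral_congr_ae ?_
  filter_upwards [hg K] with x hx
  rw [hx]

theorem mem_hDiv (h : HasData k T Γσ d τ) (hΩ : IsOpen Ω) : τ ∈ HDiv Ω := by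
  obtain ⟨g, hg, -⟩ := h.exists_isWeakDiv hΩ
  exact ⟨g, hg⟩

theorem divergence_ae_eq (h : HasData k T Γσ d τ) (hΩ : IsOpen Ω) (K : Fin T.N) :
    divergence τ =ᵐ[volume.restrict (T.cell K).carrier] polyField fun i => d.2.1 K i := by
  obtain ⟨g, hg, hg'⟩ := h.exists_isWeakDiv hΩ
  rw [divergence_eq hΩ hg]
  exact hg' K

theorem mem_stressSpace (h : HasData k T Γσ d τ) (hΩ : IsOpen Ω) : τ ∈ stressSpace k T Γσ := by
  have hdeg : ∀ {m : ℕ} (p : Poly m), p.1.totalDegree ≤ m := fun p =>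
    (MvPolynomial.mem_restrictTotalDegree _ _ _).1 p.2
  refine ⟨⟨h.mem_hDiv hΩ, fun φ h1 h2 i => ?_⟩, fun K => ⟨?_, ⟨fun i => d.1 K i,
    fun i => hdeg _, ?_⟩, fun i => d.2.1 K i, fun i => hdeg _, h.isWeakDiv K,
    fun e i => d.2.2 K e i, fun e i => hdeg _, ?_⟩⟩
  · rw [normalPairing, integral_add (integrableOn_comp_mul h1 _ i) (by
      by_cases hm : MeasurableSet Ω
      · exact integrableOn_row_pderiv subset_rfl hm h1 τ i
      · exact absurd hΩ.measurableSet hm)]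
    have e := h.global φ ⟨h1, h2⟩ i
    rw [T.setIntegral_eq_sum fun K => (integrableOn_comp_mul h1 _ i).mono_set (T.subset K)]
    rw [show (∫ x in Ω, ∑ j : Fin 2, τ x (i, j) * pderiv j φ x) = _ from e, ← sub_eq_add_neg,
      sub_eq_zero]
    refine Finset.sum_congr rfl fun K _ => integral_congr_ae ?_
    filter_upwards [h.divergence_ae_eq hΩ K] with x hx
    rw [hx, polyField_apply]
  · exact (Lp.memLp τ).mono_measure (T.restrict_cell_le K)
  · intro φ h1 h2 i
    have := h.curl K φ ⟨h1, h2⟩ i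
    simp_rw [sum_mul_rot] at this
    exact this
  · intro φ h1 i
    simp only [normalPairing, polyField_apply]
    rw [integral_add ((T.cell K).integrableOn_polyEval_mul _ h1.1.continuous)
      (integrableOn_row_pderiv (T.subset K) (T.cell K).measurableSet h1 τ i)]
    have := h.normal K φ h1 i
    rw [show (∫ x in (T.cell K).carrier, ∑ j : Fin 2, τ x (i, j) * pderiv j φ x) = _ from this]
    simp

end HasData

/-- Rephrases membership by identities linear in the pair of field and data, with each integral of
`τ` continuous in `τ`; closedness of the space is read off from this form. The `global` identities
encode two things at once: tests supported in `Ω` give the weak divergence, and tests reaching `Γσ`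
give the vanishing normal trace. -/
theorem mem_stressSpace_iff (hΩ : IsOpen Ω) {k : ℕ} {T : PolygonalMesh Ω} {Γσ : Set Pt}
    {τ : L2Ten Ω} : τ ∈ stressSpace k T Γσ ↔ ∃ d, HasData k T Γσ d τ := by
  refine ⟨fun h => ?_, fun ⟨d, hd⟩ => hd.mem_stressSpace hΩ⟩
  obtain ⟨⟨hdiv, hstar⟩, hloc⟩ := h
  simp only [IsLocalStress] at hloc
  choose hL hcs f hf hwd q hq hn using hloc
  choose c hc hcurl using hcs
  have hmem : ∀ {m : ℕ} {p : MvPolynomial (Fin 2) ℝ}, p.totalDegree ≤ m → p ∈ Poly m := fun h =>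
    (MvPolynomial.mem_restrictTotalDegree _ _ _).2 h
  refine ⟨⟨fun K i => ⟨c K i, hmem (hc K i)⟩, fun K i => ⟨f K i, hmem (hf K i)⟩,
    fun K e i => ⟨q K e i, hmem (hq K e i)⟩⟩, ?_, ?_, ?_⟩
  · rintro K φ ⟨h1, h2⟩ i
    simp_rw [sum_mul_rot]
    exact hcurl K φ h1 h2 i
  · intro K φ h1 i
    have := hn K φ h1 i
    simp only [normalPairing, polyField_apply] at this
    rw [integral_add ((T.cell K).integrableOn_polyEval_mul _ h1.1.continuous)
      (integrableOn_row_pderiv (T.subset K) (T.cell K).measurableSet h1 τ i)] at this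
    rw [eq_sub_iff_add_eq, add_comm]
    exact this
  · intro φ h1 i
    have := hstar φ h1.1 h1.2 i
    rw [normalPairing, integral_add (integrableOn_comp_mul h1.1 _ i)
      (integrableOn_row_pderiv subset_rfl hΩ.measurableSet h1.1 τ i),
      T.setIntegral_eq_sum fun K => (integrableOn_comp_mul h1.1 _ i).mono_set (T.subset K)] at this
    rw [eq_neg_iff_add_eq_zero, add_comm, ← this]
    congr 1
    refine Finset.sum_congr rfl fun K _ => integral_congr_ae ?_
    -- The polynomial divergence on the cell and the restriction of the global divergence agree by
    -- uniqueness of weak divergences.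
    have hae := IsWeakDiv.ae_eq (T.cell K).isOpen (hwd K)
      ((isWeakDiv_divergence hdiv).mono (T.subset K)) (hL K)
      (PolygonalMesh.memLp_polyEval (T.cell K) (f K))
      ((Lp.memLp (divergence τ)).mono_measure (T.restrict_cell_le K))
    filter_upwards [hae] with x hx
    rw [← hx, polyField_apply]

/-! ### Closedness of the discrete stress space, and gluing of local fields -/

/-- The integral over a cell of the product of a polynomial with `φ`. -/
def cellPairing (K : SimplePolygon) (φ : testSpace) : MvPolynomial (Fin 2) ℝ →ₗ[ℝ] ℝ where
  toFun p := ∫ x in K.carrier, polyEval p x * φ.1 x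
  map_add' p q := by
    simp_rw [polyEval_add, add_mul]
    exact integral_add (K.integrableOn_polyEval_mul p φ.2.1.continuous)
      (K.integrableOn_polyEval_mul q φ.2.1.continuous)
  map_smul' a p := by
    simp_rw [polyEval_smul, mul_assoc]
    exact integral_const_mul _ _

/-- The integral over an edge of the product of a polynomial with `φ`. -/
def edgePairing (K : SimplePolygon) (e : Fin K.n) (φ : testSpace) :
    MvPolynomial (Fin 2) ℝ →ₗ[ℝ] ℝ where
  toFun p := K.edgeIntegral e fun x => polyEval p x * φ.1 x
  map_add' p q := by
    have hc : ∀ p : MvPolynomial (Fin 2) ℝ, IntervalIntegrable (fun t : ℝ =>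
        polyEval p (AffineMap.lineMap (K.vertex e) (K.vertex (finRotate K.n e)) t) *
        φ.1 (AffineMap.lineMap (K.vertex e) (K.vertex (finRotate K.n e)) t)) volume 0 1 :=
      fun p => (((continuous_polyEval p).mul φ.2.1.continuous).comp
        AffineMap.lineMap_continuous).intervalIntegrable _ _
    simp_rw [SimplePolygon.edgeIntegral, polyEval_add, add_mul]
    rw [intervalIntegral.integral_add (hc p) (hc q), mul_add]
  map_smul' a p := by
    simp_rw [SimplePolygon.edgeIntegral, polyEval_smul, mul_assoc,
      intervalIntegral.integral_const_mul, RingHom.id_apply, smul_eq_mul]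
    ring

/-- The discrete stress space as a closed subspace of `L²`. -/
theorem exists_closed_submodule (hΩ : IsOpen Ω) (k : ℕ) (T : PolygonalMesh Ω) (Γσ : Set Pt) :
    ∃ S : Submodule ℝ (L2Ten Ω), IsClosed (S : Set (L2Ten Ω)) ∧
      (S : Set (L2Ten Ω)) = stressSpace k T Γσ := by
  choose F₁ hF₁ using fun (K : Fin T.N) (φ : testSpaceIn (T.cell K).carrier) (i : Fin 2) =>
    exists_inner_eq_setIntegral (T.subset K) (T.cell K).measurableSet φ.2.1.memLp_rot_volume i
  choose F₂ hF₂ using fun (K : Fin T.N) (φ : testSpace) (i : Fin 2) =>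
    exists_inner_eq_setIntegral (T.subset K) (T.cell K).measurableSet (IsTest.memLp_grad_volume φ.2) i
  choose F₃ hF₃ using fun (φ : {φ // IsStarTest Ω Γσ φ}) (i : Fin 2) =>
    exists_inner_eq_setIntegral (Ω := Ω) subset_rfl hΩ.measurableSet φ.2.1.memLp_grad_volume i
  let A : L2Ten Ω →L[ℝ] ((K : Fin T.N) → testSpaceIn (T.cell K).carrier → Fin 2 → ℝ) ×
      (Fin T.N → testSpace → Fin 2 → ℝ) × ({φ // IsStarTest Ω Γσ φ} → Fin 2 → ℝ) :=
    (ContinuousLinearMap.pi fun K => ContinuousLinearMap.pi fun φ => ContinuousLinearMap.pi fun i =>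
      innerSL ℝ (F₁ K φ i)).prod
    ((ContinuousLinearMap.pi fun K => ContinuousLinearMap.pi fun φ => ContinuousLinearMap.pi fun i =>
      innerSL ℝ (F₂ K φ i)).prod
    (ContinuousLinearMap.pi fun φ => ContinuousLinearMap.pi fun i => innerSL ℝ (F₃ φ i)))
  let E : StressData k T →ₗ[ℝ] ((K : Fin T.N) → testSpaceIn (T.cell K).carrier → Fin 2 → ℝ) ×
      (Fin T.N → testSpace → Fin 2 → ℝ) × ({φ // IsStarTest Ω Γσ φ} → Fin 2 → ℝ) :=
    { toFun := fun d => ⟨fun K φ i => -cellPairing (T.cell K) ⟨φ.1, φ.2.1⟩ (d.1 K i),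
        fun K φ i => (∑ e, edgePairing (T.cell K) e φ (d.2.2 K e i)) -
          cellPairing (T.cell K) φ (d.2.1 K i),
        fun φ i => -∑ K, cellPairing (T.cell K) ⟨φ.1, φ.2.1⟩ (d.2.1 K i)⟩
      map_add' := fun d d' => by
        ext <;> simp [Finset.sum_add_distrib] <;> ring
      map_smul' := fun a d => by
        ext <;> simp [Finset.mul_sum, mul_sub] }
  -- `A` evaluates all test integrals of a field and `E` gives the values prescribed by polynomial
  -- data. The range of `E` is finite-dimensional, hence closed even in this large product, and so
  -- is its preimage under `A`.
  refine ⟨(LinearMap.range E).comap A.toLinearMap, ?_, ?_⟩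
  · have hc  := (LinearMap.range E).closed_of_finiteDimensional
    exact hc.preimage A.continuous
  · ext τ
    rw [mem_stressSpace_iff hΩ]
    refine exists_congr fun d => ?_
    constructor
    · intro h
      refine ⟨fun K φ hφ i => ?_, fun K φ hφ i => ?_, fun φ hφ i => ?_⟩
      · rw [← (hF₁ K ⟨φ, hφ⟩ i τ).1]
        exact (congrFun (congrFun (congrFun (congrArg Prod.fst h) K) ⟨φ, hφ⟩) i).symm
      · rw [← (hF₂ K ⟨φ, hφ⟩ i τ).1]
        exact (congrFun (congrFun (congrFun (congrArg (fun p => p.2.1) h) K) ⟨φ, hφ⟩) i).symm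
      · rw [← (hF₃ ⟨φ, hφ⟩ i τ).1]
        exact (congrFun (congrFun (congrArg (fun p => p.2.2) h) ⟨φ, hφ⟩) i).symm
    · intro h
      refine Prod.ext ?_ (Prod.ext ?_ ?_)
      · funext K φ i
        exact ((hF₁ K φ i τ).1.trans (h.curl K φ.1 φ.2 i)).symm
      · funext K φ i
        exact ((hF₂ K φ i τ).1.trans (h.normal K φ.1 φ.2 i)).symm
      · funext φ i
        exact ((hF₃ φ i τ).1.trans (h.global φ.1 φ.2 i)).symm

/-- Local fields with piecewise polynomial data whose normal traces cancel form an element of the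
discrete stress space. -/
theorem exists_mem_stressSpace (hΩ : IsOpen Ω) {k : ℕ} {T : PolygonalMesh Ω} {Γσ : Set Pt}
    (d : StressData k T) (t : (K : Fin T.N) → Fin 2 → L2Vec (T.cell K).carrier)
    (hcurl : ∀ K, ∀ φ, IsTest φ → tsupport φ ⊆ (T.cell K).carrier → ∀ i : Fin 2,
      ∫ x in (T.cell K).carrier, inner ℝ (t K i x) (rot φ x) =
        -∫ x in (T.cell K).carrier, polyEval (d.1 K i) x * φ x)
    (hnormal : ∀ K, ∀ φ, IsTest φ → ∀ i : Fin 2,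
      ∫ x in (T.cell K).carrier, (polyEval (d.2.1 K i) x * φ x + inner ℝ (t K i x) (grad φ x)) =
        ∑ e, (T.cell K).edgeIntegral e (fun x => polyEval (d.2.2 K e i) x * φ x))
    (hcancel : ∀ φ, IsStarTest Ω Γσ φ → ∀ i : Fin 2,
      ∑ K, ∑ e, (T.cell K).edgeIntegral e (fun x => polyEval (d.2.2 K e i) x * φ x) = 0) :
    ∃ τ ∈ stressSpace k T Γσ, ∀ K,
      (∀ᵐ x ∂(volume.restrict (T.cell K).carrier), ∀ i j : Fin 2, τ x (i, j) = t K i x j) ∧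
      divergence τ =ᵐ[volume.restrict (T.cell K).carrier] polyField fun i => d.2.1 K i := by
  obtain ⟨τ, hτ⟩ := T.exists_glue (fun K x => (WithLp.toLp 2 fun p => t K p.1 x p.2 : Ten))
    (fun K => by
      rw [memLp_piLp_iff]
      intro p
      exact (Lp.memLp (t K p.1)).eval_piLp p.2)
  have hτ' : ∀ K, ∀ᵐ x ∂(volume.restrict (T.cell K).carrier), ∀ i j : Fin 2,
      τ x (i, j) = t K i x j := by
    intro K
    filter_upwards [hτ K] with x hx i j
    rw [hx]
  have hrow : ∀ K (w : Pt → Pt) (i : Fin 2),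
      ∫ x in (T.cell K).carrier, ∑ j : Fin 2, τ x (i, j) * w x j =
        ∫ x in (T.cell K).carrier, inner ℝ (t K i x) (w x) := by
    intro K w i
    refine integral_congr_ae ?_
    filter_upwards [hτ' K] with x hx
    simp [hx, PiLp.inner_apply, mul_comm]
  have hn : ∀ K, ∀ φ, IsTest φ → ∀ i : Fin 2,
      ∫ x in (T.cell K).carrier, ∑ j : Fin 2, τ x (i, j) * grad φ x j =
      (∑ e, (T.cell K).edgeIntegral e (fun x => polyEval (d.2.2 K e i) x * φ x)) -
        ∫ x in (T.cell K).carrier, polyEval (d.2.1 K i) x * φ x := by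
    intro K φ h1 i
    rw [hrow, ← hnormal K φ h1 i,
      integral_add ((T.cell K).integrableOn_polyEval_mul _ h1.1.continuous)
        (integrableOn_inner_grad _ h1)]
    ring
  have hd : HasData k T Γσ d τ := by
    refine ⟨fun K φ hφ i => ?_, hn, fun φ hφ i => ?_⟩
    · rw [hrow]
      exact hcurl K φ hφ.1 hφ.2 i
    · rw [T.setIntegral_eq_sum (f := fun x => ∑ j : Fin 2, τ x (i, j) * grad φ x j)
        fun K => integrableOn_row_pderiv (T.subset K)
        (T.cell K).measurableSet hφ.1 τ i, Finset.sum_congr rfl fun K _ => hn K φ hφ.1 i,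
        Finset.sum_sub_distrib, hcancel φ hφ i, zero_sub]
  exact ⟨τ, hd.mem_stressSpace hΩ, fun K => ⟨hτ' K, hd.divergence_ae_eq hΩ K⟩⟩

end WeakSymVEM

end

noncomputable section

namespace WeakSymVEM

/-! ### Edge integrals -/

/-- Its role is to make edge integrals depend only on the edge as a set, although adjacent cells may
run through it in opposite directions. End points are extreme: in the parameter of the line, `0` and
`1` can be convex combinations of `α`, `β` in `[0, 1]` only if these are `0` and `1` themselves. -/
theorem segment_eq_segment {P Q P' Q' : Pt} (h : P ≠ Q)
    (he : segment ℝ P' Q' = segment ℝ P Q) : (P' = P ∧ Q' = Q) ∨ (P' = Q ∧ Q' = P) := by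
  have hP : P ∈ segment ℝ P' Q' := he ▸ left_mem_segment ℝ P Q
  have hQ : Q ∈ segment ℝ P' Q' := he ▸ right_mem_segment ℝ P Q
  have hP' : P' ∈ segment ℝ P Q := he ▸ left_mem_segment ℝ P' Q'
  have hQ' : Q' ∈ segment ℝ P Q := he ▸ right_mem_segment ℝ P' Q'
  rw [segment_eq_image_lineMap] at hP hQ hP' hQ'
  obtain ⟨s, hs, hsP⟩ := hP
  obtain ⟨t, ht, htQ⟩ := hQ
  obtain ⟨α, hα, rfl⟩ := hP'
  obtain ⟨β, hβ, rfl⟩ := hQ'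
  have comb : ∀ r : ℝ, AffineMap.lineMap (AffineMap.lineMap P Q α : Pt) (AffineMap.lineMap P Q β) r
      = AffineMap.lineMap P Q ((1 - r) * α + r * β) := by
    intro r
    simp only [AffineMap.lineMap_apply_module]
    module
  have inj : Function.Injective (AffineMap.lineMap P Q : ℝ → Pt) :=
    AffineMap.lineMap_injective ℝ h
  have e1 : (1 - s) * α + s * β = 0 := inj (by rw [← comb, hsP, AffineMap.lineMap_apply_zero])
  have e2 : (1 - t) * α + t * β = 1 := inj (by rw [← comb, htQ, AffineMap.lineMap_apply_one])
  have a1 : (1 - s) * α = 0 := by nlinarith [mul_nonneg (sub_nonneg.2 hs.2) hα.1, mul_nonneg hs.1 hβ.1]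
  have a2 : s * β = 0 := by linarith
  rcases mul_eq_zero.1 a2 with h0 | h0
  · have hα0 : α = 0 := by rw [h0] at a1; linarith
    have hβ1 : β = 1 := by rw [hα0] at e2; nlinarith [ht.1, ht.2, hβ.1, hβ.2]
    left; simp [hα0, hβ1]
  · have hα1 : α = 1 := by rw [h0] at e2; nlinarith [ht.1, ht.2, hα.1, hα.2]
    right; simp [h0, hα1]

theorem edgeIntegral_eq_of_edge_eq {K L : SimplePolygon} {i : Fin K.n} {j : Fin L.n}
    (h : L.edge j = K.edge i) (g : Pt → ℝ) : L.edgeIntegral j g = K.edgeIntegral i g := by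
  unfold SimplePolygon.edgeIntegral SimplePolygon.edgeLength
  rcases segment_eq_segment (K.vertex_ne i) h with ⟨h1, h2⟩ | ⟨h1, h2⟩
  · rw [h1, h2]
  · rw [h1, h2, dist_comm]
    congr 1
    have e : ∀ t : ℝ, g (AffineMap.lineMap (K.vertex (finRotate K.n i)) (K.vertex i) t)
        = (fun s => g (AffineMap.lineMap (K.vertex i) (K.vertex (finRotate K.n i)) s)) (1 - t) :=
      fun t => by simp only [AffineMap.lineMap_apply_one_sub]
    rw [intervalIntegral.integral_congr fun t _ => e t,
      intervalIntegral.integral_comp_sub_left fun s =>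
        g (AffineMap.lineMap (K.vertex i) (K.vertex (finRotate K.n i)) s)]
    simp

theorem edgeIntegral_nonneg {K : SimplePolygon} {i : Fin K.n} {g : Pt → ℝ} (h : ∀ x, 0 ≤ g x) :
    0 ≤ K.edgeIntegral i g :=
  mul_nonneg dist_nonneg (intervalIntegral.integral_nonneg zero_le_one fun _ _ => h _)

/-- A continuous square of integral zero vanishes on the open edge, hence by continuity at its end
points. Two points are all that is needed to identify a rigid motion. -/
theorem eq_zero_of_edgeIntegral_sq_eq_zero {K : SimplePolygon} {i : Fin K.n} {g : Pt → ℝ}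
    (hg : Continuous g) (h : K.edgeIntegral i (fun x => g x * g x) = 0) :
    g (K.vertex i) = 0 ∧ g (K.vertex (finRotate K.n i)) = 0 := by
  have h1 := (mul_eq_zero.1 h).resolve_left (dist_ne_zero.2 (K.vertex_ne i))
  set f : ℝ → ℝ := fun t => g (AffineMap.lineMap (K.vertex i) (K.vertex (finRotate K.n i)) t)
  have hf : Continuous f := hg.comp AffineMap.lineMap_continuous
  have h2 : (fun t => f t * f t) =ᵐ[volume.restrict (Ioc 0 1)] 0 :=
    (intervalIntegral.integral_eq_zero_iff_of_le_of_nonneg_ae zero_le_one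
      (Filter.Eventually.of_forall fun t => mul_self_nonneg (f t))
      ((hf.mul hf).intervalIntegrable _ _)).1 h1
  rw [← restrict_Ioo_eq_restrict_Ioc] at h2
  have h3 := Measure.eqOn_open_of_ae_eq h2 isOpen_Ioo (hf.mul hf).continuousOn
    (continuousOn_const (c := (0 : ℝ)))
  have h4 := Set.EqOn.closure h3 (hf.mul hf) (continuous_const (y := (0 : ℝ)))
  rw [closure_Ioo zero_ne_one] at h4
  constructor
  · simpa [f] using h4 (left_mem_Icc.2 zero_le_one)
  · simpa [f] using h4 (right_mem_Icc.2 zero_le_one)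

/-! ### Local fields on a cell -/

/-- Any smooth function agrees on a bounded set with a test function. -/
theorem exists_isTest_eqOn {K : Set Pt} (hKo : IsOpen K) (hK : Bornology.IsBounded K) {ψ : Pt → ℝ}
    (hψ : ContDiff ℝ ∞ ψ) : ∃ φ, IsTest φ ∧ EqOn φ ψ (closure K) ∧ EqOn (grad φ) (grad ψ) K := by
  obtain ⟨R, hR⟩ := hK.subset_closedBall (0 : Pt)
  let b : ContDiffBump (0 : Pt) := ⟨max R 1, max R 1 + 1, by positivity, by linarith⟩
  have hb : EqOn (fun x => b x * ψ x) ψ (closure K) := by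
    intro x hx
    have : x ∈ Metric.closedBall (0 : Pt) b.rIn :=
      (closure_minimal (hR.trans (Metric.closedBall_subset_closedBall (le_max_left R 1)))
        Metric.isClosed_closedBall) hx
    simp only [b.one_of_mem_closedBall this, one_mul]
  refine ⟨fun x => b x * ψ x, ⟨b.contDiff.mul hψ, b.hasCompactSupport.mul_right⟩, hb, ?_⟩
  intro x hx
  have : (fun x => b x * ψ x) =ᶠ[nhds x] ψ :=
    Filter.eventuallyEq_of_mem (hKo.mem_nhds hx) (hb.mono subset_closure)
  ext j
  simp [grad, pderiv, this.fderiv_eq]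

namespace SimplePolygon

variable (K : SimplePolygon)

theorem edge_subset_closure (e : Fin K.n) : K.edge e ⊆ closure K.carrier :=
  (K.edge_subset_frontier e).trans frontier_subset_closure

theorem edgeIntegral_congr (e : Fin K.n) {g g' : Pt → ℝ} (h : EqOn g g' (closure K.carrier)) :
    K.edgeIntegral e g = K.edgeIntegral e g' := by
  unfold edgeIntegral
  congr 1
  refine intervalIntegral.integral_congr fun t ht => ?_
  rw [uIcc_of_le zero_le_one] at ht
  refine h (K.edge_subset_closure e ?_)
  rw [edge, segment_eq_image_lineMap]
  exact ⟨t, ht, rfl⟩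

variable {K}

/-- Green's formula with polynomial test functions. -/
theorem integral_mul_add_inner_grad {f : Pt → ℝ} {t : L2Vec K.carrier}
    {q : Fin K.n → Pt → ℝ}
    (h : ∀ φ, IsTest φ → ∫ x in K.carrier, (f x * φ x + inner ℝ (t x) (grad φ x)) =
      ∑ e, K.edgeIntegral e (fun x => q e x * φ x)) {ψ : Pt → ℝ} (hψ : ContDiff ℝ ∞ ψ) :
    ∫ x in K.carrier, (f x * ψ x + inner ℝ (t x) (grad ψ x)) =
      ∑ e, K.edgeIntegral e (fun x => q e x * ψ x) := by
  obtain ⟨φ, h1, h2, h3⟩ := exists_isTest_eqOn K.isOpen K.isBounded hψ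
  have := h φ h1
  rw [setIntegral_congr_fun K.measurableSet (g := fun x => f x * ψ x + inner ℝ (t x) (grad ψ x))
    (fun x hx => by simp only [h2 (subset_closure hx), h3 hx])] at this
  rw [this]
  exact Finset.sum_congr rfl fun e _ => K.edgeIntegral_congr e fun x hx => by simp only [h2 hx]

theorem exists_field_edge {c : Pt} (hK : IsStarAbout K.carrier c) (e : Fin K.n) {f q : Pt → ℝ}
    (hf : Continuous f) (hq : Continuous q) (hfq : ∫ x in K.carrier, f x = K.edgeIntegral e q) :
    ∃ t : L2Vec K.carrier,
      (∀ φ, IsTest φ → ∫ x in K.carrier, (f x * φ x + inner ℝ (t x) (grad φ x)) =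
        K.edgeIntegral e (fun x => q x * φ x)) ∧
      ∀ φ, IsTest φ → tsupport φ ⊆ K.carrier → ∫ x in K.carrier, inner ℝ (t x) (rot φ x) = 0 := by
  obtain ⟨r, hr, hs⟩ := hK.star
  obtain ⟨t, h1, h2⟩ := exists_field_div_normal K.isOpen K.isBounded K.isConnected.nonempty hr hs
    (K.edge_subset_closure e) (hK.independent (K.vertex_ne e) (K.edge_subset_frontier e)) hf
    (q := fun x => K.edgeLength e * q x) (continuous_const.mul hq) (by
      rw [hfq, edgeIntegral, intervalIntegral.integral_const_mul])
  refine ⟨t, fun φ hφ => ?_, h2⟩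
  rw [h1 φ hφ, edgeIntegral]
  simp_rw [mul_assoc]
  rw [intervalIntegral.integral_const_mul]

/-- There is a curl free field with given normal trace and constant divergence. -/
theorem exists_field_edges {c : Pt} (hK : IsStarAbout K.carrier c) {q : Fin K.n → Pt → ℝ}
    (hq : ∀ e, Continuous (q e)) : ∃ (m : ℝ) (t : L2Vec K.carrier),
      (∀ φ, IsTest φ → ∫ x in K.carrier, (m * φ x + inner ℝ (t x) (grad φ x)) =
        ∑ e, K.edgeIntegral e (fun x => q e x * φ x)) ∧
      ∀ φ, IsTest φ → tsupport φ ⊆ K.carrier → ∫ x in K.carrier, inner ℝ (t x) (rot φ x) = 0 := by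
  have hvol : (volume K.carrier).toReal ≠ 0 :=
    (ENNReal.toReal_pos (K.isOpen.measure_pos volume K.isConnected.nonempty).ne'
      K.isBounded.measure_lt_top.ne).ne'
  -- Each edge is handled by its own Neumann problem, with the constant divergence forced by
  -- compatibility; the fields are then added.
  choose t ht ht' using fun e => exists_field_edge hK e
    (f := fun _ => K.edgeIntegral e (q e) / (volume K.carrier).toReal) continuous_const (hq e) (by
      rw [setIntegral_const, smul_eq_mul, measureReal_def, mul_div_cancel₀ _ hvol])
  have hsum : ∀ w : L2Vec K.carrier, inner ℝ (∑ e, t e) w = ∑ e, inner ℝ (t e) w := fun w =>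
    sum_inner _ _ _
  refine ⟨∑ e, K.edgeIntegral e (q e) / (volume K.carrier).toReal, ∑ e, t e, fun φ hφ => ?_,
    fun φ hφ hs => ?_⟩
  · have hi : ∀ m : ℝ, IntegrableOn (fun x => m * φ x) K.carrier := fun m =>
      integrableOn_of_continuous K.isBounded (continuous_const.mul hφ.1.continuous)
    have h2 := inner_gradL2 (∑ e, t e) ⟨φ, hφ⟩
    rw [hsum] at h2
    rw [integral_add (hi _) (integrableOn_inner_grad _ hφ), ← h2, integral_const_mul,
      Finset.sum_mul, ← Finset.sum_add_distrib]
    refine Finset.sum_congr rfl fun e _ => ?_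
    rw [← ht e φ hφ, integral_add (hi _) (integrableOn_inner_grad _ hφ), integral_const_mul,
      inner_gradL2]
  · have h2 := inner_rotL2 (∑ e, t e) ⟨φ, hφ, hs⟩
    rw [← h2, hsum]
    refine Finset.sum_eq_zero fun e _ => ?_
    rw [inner_rotL2]
    exact ht' e φ hφ hs

/-- A field with zero normal trace, zero curl and given divergence of mean zero. -/
theorem exists_field_meanZero {c : Pt} (hK : IsStarAbout K.carrier c) {f : Pt → ℝ}
    (hf : Continuous f) (hf0 : ∫ x in K.carrier, f x = 0) : ∃ t : L2Vec K.carrier,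
      (∀ φ, IsTest φ → ∫ x in K.carrier, (f x * φ x + inner ℝ (t x) (grad φ x)) = 0) ∧
      ∀ φ, IsTest φ → tsupport φ ⊆ K.carrier → ∫ x in K.carrier, inner ℝ (t x) (rot φ x) = 0 := by
  have h0 : ∀ e, K.edgeIntegral e (fun _ => 0) = 0 := fun e => by simp [edgeIntegral]
  -- The zero trace is prescribed on an arbitrary edge; the mean value condition is then the
  -- compatibility condition.
  obtain ⟨t, h1, h2⟩ := exists_field_edge hK ⟨0, by linarith [K.three_le]⟩ (q := fun _ => 0) hf
    continuous_const (by rw [hf0, h0])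
  exact ⟨t, fun φ hφ => by rw [h1 φ hφ]; simp [h0], h2⟩

end SimplePolygon

/-! ### Rotations and rigid motions -/

/-- The rows of the skew tensor with upper right entry `a`. -/
def skewRow (a : ℝ) (i : Fin 2) : Pt := if i = 0 then !₂[0, a] else !₂[-a, 0]

/-- The components of the rigid motion with gradient the skew tensor with entry `a` and
translation `m`. -/
def rigid (a : ℝ) (m : Fin 2 → ℝ) (i : Fin 2) : MvPolynomial (Fin 2) ℝ :=
  if i = 0 then MvPolynomial.C a * MvPolynomial.X 1 + MvPolynomial.C (m 0)
  else -(MvPolynomial.C a * MvPolynomial.X 0) + MvPolynomial.C (m 1)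

theorem totalDegree_rigid_le (a : ℝ) (m : Fin 2 → ℝ) (i : Fin 2) {k : ℕ} (hk : 1 ≤ k) :
    (rigid a m i).totalDegree ≤ k := by
  have h : ∀ j : Fin 2, (MvPolynomial.C a * MvPolynomial.X j :
      MvPolynomial (Fin 2) ℝ).totalDegree ≤ 1 := fun j =>
    (MvPolynomial.totalDegree_mul _ _).trans (by simp)
  refine le_trans ?_ hk
  unfold rigid
  split_ifs
  · exact (MvPolynomial.totalDegree_add _ _).trans (max_le (h 1) (by simp))
  · refine (MvPolynomial.totalDegree_add _ _).trans (max_le ?_ (by simp))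
    rw [MvPolynomial.totalDegree_neg]
    exact h 0

theorem polyEval_rigid (a : ℝ) (m : Fin 2 → ℝ) (i : Fin 2) (x : Pt) :
    polyEval (rigid a m i) x = if i = 0 then a * x 1 + m 0 else -(a * x 0) + m 1 := by
  unfold rigid
  split_ifs <;> simp [polyEval]

theorem grad_rigid (a : ℝ) (m : Fin 2 → ℝ) (i : Fin 2) (x : Pt) :
    grad (polyEval (rigid a m i)) x = skewRow a i := by
  ext j
  simp only [grad, pderiv_polyEval]
  fin_cases i <;> fin_cases j <;> simp [rigid, skewRow, polyEval, MvPolynomial.pderiv_X]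

/-- A rigid motion vanishing at two different points is zero. -/
theorem rigid_eq_of_two_points {a a' : ℝ} {m m' : Fin 2 → ℝ} {P Q : Pt} (h : P ≠ Q)
    (hP : ∀ i, polyEval (rigid a m i) P = polyEval (rigid a' m' i) P)
    (hQ : ∀ i, polyEval (rigid a m i) Q = polyEval (rigid a' m' i) Q) : a = a' ∧ m = m' := by
  simp only [polyEval_rigid, Fin.forall_fin_two] at hP hQ
  simp only [if_true, one_ne_zero, if_false] at hP hQ
  obtain ⟨p0, p1⟩ := hP
  obtain ⟨q0, q1⟩ := hQ
  have ha : a = a' := by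
    by_contra hne
    have hne : a - a' ≠ 0 := sub_ne_zero.2 hne
    apply h
    ext i
    fin_cases i
    · exact mul_left_cancel₀ hne (by simp only [Fin.zero_eta]; linear_combination q1 - p1)
    · exact mul_left_cancel₀ hne (by simp only [Fin.mk_one]; linear_combination p0 - q0)
  subst ha
  refine ⟨rfl, funext fun i => ?_⟩
  fin_cases i
  · simp only [Fin.zero_eta]; linarith
  · simp only [Fin.mk_one]; linarith

/-- Shows that the row-wise curl of a skew field with entry `ρ` is the gradient of `ρ`, so a skew
field without curl is constant. -/
theorem inner_skewRow_rot (a : ℝ) (i : Fin 2) (φ : Pt → ℝ) (x : Pt) :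
    inner ℝ (skewRow a i) (rot φ x) = a * pderiv i φ x := by
  rw [inner_rot]
  fin_cases i <;> simp [skewRow]

theorem memLp_skewRow (K : SimplePolygon) (ρ : MvPolynomial (Fin 2) ℝ) (i : Fin 2) :
    MemLp (fun x => skewRow (polyEval ρ x) i) 2 (volume.restrict K.carrier) := by
  apply memLp_of_continuous K.isBounded
  have := continuous_polyEval ρ
  unfold skewRow
  split_ifs
  all_goals
    refine (PiLp.continuous_toLp 2 _).comp (continuous_pi fun j => ?_)
    fin_cases j
  exacts [continuous_const, this, this.neg, continuous_const]

theorem setIntegral_polyEval_mul_pderiv {U : Set Pt} (ρ : MvPolynomial (Fin 2) ℝ) (i : Fin 2)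
    {φ : Pt → ℝ} (hφ : IsTest φ) (hU : tsupport φ ⊆ U) :
    ∫ x in U, polyEval ρ x * pderiv i φ x =
      -∫ x in U, polyEval (MvPolynomial.pderiv i ρ) x * φ x := by
  have hρ := contDiff_polyEval ρ
  rw [setIntegral_eq_integral_of_forall_compl_eq_zero fun x hx => by
      rw [pderiv_eq_zero_of_notMem (fun h => hx (hU h)), mul_zero],
    setIntegral_eq_integral_of_forall_compl_eq_zero fun x hx => by
      rw [image_eq_zero_of_notMem_tsupport (fun h => hx (hU h)), mul_zero]]
  simp_rw [← pderiv_polyEval]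
  refine integral_mul_fderiv_eq_neg_fderiv_mul_of_integrable ?_ ?_ ?_ ?_ ?_
  · exact ((contDiff_pderiv hρ i).continuous.mul hφ.1.continuous).integrable_of_hasCompactSupport
      hφ.2.mul_left
  · exact (hρ.continuous.mul (hφ.pderiv i).1.continuous).integrable_of_hasCompactSupport
      (hφ.pderiv i).2.mul_left
  · exact (hρ.continuous.mul hφ.1.continuous).integrable_of_hasCompactSupport hφ.2.mul_left
  · exact fun x _ => hρ.differentiable (by simp) x
  · exact fun x _ => hφ.1.differentiable (by simp) x

/-- A polynomial whose weak gradient vanishes on a cell is constant there. -/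
theorem exists_polyEval_eq_const (K : SimplePolygon) (ρ : MvPolynomial (Fin 2) ℝ)
    (h : ∀ i, ∀ φ, IsTest φ → tsupport φ ⊆ K.carrier →
      ∫ x in K.carrier, polyEval ρ x * pderiv i φ x = 0) :
    ∃ a, ∀ x ∈ K.carrier, polyEval ρ x = a := by
  have hz : ∀ i, EqOn (polyEval (MvPolynomial.pderiv i ρ)) 0 K.carrier := by
    intro i
    have hc := continuous_polyEval (MvPolynomial.pderiv i ρ)
    refine Measure.eqOn_open_of_ae_eq (μ := volume) ?_ K.isOpen hc.continuousOn continuousOn_const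
    rw [Filter.EventuallyEq, ae_restrict_iff' K.measurableSet]
    refine K.isOpen.ae_eq_zero_of_integral_contDiff_smul_eq_zero
      (hc.locallyIntegrable.locallyIntegrableOn _) fun φ h1 h2 h3 => ?_
    have e := setIntegral_polyEval_mul_pderiv ρ i ⟨h1, h2⟩ h3
    rw [h i φ ⟨h1, h2⟩ h3, zero_eq_neg, setIntegral_eq_integral_of_forall_compl_eq_zero
      fun x hx => by
        rw [image_eq_zero_of_notMem_tsupport (fun h => hx (h3 h)), mul_zero]] at e
    simpa [mul_comm] using e
  have hd : Differentiable ℝ (polyEval ρ) := (contDiff_polyEval ρ).differentiable (by simp)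
  refine K.isOpen.exists_is_const_of_fderiv_eq_zero K.isConnected.isPreconnected
    hd.differentiableOn fun x hx => ?_
  have hg : grad (polyEval ρ) x = 0 := by
    ext i
    simp only [grad, pderiv_polyEval]
    exact hz i hx
  have := norm_grad (polyEval ρ) x
  rw [hg, norm_zero] at this
  exact norm_eq_zero.1 this.symm

end WeakSymVEM

end

noncomputable section

namespace WeakSymVEM

/-! ### Injectivity of the constraints -/

variable {Ω : Set Pt}

/-- The components of `u` are given by the polynomials `p` and `r` is the skew field with upper
right entry `ρ`, cell by cell. -/
structure IsPiecewise (T : PolygonalMesh Ω) (p : Fin T.N → Fin 2 → MvPolynomial (Fin 2) ℝ)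
    (ρ : Fin T.N → MvPolynomial (Fin 2) ℝ) (u : L2Vec Ω) (r : L2Ten Ω) : Prop where
  vec : ∀ K, ∀ᵐ x ∂(volume.restrict (T.cell K).carrier), ∀ i, u x i = polyEval (p K i) x
  skew : ∀ K, ∀ᵐ x ∂(volume.restrict (T.cell K).carrier), ∀ i j,
    r x (i, j) = skewRow (polyEval (ρ K) x) i j

theorem exists_isPiecewise {k : ℕ} {T : PolygonalMesh Ω} {u : L2Vec Ω} {r : L2Ten Ω}
    (hu : u ∈ velocitySpace k T) (hr : r ∈ rotationSpace k T) :
    ∃ p ρ, IsPiecewise T p ρ u r ∧ (∀ K i, (p K i).totalDegree ≤ k) ∧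
      ∀ K, (ρ K).totalDegree ≤ k := by
  choose p hp hpu using hu
  obtain ⟨hs, hr⟩ := hr
  choose s hsd hsr using hr
  refine ⟨p, fun K => s K (0, 1), ⟨hpu, fun K => ?_⟩, hp, fun K => hsd K _⟩
  filter_upwards [hsr K, ae_mono (T.restrict_cell_le K) hs] with x h1 h2
  have h00 : r x (0, 0) = 0 := by linarith [h2 0 0]
  have h11 : r x (1, 1) = 0 := by linarith [h2 1 1]
  simp only [Fin.forall_fin_two, ← h1]
  simp [skewRow, h00, h11, h2 1 0]

theorem integrableOn_inner_skewRow (K : SimplePolygon) (t : L2Vec K.carrier)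
    (ρ : MvPolynomial (Fin 2) ℝ) (i : Fin 2) :
    IntegrableOn (fun x => inner ℝ (t x) (skewRow (polyEval ρ x) i)) K.carrier := by
  refine (L2.integrable_inner (𝕜 := ℝ) t (memLp_skewRow K ρ i).toLp).congr ?_
  filter_upwards [(memLp_skewRow K ρ i).coeFn_toLp] with x hx
  rw [hx]

section Pairing

variable {T : PolygonalMesh Ω} {p : Fin T.N → Fin 2 → MvPolynomial (Fin 2) ℝ}
  {ρ : Fin T.N → MvPolynomial (Fin 2) ℝ} {u : L2Vec Ω} {r : L2Ten Ω}

/-- Splits the coupling form by cells and rows, into integrals of the shape of Green's formula once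
the skew row is a gradient. -/
theorem IsPiecewise.pairing_eq_sum (h : IsPiecewise T p ρ u r) {τ : L2Ten Ω} {v : L2Vec Ω}
    {t : (K : Fin T.N) → Fin 2 → L2Vec (T.cell K).carrier}
    {f : Fin T.N → Fin 2 → MvPolynomial (Fin 2) ℝ}
    (hτ : ∀ K, ∀ᵐ x ∂(volume.restrict (T.cell K).carrier), ∀ i j : Fin 2, τ x (i, j) = t K i x j)
    (hv : ∀ K, v =ᵐ[volume.restrict (T.cell K).carrier] polyField (f K)) :
    inner ℝ v u + inner ℝ τ r = ∑ K, ∑ i, ∫ x in (T.cell K).carrier,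
      (polyEval (f K i) x * polyEval (p K i) x +
        inner ℝ (t K i x) (skewRow (polyEval (ρ K) x) i)) := by
  have i1 := L2.integrable_inner (𝕜 := ℝ) v u
  have i2 := L2.integrable_inner (𝕜 := ℝ) τ r
  rw [L2.inner_def, L2.inner_def, ← integral_add i1 i2,
    T.setIntegral_eq_sum (f := fun x => inner ℝ (v x) (u x) + inner ℝ (τ x) (r x))
      fun K => (i1.add i2).mono_measure (T.restrict_cell_le K)]
  refine Finset.sum_congr rfl fun K _ => ?_
  have hI : ∀ i ∈ Finset.univ, IntegrableOn (fun x => polyEval (f K i) x * polyEval (p K i) x +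
      inner ℝ (t K i x) (skewRow (polyEval (ρ K) x) i)) (T.cell K).carrier := fun i _ =>
    ((T.cell K).integrableOn_polyEval_mul _ (continuous_polyEval _)).add
      (integrableOn_inner_skewRow _ _ _ _)
  rw [← integral_finsetSum _ hI]
  refine integral_congr_ae ?_
  filter_upwards [h.vec K, h.skew K, hτ K, hv K] with x h1 h2 h3 h4
  simp only [PiLp.inner_apply, h1, h2, h3, h4, Fintype.sum_prod_type, polyField_apply,
    Finset.sum_add_distrib]
  congr 1
  exact Finset.sum_congr rfl fun i _ => by simp [mul_comm]

variable {k : ℕ} {Γσ : Set Pt}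

/-- Testing with the projection of the rotation to the rotated gradients. -/
theorem IsPiecewise.exists_rotation_const (hΩ : IsOpen Ω) (h : IsPiecewise T p ρ u r)
    (hρ : ∀ K, (ρ K).totalDegree ≤ k)
    (h0 : ∀ τ ∈ stressSpace k T Γσ, inner ℝ (divergence τ) u + inner ℝ τ r = 0) (K : Fin T.N) :
    ∃ a, ∀ x ∈ (T.cell K).carrier, polyEval (ρ K) x = a := by
  let w : (K : Fin T.N) → Fin 2 → L2Vec (T.cell K).carrier := fun K i =>
    (memLp_skewRow (T.cell K) (ρ K) i).toLp
  have hw : ∀ K i, w K i =ᵐ[volume.restrict (T.cell K).carrier]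
      fun x => skewRow (polyEval (ρ K) x) i := fun K i =>
    (memLp_skewRow (T.cell K) (ρ K) i).coeFn_toLp
  choose t ht₁ ht₂ ht₃ using fun K i => exists_divFree_field (w K i)
  have hrot : ∀ K i φ, IsTest φ → tsupport φ ⊆ (T.cell K).carrier →
      ∫ x in (T.cell K).carrier, inner ℝ (t K i x) (rot φ x) =
        ∫ x in (T.cell K).carrier, polyEval (ρ K) x * pderiv i φ x := by
    intro K i φ h1 h2
    rw [ht₂ K i ⟨φ, h1, h2⟩]
    refine integral_congr_ae ?_
    filter_upwards [hw K i] with x hx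
    rw [hx, inner_skewRow_rot]
  -- The data of the test stress: curl `∇ρ`, zero divergence, zero normal traces. The traces cancel
  -- trivially, so no condition links the cells.
  obtain ⟨τ, hτ, hτ'⟩ := exists_mem_stressSpace (Γσ := Γσ) hΩ (k := k)
    (⟨fun K i => ⟨MvPolynomial.pderiv i (ρ K), (MvPolynomial.mem_restrictTotalDegree _ _ _).2
      (totalDegree_pderiv_le (hρ K) i)⟩, 0, 0⟩ : StressData k T) t
    (fun K φ h1 h2 i => by
      rw [hrot K i φ h1 h2, setIntegral_polyEval_mul_pderiv _ _ h1 h2])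
    (fun K φ h1 i => by simpa [SimplePolygon.edgeIntegral] using ht₁ K i ⟨φ, h1⟩)
    (fun φ hφ i => by simp [SimplePolygon.edgeIntegral])
  have e := h0 τ hτ
  rw [h.pairing_eq_sum (fun K => (hτ' K).1) (fun K => (hτ' K).2)] at e
  -- With zero divergence only the pairing with the rotation remains, and the inner product of `w`
  -- with its orthogonal projection `t` is `‖t‖²`.
  have e2 : ∀ K i, ∫ x in (T.cell K).carrier, (polyEval ((0 : Fin 2 → Poly k) i) x *
      polyEval (p K i) x + inner ℝ (t K i x) (skewRow (polyEval (ρ K) x) i)) = ‖t K i‖ ^ 2 := by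
    intro K i
    rw [← ht₃, inner_L2_eq_of_ae (t K i) (w K i) (Filter.EventuallyEq.refl _ _) (hw K i)]
    simp
  have e3 : ∑ K, ∑ i, ‖t K i‖ ^ 2 = 0 := by
    rw [← e]
    exact Finset.sum_congr rfl fun K _ => Finset.sum_congr rfl fun i _ => (e2 K i).symm
  have e4 : ∀ i, t K i = 0 := by
    intro i
    have h1 := (Finset.sum_eq_zero_iff_of_nonneg fun K _ =>
      Finset.sum_nonneg fun i _ => sq_nonneg ‖t K i‖).1 e3 K (Finset.mem_univ _)
    have h2 := (Finset.sum_eq_zero_iff_of_nonneg fun i _ => sq_nonneg ‖t K i‖).1 h1 i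
      (Finset.mem_univ _)
    exact norm_eq_zero.1 (pow_eq_zero_iff two_ne_zero |>.1 h2)
  refine exists_polyEval_eq_const _ _ fun i φ h1 h2 => ?_
  rw [← hrot K i φ h1 h2, e4 i]
  refine integral_eq_zero_of_ae ?_
  filter_upwards [Lp.coeFn_zero Pt 2 (volume.restrict (T.cell K).carrier)] with x hx
  rw [hx]; simp

theorem polyEval_rigid_eq_add (a : ℝ) (m : Fin 2 → ℝ) (i : Fin 2) (x : Pt) :
    polyEval (rigid a m i) x = polyEval (rigid a 0 i) x + m i := by
  simp only [polyEval_rigid]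
  fin_cases i <;> simp

/-- Testing with curl free fields with zero normal trace. -/
theorem IsPiecewise.exists_rigid (hΩ : IsOpen Ω) (hT : T.IsStarMesh) (hk : 1 ≤ k)
    (h : IsPiecewise T p ρ u r) (hp : ∀ K i, (p K i).totalDegree ≤ k)
    (h0 : ∀ τ ∈ stressSpace k T Γσ, inner ℝ (divergence τ) u + inner ℝ τ r = 0)
    {a : Fin T.N → ℝ} (ha : ∀ K, ∀ x ∈ (T.cell K).carrier, polyEval (ρ K) x = a K) :
    ∃ m : Fin T.N → Fin 2 → ℝ, ∀ K, ∀ x ∈ (T.cell K).carrier, ∀ i,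
      polyEval (p K i) x = polyEval (rigid (a K) (m K) i) x := by
  have hvol : ∀ K, (volume (T.cell K).carrier).toReal ≠ 0 := fun K =>
    (ENNReal.toReal_pos ((T.cell K).isOpen.measure_pos volume (T.cell K).isConnected.nonempty).ne'
      (T.cell K).isBounded.measure_lt_top.ne).ne'
  have hint : ∀ K (q : MvPolynomial (Fin 2) ℝ), IntegrableOn (polyEval q) (T.cell K).carrier :=
    fun K q => integrableOn_of_continuous (T.cell K).isBounded (continuous_polyEval q)
  -- The translation is the mean of the difference of `u` and the rotation, so that the remainder
  -- `F` has mean zero and is an admissible divergence for zero normal trace.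
  let m : Fin T.N → Fin 2 → ℝ := fun K i =>
    (∫ x in (T.cell K).carrier, (polyEval (p K i) x - polyEval (rigid (a K) 0 i) x)) /
      (volume (T.cell K).carrier).toReal
  let F : Fin T.N → Fin 2 → MvPolynomial (Fin 2) ℝ := fun K i => p K i - rigid (a K) (m K) i
  have hF : ∀ K i, (F K i).totalDegree ≤ k := fun K i =>
    (MvPolynomial.totalDegree_sub _ _).trans (max_le (hp K i) (totalDegree_rigid_le _ _ _ hk))
  have hF0 : ∀ K i, ∫ x in (T.cell K).carrier, polyEval (F K i) x = 0 := by
    intro K i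
    have e : ∀ x, polyEval (F K i) x =
        (polyEval (p K i) x - polyEval (rigid (a K) 0 i) x) - m K i := by
      intro x
      rw [polyEval_sub, polyEval_rigid_eq_add]; ring
    simp_rw [e]
    rw [integral_sub (f := fun x => polyEval (p K i) x - polyEval (rigid (a K) 0 i) x)
      ((hint K _).sub (hint K _))
      (integrableOn_of_continuous (T.cell K).isBounded continuous_const), setIntegral_const,
      smul_eq_mul, measureReal_def, mul_div_cancel₀ _ (hvol K), sub_self]
  choose c hc using hT
  choose t ht₁ ht₂ using fun K i =>
    SimplePolygon.exists_field_meanZero (hc K) (continuous_polyEval (F K i)) (hF0 K i)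
  obtain ⟨τ, hτ, hτ'⟩ := exists_mem_stressSpace (Γσ := Γσ) hΩ (k := k)
    (⟨0, fun K i => ⟨F K i, (MvPolynomial.mem_restrictTotalDegree _ _ _).2 (hF K i)⟩, 0⟩ :
      StressData k T) t
    (fun K φ h1 h2 i => by simpa using ht₂ K i φ h1 h2)
    (fun K φ h1 i => by simpa [SimplePolygon.edgeIntegral] using ht₁ K i φ h1)
    (fun φ hφ i => by simp [SimplePolygon.edgeIntegral])
  have e := h0 τ hτ
  rw [h.pairing_eq_sum (f := F) (fun K => (hτ' K).1) (fun K => (hτ' K).2)] at e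
  have hFF : ∀ K i, IntegrableOn (fun x => polyEval (F K i) x * polyEval (F K i) x)
      (T.cell K).carrier := fun K i => (T.cell K).integrableOn_polyEval_mul _ (continuous_polyEval _)
  have e2 : ∀ K i, ∫ x in (T.cell K).carrier, (polyEval (F K i) x *
      polyEval (p K i) x + inner ℝ (t K i x) (skewRow (polyEval (ρ K) x) i)) =
      ∫ x in (T.cell K).carrier, polyEval (F K i) x * polyEval (F K i) x := by
    intro K i
    -- Green's formula against the rigid motion, whose gradient is the skew row: it removes the
    -- rotation term and replaces `u` by `F` in the pairing.
    have g := SimplePolygon.integral_mul_add_inner_grad (q := fun _ _ => 0) (fun φ hφ => by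
      simpa [SimplePolygon.edgeIntegral] using ht₁ K i φ hφ)
      (contDiff_polyEval (rigid (a K) (m K) i))
    simp only [grad_rigid, zero_mul, SimplePolygon.edgeIntegral, intervalIntegral.integral_zero,
      mul_zero, Finset.sum_const_zero] at g
    have hi : IntegrableOn (fun x => polyEval (F K i) x * polyEval (rigid (a K) (m K) i) x +
        inner ℝ (t K i x) (skewRow (a K) i)) (T.cell K).carrier :=
      ((T.cell K).integrableOn_polyEval_mul _ (continuous_polyEval _)).add (by
        simpa using integrableOn_inner_skewRow (T.cell K) (t K i) (MvPolynomial.C (a K)) i)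
    rw [← zero_add (∫ x in (T.cell K).carrier, polyEval (F K i) x * polyEval (F K i) x), ← g,
      ← integral_add hi (hFF K i)]
    refine setIntegral_congr_fun (T.cell K).measurableSet fun x hx => ?_
    simp only [ha K x hx, F, polyEval_sub]
    ring
  simp_rw [e2] at e
  refine ⟨m, fun K x hx i => ?_⟩
  have hnn : ∀ K i, 0 ≤ ∫ x in (T.cell K).carrier, polyEval (F K i) x * polyEval (F K i) x :=
    fun K i => integral_nonneg fun x => mul_self_nonneg _
  have h1 := (Finset.sum_eq_zero_iff_of_nonneg fun K _ =>
    Finset.sum_nonneg fun i _ => hnn K i).1 e K (Finset.mem_univ _)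
  have h2 := (Finset.sum_eq_zero_iff_of_nonneg fun i _ => hnn K i).1 h1 i (Finset.mem_univ _)
  have h3 := (setIntegral_eq_zero_iff_of_nonneg_ae
    (Filter.Eventually.of_forall fun x => mul_self_nonneg _) (hFF K i)).1 h2
  have hcont := (continuous_polyEval (F K i)).mul (continuous_polyEval (F K i))
  have h4 := Measure.eqOn_open_of_ae_eq h3 (T.cell K).isOpen hcont.continuousOn
    (continuousOn_const (c := (0 : ℝ))) hx
  have h5 : polyEval (F K i) x = 0 := mul_self_eq_zero.1 h4
  rwa [polyEval_sub, sub_eq_zero] at h5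

/-- Testing with curl free fields with piecewise constant divergence. -/
theorem IsPiecewise.sum_edgeIntegral_eq_zero (hΩ : IsOpen Ω) (hT : T.IsStarMesh)
    {a : Fin T.N → ℝ} {m : Fin T.N → Fin 2 → ℝ}
    (h : IsPiecewise T (fun K => rigid (a K) (m K)) (fun K => MvPolynomial.C (a K)) u r)
    (h0 : ∀ τ ∈ stressSpace k T Γσ, inner ℝ (divergence τ) u + inner ℝ τ r = 0)
    (q : (K : Fin T.N) → Fin (T.cell K).n → Fin 2 → Poly k)
    (hq : ∀ φ, IsStarTest Ω Γσ φ → ∀ i : Fin 2,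
      ∑ K, ∑ e, (T.cell K).edgeIntegral e (fun x => polyEval (q K e i) x * φ x) = 0) :
    ∑ K, ∑ i, ∑ e, (T.cell K).edgeIntegral e
      (fun x => polyEval (q K e i) x * polyEval (rigid (a K) (m K) i) x) = 0 := by
  choose c hc using hT
  choose s t ht₁ ht₂ using fun K (i : Fin 2) => SimplePolygon.exists_field_edges (hc K)
    (q := fun e => polyEval (q K e i)) fun e => continuous_polyEval _
  obtain ⟨τ, hτ, hτ'⟩ := exists_mem_stressSpace (Γσ := Γσ) hΩ (k := k)
    (⟨0, fun K i => ⟨MvPolynomial.C (s K i), (MvPolynomial.mem_restrictTotalDegree _ _ _).2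
      (by simp)⟩, q⟩ : StressData k T) t
    (fun K φ h1 h2 i => by simpa using ht₂ K i φ h1 h2)
    (fun K φ h1 i => by simpa using ht₁ K i φ h1) hq
  rw [← h0 τ hτ, h.pairing_eq_sum (f := fun K i => MvPolynomial.C (s K i))
    (fun K => (hτ' K).1) (fun K => (hτ' K).2)]
  refine Finset.sum_congr rfl fun K _ => Finset.sum_congr rfl fun i _ => ?_
  -- Since the rotation is the gradient of the rigid motion, Green's formula turns the whole pairing
  -- on a cell into edge integrals.
  rw [← SimplePolygon.integral_mul_add_inner_grad (ht₁ K i)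
    (contDiff_polyEval (rigid (a K) (m K) i))]
  simp only [grad_rigid, polyEval_C]

end Pairing

end WeakSymVEM

end

noncomputable section

namespace WeakSymVEM

variable {Ω : Set Pt}

/-! ### Uniqueness of the multipliers -/

section Multipliers

variable {T : PolygonalMesh Ω} {k : ℕ} {Γσ : Set Pt} {a : Fin T.N → ℝ} {m : Fin T.N → Fin 2 → ℝ}

theorem totalDegree_sub_rigid_mem (hk : 1 ≤ k) (a a' : ℝ) (m m' : Fin 2 → ℝ) (i : Fin 2) :
    rigid a m i - rigid a' m' i ∈ Poly k :=
  (MvPolynomial.mem_restrictTotalDegree _ _ _).2 ((MvPolynomial.totalDegree_sub _ _).trans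
    (max_le (totalDegree_rigid_le _ _ _ hk) (totalDegree_rigid_le _ _ _ hk)))

theorem rigid_zero (i : Fin 2) : rigid 0 0 i = 0 := by
  unfold rigid; split_ifs <;> simp

open Classical in
/-- Edge data supported on the edge `i` of the cell `K`. -/
def singleEdge (T : PolygonalMesh Ω) (k : ℕ) (s : (K : Fin T.N) × Fin (T.cell K).n)
    (q : Fin 2 → Poly k) (K : Fin T.N) (e : Fin (T.cell K).n) : Fin 2 → Poly k :=
  if (⟨K, e⟩ : (K : Fin T.N) × Fin (T.cell K).n) = s then q else 0

theorem sum_edgeIntegral_singleEdge (s : (K : Fin T.N) × Fin (T.cell K).n) (q : Fin 2 → Poly k)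
    (i : Fin 2) (g : Fin T.N → Pt → ℝ) :
    ∑ K, ∑ e, (T.cell K).edgeIntegral e
      (fun x => polyEval (singleEdge T k s q K e i) x * g K x) =
      (T.cell s.1).edgeIntegral s.2 (fun x => polyEval (q i) x * g s.1 x) := by
  rw [Finset.sum_sigma', Finset.sum_eq_single s]
  · simp [singleEdge]
  · rintro ⟨K, e⟩ _ hne
    simp [singleEdge, hne, SimplePolygon.edgeIntegral]
  · simp

/-- Neighbouring cells carry the same rigid motion. -/
theorem rigid_eq_of_edge_eq (hk : 1 ≤ k)
    (h : ∀ q : (K : Fin T.N) → Fin (T.cell K).n → Fin 2 → Poly k,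
      (∀ φ, IsStarTest Ω Γσ φ → ∀ i : Fin 2,
        ∑ K, ∑ e, (T.cell K).edgeIntegral e (fun x => polyEval (q K e i) x * φ x) = 0) →
      ∑ K, ∑ i, ∑ e, (T.cell K).edgeIntegral e
        (fun x => polyEval (q K e i) x * polyEval (rigid (a K) (m K) i) x) = 0)
    {K L : Fin T.N} {i : Fin (T.cell K).n} {j : Fin (T.cell L).n}
    (he : (T.cell L).edge j = (T.cell K).edge i) : a K = a L ∧ m K = m L := by
  -- The jump of the rigid motions, of degree at most one and so admissible as a normal trace
  -- because `1 ≤ k`. With outward normals on both cells, continuity of the normal component means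
  -- trace `d` on one side and `-d` on the other; the pairing is then the integral of `|d|²` over
  -- the edge.
  let d : Fin 2 → Poly k := fun l =>
    ⟨rigid (a K) (m K) l - rigid (a L) (m L) l, totalDegree_sub_rigid_mem hk _ _ _ _ l⟩
  have hsub : ∀ (M : Fin T.N) (e : Fin (T.cell M).n) (l : Fin 2) (g : Pt → ℝ), Continuous g →
      (T.cell M).edgeIntegral e (fun x => polyEval ((singleEdge T k ⟨K, i⟩ d M e l -
        singleEdge T k ⟨L, j⟩ d M e l : Poly k) : MvPolynomial (Fin 2) ℝ) x * g x) =
      (T.cell M).edgeIntegral e (fun x => polyEval (singleEdge T k ⟨K, i⟩ d M e l) x * g x) -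
      (T.cell M).edgeIntegral e (fun x => polyEval (singleEdge T k ⟨L, j⟩ d M e l) x * g x) := by
    intro M e l g hg
    have hc : ∀ p : MvPolynomial (Fin 2) ℝ, IntervalIntegrable (fun t : ℝ => polyEval p
        (AffineMap.lineMap ((T.cell M).vertex e) ((T.cell M).vertex (finRotate _ e)) t) *
        g (AffineMap.lineMap ((T.cell M).vertex e) ((T.cell M).vertex (finRotate _ e)) t))
        volume 0 1 :=
      fun p => (((continuous_polyEval p).mul hg).comp
        AffineMap.lineMap_continuous).intervalIntegrable _ _
    simp_rw [SimplePolygon.edgeIntegral, Submodule.coe_sub, polyEval_sub, sub_mul]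
    rw [intervalIntegral.integral_sub (hc _) (hc _), mul_sub]
  have e := h (fun M e l => singleEdge T k ⟨K, i⟩ d M e l - singleEdge T k ⟨L, j⟩ d M e l)
    (fun φ hφ l => by
      simp_rw [hsub _ _ l φ hφ.1.1.continuous, Finset.sum_sub_distrib]
      rw [sum_edgeIntegral_singleEdge ⟨K, i⟩ d l (fun _ => φ),
        sum_edgeIntegral_singleEdge ⟨L, j⟩ d l (fun _ => φ), sub_eq_zero]
      exact (edgeIntegral_eq_of_edge_eq he _).symm)
  rw [Finset.sum_comm] at e
  simp_rw [hsub _ _ _ _ (continuous_polyEval _), Finset.sum_sub_distrib] at e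
  rw [← Finset.sum_sub_distrib] at e
  have e2 : ∀ l : Fin 2, (T.cell K).edgeIntegral i (fun x => polyEval (d l) x * polyEval (d l) x)
      = 0 := by
    have e3 : ∀ l : Fin 2, (∑ M, ∑ e, (T.cell M).edgeIntegral e (fun x =>
        polyEval (singleEdge T k ⟨K, i⟩ d M e l) x * polyEval (rigid (a M) (m M) l) x)) -
        (∑ M, ∑ e, (T.cell M).edgeIntegral e (fun x =>
        polyEval (singleEdge T k ⟨L, j⟩ d M e l) x * polyEval (rigid (a M) (m M) l) x)) =
        (T.cell K).edgeIntegral i (fun x => polyEval (d l) x * polyEval (d l) x) := by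
      intro l
      rw [sum_edgeIntegral_singleEdge ⟨K, i⟩ d l fun M => polyEval (rigid (a M) (m M) l),
        sum_edgeIntegral_singleEdge ⟨L, j⟩ d l fun M => polyEval (rigid (a M) (m M) l)]
      simp only
      rw [edgeIntegral_eq_of_edge_eq he]
      have hc : ∀ p : MvPolynomial (Fin 2) ℝ, IntervalIntegrable (fun t : ℝ => polyEval (d l)
          (AffineMap.lineMap ((T.cell K).vertex i) ((T.cell K).vertex (finRotate _ i)) t) *
          polyEval p (AffineMap.lineMap ((T.cell K).vertex i)
            ((T.cell K).vertex (finRotate _ i)) t)) volume 0 1 :=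
        fun p => (((continuous_polyEval _).mul (continuous_polyEval p)).comp
          AffineMap.lineMap_continuous).intervalIntegrable _ _
      unfold SimplePolygon.edgeIntegral
      rw [← mul_sub, ← intervalIntegral.integral_sub (hc _) (hc _)]
      simp_rw [← mul_sub, ← polyEval_sub]
      rfl
    simp_rw [e3] at e
    intro l
    exact (Finset.sum_eq_zero_iff_of_nonneg fun l _ =>
      edgeIntegral_nonneg fun x => mul_self_nonneg _).1 e l (Finset.mem_univ _)
  have e4 := fun l => eq_zero_of_edgeIntegral_sq_eq_zero (continuous_polyEval (d l).1) (e2 l)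
  refine rigid_eq_of_two_points ((T.cell K).vertex_ne i) (fun l => ?_) (fun l => ?_)
  · have := (e4 l).1
    rwa [polyEval_sub, sub_eq_zero] at this
  · have := (e4 l).2
    rwa [polyEval_sub, sub_eq_zero] at this

/-- The rigid motion of a cell with an edge on `Γu` vanishes. -/
theorem rigid_eq_zero_of_edge_subset (hk : 1 ≤ k) {Γu : Set Pt}
    (hΓ : IsBoundaryPartition Ω Γu Γσ)
    (h : ∀ q : (K : Fin T.N) → Fin (T.cell K).n → Fin 2 → Poly k,
      (∀ φ, IsStarTest Ω Γσ φ → ∀ i : Fin 2,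
        ∑ K, ∑ e, (T.cell K).edgeIntegral e (fun x => polyEval (q K e i) x * φ x) = 0) →
      ∑ K, ∑ i, ∑ e, (T.cell K).edgeIntegral e
        (fun x => polyEval (q K e i) x * polyEval (rigid (a K) (m K) i) x) = 0)
    {K : Fin T.N} {i : Fin (T.cell K).n} (he : (T.cell K).edge i ⊆ closure Γu) :
    a K = 0 ∧ m K = 0 := by
  let d : Fin 2 → Poly k := fun l => ⟨rigid (a K) (m K) l,
    (MvPolynomial.mem_restrictTotalDegree _ _ _).2 (totalDegree_rigid_le _ _ _ hk)⟩
  have e := h (singleEdge T k ⟨K, i⟩ d) (fun φ hφ l => by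
    rw [sum_edgeIntegral_singleEdge ⟨K, i⟩ d l (fun _ => φ)]
    -- No cancellation with another cell is needed: a test function meeting the boundary only within
    -- `Γσ` vanishes on the closure of `Γu`.
    refine edgeIntegral_eq_zero _ _ fun x hx => ?_
    suffices hxs : x ∉ tsupport φ by rw [image_eq_zero_of_notMem_tsupport hxs, mul_zero]
    intro hxs
    have hxu := he hx
    have hxf : x ∈ frontier Ω := by
      rw [hΓ.cover]; exact Or.inl hxu
    exact disjoint_left.1 hΓ.disjoint_closure.2 (hφ.2 ⟨hxs, hxf⟩) hxu)
  rw [Finset.sum_comm] at e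
  have e1 : ∀ l : Fin 2, (∑ M, ∑ e, (T.cell M).edgeIntegral e (fun x =>
      polyEval (singleEdge T k ⟨K, i⟩ d M e l) x * polyEval (rigid (a M) (m M) l) x)) =
      (T.cell K).edgeIntegral i (fun x => polyEval (d l) x * polyEval (d l) x) := fun l =>
    sum_edgeIntegral_singleEdge ⟨K, i⟩ d l fun M => polyEval (rigid (a M) (m M) l)
  simp_rw [e1] at e
  have e2 : ∀ l : Fin 2, (T.cell K).edgeIntegral i (fun x => polyEval (d l) x * polyEval (d l) x)
      = 0 := fun l => (Finset.sum_eq_zero_iff_of_nonneg fun l _ =>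
      edgeIntegral_nonneg fun x => mul_self_nonneg _).1 e l (Finset.mem_univ _)
  have e4 := fun l => eq_zero_of_edgeIntegral_sq_eq_zero (continuous_polyEval (d l).1) (e2 l)
  refine rigid_eq_of_two_points ((T.cell K).vertex_ne i) (fun l => ?_) (fun l => ?_)
  · rw [rigid_zero, polyEval_zero]; exact (e4 l).1
  · rw [rigid_zero, polyEval_zero]; exact (e4 l).2

end Multipliers

/-- The discrete multipliers are determined by their pairing with the discrete stresses. -/
theorem eq_zero_of_forall_pairing_eq_zero {Γu Γσ : Set Pt} (hΩ : IsPolygonalDomain Ω)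
    (hΓ : IsBoundaryPartition Ω Γu Γσ) {T : PolygonalMesh Ω} (hF : T.Fits Γu Γσ)
    (hT : T.IsStarMesh) {k : ℕ} (hk : 1 ≤ k) {u : L2Vec Ω} {r : L2Ten Ω}
    (hu : u ∈ velocitySpace k T) (hr : r ∈ rotationSpace k T)
    (h0 : ∀ τ ∈ stressSpace k T Γσ, inner ℝ (divergence τ) u + inner ℝ τ r = 0) :
    u = 0 ∧ r = 0 := by
  obtain ⟨p, ρ, h, hp, hρ⟩ := exists_isPiecewise hu hr
  choose a ha using h.exists_rotation_const hΩ.isOpen hρ h0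
  obtain ⟨m, hm⟩ := h.exists_rigid hΩ.isOpen hT hk hp h0 ha
  have h' : IsPiecewise T (fun K => rigid (a K) (m K)) (fun K => MvPolynomial.C (a K)) u r := by
    refine ⟨fun K => ?_, fun K => ?_⟩
    · filter_upwards [h.vec K, ae_restrict_mem (T.cell K).measurableSet] with x hx hxK i
      rw [hx, hm K x hxK]
    · filter_upwards [h.skew K, ae_restrict_mem (T.cell K).measurableSet] with x hx hxK i j
      rw [hx, ha K x hxK, polyEval_C]
  have hsum := h'.sum_edgeIntegral_eq_zero hΩ.isOpen hT h0
  obtain ⟨K₀, i₀, he₀⟩ := hT.exists_edge_subset hΩ hΓ hF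
  have hA := hT.eq_univ_of_neighbours hΩ.isOpen hΩ.isConnected.isPreconnected
    {K | a K = 0 ∧ m K = 0} ⟨K₀, rigid_eq_zero_of_edge_subset hk hΓ hsum he₀⟩
    (fun K hK L _ i j he => by
      obtain ⟨h1, h2⟩ := rigid_eq_of_edge_eq hk hsum he
      exact ⟨h1 ▸ hK.1, h2 ▸ hK.2⟩)
  have hz : ∀ K, a K = 0 ∧ m K = 0 := fun K => by
    have : K ∈ {K | a K = 0 ∧ m K = 0} := hA ▸ mem_univ K
    exact this
  constructor
  · refine PolygonalMesh.ext_of_cells (T := T) fun K => ?_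
    filter_upwards [h'.vec K, ae_mono (T.restrict_cell_le K)
      (Lp.coeFn_zero Pt 2 (volume.restrict Ω))] with x h1 h2
    rw [h2]
    ext i
    rw [h1, (hz K).1, (hz K).2, rigid_zero, polyEval_zero]
    rfl
  · refine PolygonalMesh.ext_of_cells (T := T) fun K => ?_
    filter_upwards [h'.skew K, ae_mono (T.restrict_cell_le K)
      (Lp.coeFn_zero Ten 2 (volume.restrict Ω))] with x h1 h2
    rw [h2]
    ext ⟨i, j⟩
    rw [h1, (hz K).1, polyEval_C]
    fin_cases i <;> fin_cases j <;> simp [skewRow]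

end WeakSymVEM

end

noncomputable section

namespace WeakSymVEM

variable {Ω : Set Pt}

/-! ### The divergence operator on the discrete stress space -/

/-- The graph of the weak divergence is a closed subspace. -/
theorem exists_weakDiv_graph (hΩ : IsOpen Ω) : ∃ W : Submodule ℝ (L2Ten Ω × L2Vec Ω),
    IsClosed (W : Set (L2Ten Ω × L2Vec Ω)) ∧ ∀ τ f, (τ, f) ∈ W ↔ IsWeakDiv Ω τ f := by
  choose F hF using fun (φ : testSpaceIn Ω) (i : Fin 2) =>
    exists_inner_eq_setIntegral (Ω := Ω) subset_rfl hΩ.measurableSet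
      φ.2.1.memLp_grad_volume i
  have hG : ∀ (φ : testSpaceIn Ω) (i : Fin 2), ∃ G : L2Vec Ω, ∀ f : L2Vec Ω,
      inner ℝ G f = ∫ x in Ω, f x i * φ.1 x := by
    intro φ i
    have h1 : MemLp (fun x => EuclideanSpace.single i (φ.1 x)) 2 (volume.restrict Ω) := by
      have h2 : MemLp φ.1 2 (volume.restrict Ω) :=
        (φ.2.1.1.continuous.memLp_of_hasCompactSupport φ.2.1.2).restrict Ω
      rw [memLp_piLp_iff]
      intro j
      by_cases hj : j = i
      · subst hj; simpa using h2
      · simp [hj]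
    refine ⟨h1.toLp, fun f => ?_⟩
    rw [inner_L2_eq_of_ae _ _ h1.coeFn_toLp (Filter.EventuallyEq.refl _ _)]
    simp [EuclideanSpace.inner_single_left, mul_comm]
  choose G hG using hG
  let A : L2Ten Ω × L2Vec Ω →L[ℝ] (testSpaceIn Ω → Fin 2 → ℝ) :=
    ContinuousLinearMap.pi fun φ => ContinuousLinearMap.pi fun i =>
      (innerSL ℝ (F φ i)).coprod (innerSL ℝ (G φ i))
  refine ⟨LinearMap.ker A.toLinearMap, A.isClosed_ker, fun τ f => ?_⟩
  have hA : ∀ φ i, A (τ, f) φ i = (∫ x in Ω, ∑ j : Fin 2, τ x (i, j) * pderiv j φ.1 x) +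
      ∫ x in Ω, f x i * φ.1 x := by
    intro φ i
    rw [← hG]
    exact congrArg (· + inner ℝ (G φ i) f) (hF φ i τ).1
  rw [LinearMap.mem_ker]
  constructor
  · intro h φ h1 h2 i
    rw [eq_neg_iff_add_eq_zero]
    exact (hA ⟨φ, h1, h2⟩ i).symm.trans (congrFun (congrFun h _) i)
  · intro h
    funext φ i
    refine (hA φ i).trans ?_
    rw [h φ.1 φ.2.1 φ.2.2 i, neg_add_cancel]
    rfl

theorem mem_hDiv_add (hΩ : IsOpen Ω) {τ τ' : L2Ten Ω} (h : τ ∈ HDiv Ω) (h' : τ' ∈ HDiv Ω) :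
    τ + τ' ∈ HDiv Ω ∧ divergence (τ + τ') = divergence τ + divergence τ' := by
  obtain ⟨W, -, hW⟩ := exists_weakDiv_graph hΩ
  have := (hW _ _).1 (W.add_mem ((hW _ _).2 (isWeakDiv_divergence h))
    ((hW _ _).2 (isWeakDiv_divergence h')))
  exact ⟨⟨_, this⟩, divergence_eq hΩ this⟩

theorem mem_hDiv_smul (hΩ : IsOpen Ω) (a : ℝ) {τ : L2Ten Ω} (h : τ ∈ HDiv Ω) :
    a • τ ∈ HDiv Ω ∧ divergence (a • τ) = a • divergence τ := by
  obtain ⟨W, -, hW⟩ := exists_weakDiv_graph hΩ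
  have := (hW _ _).1 (W.smul_mem a ((hW _ _).2 (isWeakDiv_divergence h)))
  exact ⟨⟨_, this⟩, divergence_eq hΩ this⟩

theorem mem_hDiv_sub (hΩ : IsOpen Ω) {τ τ' : L2Ten Ω} (h : τ ∈ HDiv Ω) (h' : τ' ∈ HDiv Ω) :
    τ - τ' ∈ HDiv Ω ∧ divergence (τ - τ') = divergence τ - divergence τ' := by
  obtain ⟨W, -, hW⟩ := exists_weakDiv_graph hΩ
  have := (hW _ _).1 (W.sub_mem ((hW _ _).2 (isWeakDiv_divergence h))
    ((hW _ _).2 (isWeakDiv_divergence h')))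
  exact ⟨⟨_, this⟩, divergence_eq hΩ this⟩

/-- The divergence is a bounded operator on each closed subspace of `L²` within `H(div)`. -/
theorem exists_divergence_clm (hΩ : IsOpen Ω) (S : Submodule ℝ (L2Ten Ω))
    (hS : IsClosed (S : Set (L2Ten Ω))) (hdiv : (S : Set (L2Ten Ω)) ⊆ HDiv Ω) :
    ∃ D : S →L[ℝ] L2Vec Ω, ∀ τ : S, D τ = divergence τ.1 := by
  obtain ⟨W, hWc, hW⟩ := exists_weakDiv_graph hΩ
  have : CompleteSpace S := hS.completeSpace_coe
  let D₀ : S →ₗ[ℝ] L2Vec Ω :=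
    { toFun := fun τ => divergence τ.1
      map_add' := fun τ τ' => (mem_hDiv_add hΩ (hdiv τ.2) (hdiv τ'.2)).2
      map_smul' := fun a τ => (mem_hDiv_smul hΩ a (hdiv τ.2)).2 }
  have hgraph : (D₀.graph : Set (S × L2Vec Ω)) =
      (fun p : S × L2Vec Ω => ((p.1 : L2Ten Ω), p.2)) ⁻¹' W := by
    ext ⟨τ, f⟩
    rw [SetLike.mem_coe, LinearMap.mem_graph_iff, mem_preimage, SetLike.mem_coe, hW]
    constructor
    · intro h
      have h : f = divergence τ.1 := h
      rw [h]
      exact isWeakDiv_divergence (hdiv τ.2)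
    · intro h
      exact (divergence_eq hΩ h).symm
  -- The closed graph theorem yields boundedness without any explicit inverse estimate on the
  -- discrete space.
  have hcl : IsClosed (D₀.graph : Set (S × L2Vec Ω)) := by
    rw [hgraph]
    exact hWc.preimage (by fun_prop)
  exact ⟨ContinuousLinearMap.ofIsClosedGraph hcl, fun τ => rfl⟩

/-- The skew fields which are polynomial on each cell. -/
def rotationSubmodule (k : ℕ) (T : PolygonalMesh Ω) : Submodule ℝ (L2Ten Ω) where
  carrier := rotationSpace k T
  add_mem' := by
    rintro η η' ⟨h1, h2⟩ ⟨h1', h2'⟩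
    refine ⟨?_, (T.piecewisePoly k (Fin 2 × Fin 2)).add_mem h2 h2'⟩
    filter_upwards [h1, h1', Lp.coeFn_add η η'] with x a b c i j
    simp only [c, Pi.add_apply, PiLp.add_apply]
    rw [a i j, b i j]; ring
  zero_mem' := by
    refine ⟨?_, (T.piecewisePoly k (Fin 2 × Fin 2)).zero_mem⟩
    filter_upwards [Lp.coeFn_zero Ten 2 (volume.restrict Ω)] with x c i j
    rw [c]; simp
  smul_mem' := by
    rintro a η ⟨h1, h2⟩
    refine ⟨?_, (T.piecewisePoly k (Fin 2 × Fin 2)).smul_mem a h2⟩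
    filter_upwards [h1, Lp.coeFn_smul a η] with x b c i j
    simp only [c, Pi.smul_apply, PiLp.smul_apply, smul_eq_mul]
    rw [b i j]; ring

instance (k : ℕ) (T : PolygonalMesh Ω) : FiniteDimensional ℝ (rotationSubmodule k T) :=
  Submodule.finiteDimensional_of_le
    (show rotationSubmodule k T ≤ T.piecewisePoly k (Fin 2 × Fin 2) from fun _ h => h.2)

/-! ### Solvability of saddle point problems -/

/-- The Gram form of an injective map is positive definite, so the induced map to the dual is
injective, and surjective by equality of finite dimensions. -/
theorem exists_forall_inner_eq {Q H : Type*} [AddCommGroup Q] [Module ℝ Q]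
    [FiniteDimensional ℝ Q] [NormedAddCommGroup H] [InnerProductSpace ℝ H] (R : Q →ₗ[ℝ] H)
    (hR : Function.Injective R) (l : Q →ₗ[ℝ] ℝ) : ∃ q, ∀ q', inner ℝ (R q) (R q') = l q' := by
  let A : Q →ₗ[ℝ] Module.Dual ℝ Q :=
    { toFun := fun q => ((innerSL ℝ (R q)).toLinearMap).comp R
      map_add' := fun q q' => by ext; simp
      map_smul' := fun a q => by ext; simp }
  have hA : Function.Injective A := by
    rw [← LinearMap.ker_eq_bot, LinearMap.ker_eq_bot']
    intro q hq
    have h : inner ℝ (R q) (R q) = 0 := LinearMap.congr_fun hq q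
    rw [inner_self_eq_zero] at h
    exact hR (h.trans (map_zero R).symm)
  obtain ⟨q, hq⟩ := (LinearMap.injective_iff_surjective_of_finrank_eq_finrank
    Subspace.dual_finrank_eq.symm).1 hA l
  exact ⟨q, fun q' => LinearMap.congr_fun hq q'⟩

/-- This is the Schur complement equation after elimination of both stresses. The right argument is
`y₀ + y₁ - 2 R q`, whence the factor `1/2` in the Gram system; for two solutions the difference
gives `2 ‖R (q₂ - q)‖² = 0`. -/
theorem existsUnique_saddle {Q H : Type*} [AddCommGroup Q] [Module ℝ Q]
    [FiniteDimensional ℝ Q] [NormedAddCommGroup H] [InnerProductSpace ℝ H] (R : Q →ₗ[ℝ] H)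
    (hR : Function.Injective R) (l : Q →ₗ[ℝ] ℝ) (y₀ y₁ : H) :
    ∃ q, (∀ q', inner ℝ (R q') ((y₀ - R q) + (y₁ - R q)) = l q') ∧
      ∀ q₂, (∀ q', inner ℝ (R q') ((y₀ - R q₂) + (y₁ - R q₂)) = l q') → q₂ = q := by
  have e : ∀ q, (y₀ - R q) + (y₁ - R q) = (y₀ + y₁) - (2 : ℝ) • R q := fun q => by
    rw [two_smul]; abel
  obtain ⟨q, hq⟩ := exists_forall_inner_eq R hR
    ((1 / 2 : ℝ) • ((innerSL ℝ (y₀ + y₁)).toLinearMap.comp R - l))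
  have hq' : ∀ q', inner ℝ (R q') ((y₀ - R q) + (y₁ - R q)) = l q' := by
    intro q'
    have h1 : inner ℝ (R q) (R q') = (1 / 2 : ℝ) * (inner ℝ (y₀ + y₁) (R q') - l q') := hq q'
    rw [e, inner_sub_right, inner_smul_right, real_inner_comm, real_inner_comm (R q), h1]
    ring
  refine ⟨q, hq', fun q₂ hq₂ => ?_⟩
  have h1 := hq₂ (q₂ - q)
  rw [← hq' (q₂ - q), ← sub_eq_zero, ← inner_sub_right, e, e, sub_sub_sub_cancel_left,
    ← smul_sub, ← map_sub, ← neg_sub q₂ q, map_neg, smul_neg, inner_neg_right,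
    inner_smul_right, neg_eq_zero] at h1
  have h2 := inner_self_eq_zero.1 ((mul_eq_zero.1 h1).resolve_left two_ne_zero)
  exact sub_eq_zero.1 (hR (h2.trans (map_zero R).symm))

theorem exists_linearMap_inner_add_inner {G H : Type*} [NormedAddCommGroup G]
    [InnerProductSpace ℝ G] [NormedAddCommGroup H] [InnerProductSpace ℝ H] (V : Submodule ℝ G)
    (Z : Submodule ℝ H) (a : G) (b : H) :
    ∃ l : V × Z →ₗ[ℝ] ℝ, ∀ q, l q = inner ℝ a (q.1 : G) + inner ℝ b (q.2 : H) :=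
  ⟨((innerSL ℝ a).toLinearMap.comp V.subtype).coprod ((innerSL ℝ b).toLinearMap.comp Z.subtype),
    fun _ => rfl⟩

/-- Existence and uniqueness for a saddle point problem with two stress unknowns in a closed
subspace `S`, whose coupling form is injective on the multiplier spaces `V` and `Z`. -/
theorem existsUnique_two_stress_saddle {G H : Type*} [NormedAddCommGroup G]
    [InnerProductSpace ℝ G] [CompleteSpace G] [NormedAddCommGroup H] [InnerProductSpace ℝ H]
    (S : Submodule ℝ H) [CompleteSpace S] (D : S →L[ℝ] G) (V : Submodule ℝ G)
    [FiniteDimensional ℝ V] (Z : Submodule ℝ H) [FiniteDimensional ℝ Z]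
    (hinj : ∀ v ∈ V, ∀ η ∈ Z, (∀ τ : S, inner ℝ (D τ) v + inner ℝ (τ : H) η = 0) → v = 0 ∧ η = 0)
    (σ₀ σ₁ : H) (f u : G) (r : H) :
    ∃ (s₀ s₁ : S) (v : V) (η : Z), ∀ (t₀ t₁ : S) (w : V) (ζ : Z),
      ((∀ τ : S, inner ℝ ((t₀ : H) - σ₀) (τ : H) + inner ℝ (D τ) ((w : G) - u) +
          inner ℝ (τ : H) ((ζ : H) - r) = 0) ∧
        (∀ τ : S, inner ℝ ((t₁ : H) - σ₁) (τ : H) + inner ℝ (D τ) ((w : G) - u) +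
          inner ℝ (τ : H) ((ζ : H) - r) = 0) ∧
        (∀ x : V, inner ℝ (D (t₀ + t₁) - f) (x : G) = 0) ∧
        ∀ x : Z, inner ℝ (((t₀ + t₁ : S) : H) - (σ₀ + σ₁)) (x : H) = 0) ↔
      t₀ = s₀ ∧ t₁ = s₁ ∧ w = v ∧ ζ = η := by
  have hP : ∀ (σ : H) (τ : S), inner ℝ (S.orthogonalProjectionOnto σ) τ = inner ℝ σ (τ : H) :=
    fun σ τ => Submodule.inner_orthogonalProjectionOnto_eq_of_mem_right τ σ
  -- The Riesz representative of the coupling functional: adjoint of the divergence plus orthogonal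
  -- projection to `S`. It is defined on the full spaces, since the data `u` and `r` are not
  -- discrete.
  obtain ⟨R, hR⟩ : ∃ R : G × H →ₗ[ℝ] S, ∀ (v : G) (η : H) (τ : S),
      inner ℝ (R (v, η)) τ = inner ℝ (D τ) v + inner ℝ (τ : H) η := by
    refine ⟨((ContinuousLinearMap.adjoint D).coprod S.orthogonalProjectionOnto).toLinearMap,
      fun v η τ => ?_⟩
    rw [ContinuousLinearMap.coe_coe, ContinuousLinearMap.coprod_apply, inner_add_left,
      ContinuousLinearMap.adjoint_inner_left, hP, real_inner_comm, real_inner_comm η]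
  obtain ⟨Rq, hRq⟩ : ∃ Rq : V × Z →ₗ[ℝ] S, ∀ (v : V) (η : Z) (τ : S),
      inner ℝ (Rq (v, η)) τ = inner ℝ (D τ) (v : G) + inner ℝ (τ : H) (η : H) :=
    ⟨R.comp (V.subtype.prodMap Z.subtype), fun v η τ => hR _ _ τ⟩
  have hRinj : Function.Injective Rq := by
    rw [← LinearMap.ker_eq_bot, LinearMap.ker_eq_bot']
    rintro ⟨v, η⟩ hq
    have := hinj v v.2 η η.2 fun τ => by rw [← hRq, hq, inner_zero_left]
    exact Prod.ext (Subtype.ext this.1) (Subtype.ext this.2)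
  -- The mass term on `S` is the inner product itself, so each stress equation can be solved
  -- explicitly for its stress.
  have heq : ∀ (σ : H) (s : S) (w : V) (ζ : Z), (∀ τ : S,
      inner ℝ ((s : H) - σ) (τ : H) + inner ℝ (D τ) ((w : G) - u) +
        inner ℝ (τ : H) ((ζ : H) - r) = 0) ↔
      s = S.orthogonalProjectionOnto σ + R (u, r) - Rq (w, ζ) := by
    intro σ s w ζ
    have e : ∀ τ : S, inner ℝ ((s : H) - σ) (τ : H) + inner ℝ (D τ) ((w : G) - u) +
        inner ℝ (τ : H) ((ζ : H) - r) =
        inner ℝ (s - (S.orthogonalProjectionOnto σ + R (u, r) - Rq (w, ζ))) τ := by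
      intro τ
      rw [inner_sub_left s, inner_sub_left, inner_sub_right, inner_sub_right, inner_sub_left,
        inner_add_left, hP, hR, hRq, Submodule.coe_inner]
      ring
    simp only [e]
    rw [← sub_eq_zero (b := S.orthogonalProjectionOnto σ + R (u, r) - Rq (w, ζ))]
    exact ⟨fun h => inner_self_eq_zero.1 (h _), fun h τ => by rw [h, inner_zero_left]⟩
  obtain ⟨l, hl⟩ := exists_linearMap_inner_add_inner V Z f (σ₀ + σ₁)
  -- The two constraints together are one equation on the product of the multiplier spaces,
  -- involving the same map `Rq`; they are recovered by setting one component to zero.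
  have hcon : ∀ s : S, ((∀ x : V, inner ℝ (D s - f) (x : G) = 0) ∧
      ∀ x : Z, inner ℝ ((s : H) - (σ₀ + σ₁)) (x : H) = 0) ↔ ∀ q, inner ℝ (Rq q) s = l q := by
    intro s
    have e : ∀ x y, inner ℝ (Rq (x, y)) s - l (x, y) =
        inner ℝ (D s - f) (x : G) + inner ℝ ((s : H) - (σ₀ + σ₁)) (y : H) := by
      intro x y
      rw [hRq, hl, inner_sub_left, inner_sub_left]
      ring
    constructor
    · rintro ⟨h1, h2⟩ ⟨x, y⟩
      rw [← sub_eq_zero, e, h1, h2, add_zero]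
    · intro h
      refine ⟨fun x => ?_, fun y => ?_⟩
      · have := e x 0
        rwa [h, sub_self, ZeroMemClass.coe_zero, inner_zero_right, add_zero, eq_comm] at this
      · have := e 0 y
        rwa [h, sub_self, ZeroMemClass.coe_zero, inner_zero_right, zero_add, eq_comm] at this
  obtain ⟨⟨v, η⟩, hq, huniq⟩ := existsUnique_saddle Rq hRinj l
    (S.orthogonalProjectionOnto σ₀ + R (u, r)) (S.orthogonalProjectionOnto σ₁ + R (u, r))
  refine ⟨S.orthogonalProjectionOnto σ₀ + R (u, r) - Rq (v, η),
    S.orthogonalProjectionOnto σ₁ + R (u, r) - Rq (v, η), v, η, fun t₀ t₁ w ζ => ?_⟩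
  rw [heq, heq, hcon]
  constructor
  · rintro ⟨rfl, rfl, h⟩
    obtain ⟨rfl, rfl⟩ := Prod.ext_iff.1 (huniq _ h)
    exact ⟨rfl, rfl, rfl, rfl⟩
  · rintro ⟨rfl, rfl, rfl, rfl⟩
    exact ⟨rfl, rfl, hq⟩

/-! ### Application to the elliptic projection -/

set_option maxHeartbeats 800000 in
/-- Well-posedness of the weakly symmetric elliptic projection. -/
theorem existsUnique_isProjection {Γu Γσ : Set Pt} (hΩ : IsPolygonalDomain Ω)
    (hΓ : IsBoundaryPartition Ω Γu Γσ) {T : PolygonalMesh Ω} (hT : T.Fits Γu Γσ)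
    {η₁ η₂ : ℝ} (hη₁ : 0 < η₁) (hreg : T.ShapeRegular η₁ η₂) {k : ℕ} (hk : 1 ≤ k)
    {σ₀ σ₁ : L2Ten Ω} (u : L2Vec Ω) (r : L2Ten Ω)
    (hσ₀ : σ₀ ∈ HDivStar Ω Γσ) (hσ₁ : σ₁ ∈ HDivStar Ω Γσ) :
    ∃! s : L2Ten Ω × L2Ten Ω × L2Vec Ω × L2Ten Ω,
      IsProjection k T Γσ σ₀ σ₁ u r s.1 s.2.1 s.2.2.1 s.2.2.2 := by
  obtain ⟨S, hSc, hS⟩ := exists_closed_submodule hΩ.isOpen k T Γσ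
  have hmem : ∀ τ, τ ∈ stressSpace k T Γσ ↔ τ ∈ S := fun τ => by rw [← hS]; rfl
  have hSdiv : (S : Set (L2Ten Ω)) ⊆ HDiv Ω := fun τ h => ((hmem τ).2 h).1.1
  have : CompleteSpace S := hSc.completeSpace_coe
  obtain ⟨D, hD⟩ := exists_divergence_clm hΩ.isOpen S hSc hSdiv
  have hσ := mem_hDiv_add hΩ.isOpen hσ₀.1 hσ₁.1
  obtain ⟨s₀, s₁, v, η, h⟩ := existsUnique_two_stress_saddle S D (T.piecewisePoly k (Fin 2))
    (rotationSubmodule k T) (fun w hw ζ hζ h => eq_zero_of_forall_pairing_eq_zero hΩ hΓ hT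
      (hreg.isStarMesh hη₁) hk hw hζ fun τ hτ => by
        rw [← hD ⟨τ, (hmem τ).1 hτ⟩]; exact h _)
    σ₀ σ₁ (divergence (σ₀ + σ₁)) u r
  -- Additivity of the chosen `divergence` is available only within `H(div)`, so the hypotheses on
  -- `σ₀` and `σ₁` are needed to pass from the abstract constraint to that of the system.
  have hdiv : ∀ t₀ t₁ : S, D (t₀ + t₁) - divergence (σ₀ + σ₁) =
      divergence ((t₀ : L2Ten Ω) + (t₁ : L2Ten Ω) - σ₀ - σ₁) := by
    intro t₀ t₁
    rw [hD, ← (mem_hDiv_sub hΩ.isOpen (hSdiv (t₀ + t₁).2) hσ.1).2]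
    exact congrArg divergence (sub_sub ((t₀ : L2Ten Ω) + (t₁ : L2Ten Ω)) σ₀ σ₁).symm
  have key : ∀ (t₀ t₁ : S) (w : T.piecewisePoly k (Fin 2)) (ζ : rotationSubmodule k T),
      IsProjection k T Γσ σ₀ σ₁ u r t₀ t₁ w ζ ↔ t₀ = s₀ ∧ t₁ = s₁ ∧ w = v ∧ ζ = η := by
    intro t₀ t₁ w ζ
    rw [← h]
    constructor
    · rintro ⟨-, -, -, -, e₀, e₁, e₂, e₃⟩
      refine ⟨fun τ => ?_, fun τ => ?_, fun x => ?_, fun x => ?_⟩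
      · rw [hD]; exact e₀ _ ((hmem _).2 τ.2)
      · rw [hD]; exact e₁ _ ((hmem _).2 τ.2)
      · rw [hdiv]; exact e₂ _ x.2
      · rw [Submodule.coe_add, ← sub_sub]; exact e₃ _ x.2
    · rintro ⟨e₀, e₁, e₂, e₃⟩
      refine ⟨(hmem _).2 t₀.2, (hmem _).2 t₁.2, w.2, ζ.2, fun τ hτ => ?_, fun τ hτ => ?_,
        fun x hx => ?_, fun x hx => ?_⟩
      · rw [← hD ⟨τ, (hmem τ).1 hτ⟩]; exact e₀ ⟨τ, (hmem τ).1 hτ⟩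
      · rw [← hD ⟨τ, (hmem τ).1 hτ⟩]; exact e₁ ⟨τ, (hmem τ).1 hτ⟩
      · rw [← hdiv]; exact e₂ ⟨x, hx⟩
      · rw [sub_sub, ← Submodule.coe_add]; exact e₃ ⟨x, hx⟩
  refine ⟨(s₀, s₁, v, η), (key s₀ s₁ v η).2 ⟨rfl, rfl, rfl, rfl⟩, ?_⟩
  rintro ⟨t₀, t₁, w, ζ⟩ ht
  obtain ⟨h₀, h₁, h₂, h₃⟩ := (key ⟨t₀, (hmem _).1 ht.mem_stress₀⟩ ⟨t₁, (hmem _).1 ht.mem_stress₁⟩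
    ⟨w, ht.mem_velocity⟩ ⟨ζ, ht.mem_rotation⟩).1 ht
  rw [← h₀, ← h₁, ← h₂, ← h₃]

end WeakSymVEM

end

theorem mainTheorem8 (Ω Γu Γσ : Set WeakSymVEM.Pt)
    (hΩ : WeakSymVEM.IsPolygonalDomain Ω) (hΓ : WeakSymVEM.IsBoundaryPartition Ω Γu Γσ)
    (T : WeakSymVEM.PolygonalMesh Ω) (hT : T.Fits Γu Γσ)
    (η₁ η₂ : ℝ) (hη₁ : 0 < η₁) (hη₂ : 0 < η₂) (hreg : T.ShapeRegular η₁ η₂)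
    (k : ℕ) (hk : 1 ≤ k)
    (σ₀ σ₁ : WeakSymVEM.L2Ten Ω) (u : WeakSymVEM.L2Vec Ω) (r : WeakSymVEM.L2Ten Ω)
    (hσ₀ : σ₀ ∈ WeakSymVEM.HDivStar Ω Γσ) (hσ₁ : σ₁ ∈ WeakSymVEM.HDivStar Ω Γσ)
    (hr : r ∈ WeakSymVEM.L2Skew Ω) :
    ∃! s : WeakSymVEM.L2Ten Ω × WeakSymVEM.L2Ten Ω × WeakSymVEM.L2Vec Ω × WeakSymVEM.L2Ten Ω,
      WeakSymVEM.IsProjection k T Γσ σ₀ σ₁ u r s.1 s.2.1 s.2.2.1 s.2.2.2 :=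
  WeakSymVEM.existsUnique_isProjection hΩ hΓ hT hη₁ hreg hk u r hσ₀ hσ₁
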